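/- Notation. For $k\ge 1$ let $\tau_k=\frac1k\mathrm{Tr}$ be the normalized trace on $\mathcal M_k(\mathbb C)$ and $\|(A_1,\dots,A_p)\|_2=\big(\sum_i\tau_k(A_i^*A_i)\big)^{1/2}$ on $\mathcal M_k(\mathbb C)^p$. For $\Gamma\subseteq\mathcal M_k(\mathbb C)^p$ and $\delta>0$, let $\nu(\Gamma,\delta)$ be the minimal number of $\delta$-orbit-balls $\{A:\exists\, W\in\mathcal U(k),\ \|A-WBW^*\|_2<\delta\}$ with centers $B\in\Gamma$ that cover $\Gamma$. Let $\omega$ be a free ultrafilter on $\{1,2,3,\dots\}$, and let $\mathcal M_k(\mathbb C)^\omega$ be the quotient of the algebra of norm-bounded sequences $(X_k)_{k\ge1}$, $X_k\in\mathcal M_k(\mathbb C)$, by the ideal $\{(X_k)_k:\lim_{k\to\omega}\tau_k(X_k^*X_k)=0\}$, with trace $\tau_\omega([(X_k)_k])=\lim_{k\to\omega}\tau_k(X_k)$. Let $\mathcal N$ be a von Neumann algebra with a tracial state $\tau$, and let $\Theta$ be the set of faithful trace-preserving $*$-homomorphisms $\theta:(\mathcal N,\tau)\to(\mathcal M_k(\mathbb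 C)^\omega,\tau_\omega)$. For $x_1,\dots,x_p\in\mathcal N$, $R>0$ and a sequence $\xi=(k_m)_{m\ge1}$ of positive integers with $k_m\to\infty$, let $\mathfrak N_{R,\xi}(x_1,\dots,x_p)$ be the union over $\theta\in\Theta$ of the sets of all $((Y_{1,k})_{k\ge1},\dots,(Y_{p,k})_{k\ge1})$ in $\big(\prod_{k\ge1}\mathcal M_k(\mathbb C)\big)^p$ such that $\|Y_{i,k}\|<R$ (operator norm) for all $i,k$ and $$\big|\tau_k(Y_{j_1,k}^{\epsilon_1}\cdots Y_{j_q,k}^{\epsilon_q})-\tau_\omega(\theta(x_{j_1})^{\epsilon_1}\cdots\theta(x_{j_q})^{\epsilon_q})\big|<\tfrac1m$$ for all $m\ge 1$, $k\ge k_m$, $1\le q\le m$, $1\le j_1,\dots,j_q\le p$ and $\epsilon_i\in\{*,1\}$. Let $\mathbb P_k$ be the projection onto $\mathcal M_k(\mathbb C)^p$, and for $s\ge0$ put (with $\log 0=-\infty$) $$\mathcal H_s^\omega(x_1,\dots,x_p)=\limsup_{\delta\to0^+}\ \sup_{R>0,\ \xi}\ \lim_{k\to\omega}\frac{\log\nu\big(\mathbb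 P_k(\mathfrak N_{R,\xi}(x_1,\dots,x_p)),\delta\big)}{k^{2s}}.$$ If $\mathcal N$ is finitely generated as a von Neumann algebra, $\Theta\neq\emptyset$, and $\mathcal H_s^\omega(x_1,\dots,x_p)=c$ for every finite family of generators of $\mathcal N$, then one says that $\mathcal H_s^\omega(\mathcal N)$ is defined and equals $c$. For a discrete group $G$, let $L(G)$ be the von Neumann algebra generated by the left regular representation of $G$ on $\ell^2(G)$, with its canonical trace $\tau(a)=\langle a\delta_e,\delta_e\rangle$. Theorem. Let $n\ge0$, and let $\omega$ be any free ultrafilter on $\{1,2,3,\dots\}$. Then $\mathcal H_1^\omega(L(SL(2n+1,\mathbb Z)))=0$; that is, $L(SL(2n+1,\mathbb Z))$ is finitely generated as a von Neumann algebra, it has a faithful trace-preserving embedding into $\mathcal M_k(\mathbb C)^\omega$, and $\mathcal H_1^\omega(x_1,\dots,x_p)=0$ for every finite family $x_1,\dots,x_p$ of generators of it. -/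

import Mathlib

open Filter Topology
open scoped ENNReal Matrix Matrix.Norms.L2Operator InnerProductSpace

noncomputable section

namespace EmbDim

/-! ### Matrices with the normalized trace -/

/-- The full matrix algebra `M_k(ℂ)`, `k ≥ 1`; its norm is the operator norm. -/
abbrev Mat (k : ℕ+) : Type := Matrix (Fin k) (Fin k) ℂ

/-- The normalized trace `τ_k = (1/k) Tr` on `M_k(ℂ)`. -/
def ntrace {k : ℕ+} (A : Mat k) : ℂ := ((k : ℕ) : ℂ)⁻¹ * A.trace

/-- The trace norm `‖(A₁,…,A_n)‖₂ = (∑ τ_k(A_i* A_i))^{1/2}` on `M_k(ℂ)^n`. -/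
def twoNorm {n : ℕ} {k : ℕ+} (A : Fin n → Mat k) : ℝ :=
  Real.sqrt (∑ i, (ntrace (star (A i) * A i)).re)

/-- The orbit ball of radius `δ` centered at `B`: the tuples at `‖·‖₂`-distance `< δ` from some
unitary conjugate of `B`. -/
def orbitBall {n : ℕ} {k : ℕ+} (B : Fin n → Mat k) (δ : ℝ) : Set (Fin n → Mat k) :=
  {A | ∃ W ∈ Matrix.unitaryGroup (Fin k) ℂ, twoNorm (fun i => A i - W * B i * star W) < δ}

/-- The orbit covering number `ν(Γ, δ)`: the minimal number of orbit balls of radius `δ` with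
centers in `Γ` that cover `Γ`. -/
def orbitCoveringNumber {n : ℕ} {k : ℕ+} (Γ : Set (Fin n → Mat k)) (δ : ℝ) : ℕ∞ :=
  ⨅ (F : Set (Fin n → Mat k)) (_ : F ⊆ Γ) (_ : Γ ⊆ ⋃ B ∈ F, orbitBall B δ), F.encard

/-! ### The tracial ultraproduct of the matrix algebras -/

lemma tendsto_ofReal_complex_iff {ι : Type*} {l : Filter ι} {f : ι → ℝ} {a : ℝ} :
    Tendsto (fun i => (f i : ℂ)) l (𝓝 (a : ℂ)) ↔ Tendsto f l (𝓝 a) :=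
  ⟨fun h => by
    simpa [Function.comp_def] using (Complex.continuous_re.tendsto _).comp h,
    fun h => (Complex.continuous_ofReal.tendsto _).comp h⟩

/-- `k⁻¹ ∑ |A_ij|² = τ_k(A* A)`. -/
def frobSq {k : ℕ+} (A : Mat k) : ℝ := ((k : ℕ) : ℝ)⁻¹ * ∑ i, ∑ j, ‖A i j‖ ^ 2

lemma frobSq_nonneg {k : ℕ+} (A : Mat k) : 0 ≤ frobSq A := by
  unfold frobSq; positivity

lemma ntrace_star_mul_self {k : ℕ+} (A : Mat k) : ntrace (star A * A) = (frobSq A : ℂ) := by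
  unfold ntrace frobSq
  push_cast
  congr 1
  rw [Finset.sum_comm]
  simp [Matrix.trace, Matrix.mul_apply, Matrix.star_apply, Complex.conj_mul']

lemma frobSq_star {k : ℕ+} (A : Mat k) : frobSq (star A) = frobSq A := by
  unfold frobSq
  rw [Finset.sum_comm]
  simp [Matrix.star_apply]

lemma frobSq_add_le {k : ℕ+} (A B : Mat k) : frobSq (A + B) ≤ 2 * frobSq A + 2 * frobSq B := by
  have h : ∑ i, ∑ j, ‖(A + B) i j‖ ^ 2 ≤
      2 * (∑ i, ∑ j, ‖A i j‖ ^ 2) + 2 * ∑ i, ∑ j, ‖B i j‖ ^ 2 := by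
    simp only [Finset.mul_sum, ← Finset.sum_add_distrib]
    refine Finset.sum_le_sum fun i _ => Finset.sum_le_sum fun j _ => ?_
    have h1 : ‖(A + B) i j‖ ≤ ‖A i j‖ + ‖B i j‖ := norm_add_le _ _
    nlinarith [norm_nonneg ((A + B) i j), sq_nonneg (‖A i j‖ - ‖B i j‖)]
  have := mul_le_mul_of_nonneg_left h (show (0 : ℝ) ≤ ((k : ℕ) : ℝ)⁻¹ by positivity)
  unfold frobSq
  linarith

lemma frobSq_mul_le {k : ℕ+} (A B : Mat k) : frobSq (A * B) ≤ ‖A‖ ^ 2 * frobSq B := by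
  have h : ∑ i, ∑ j, ‖(A * B) i j‖ ^ 2 ≤ ‖A‖ ^ 2 * ∑ i, ∑ j, ‖B i j‖ ^ 2 := by
    rw [Finset.sum_comm, Finset.sum_comm (f := fun i j => ‖B i j‖ ^ 2), Finset.mul_sum]
    refine Finset.sum_le_sum fun j _ => ?_
    have h1 := Matrix.l2_opNorm_mulVec A (WithLp.toLp 2 (fun i => B i j))
    have h2 := pow_le_pow_left₀ (norm_nonneg _) h1 2
    rw [mul_pow, EuclideanSpace.norm_sq_eq, EuclideanSpace.norm_sq_eq] at h2
    simpa [Matrix.mul_apply, Matrix.mulVec, dotProduct] using h2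
  have := mul_le_mul_of_nonneg_left h (show (0 : ℝ) ≤ ((k : ℕ) : ℝ)⁻¹ by positivity)
  unfold frobSq
  linarith

lemma norm_ntrace_sq_le {k : ℕ+} (A : Mat k) : ‖ntrace A‖ ^ 2 ≤ frobSq A := by
  have hk : (0 : ℝ) < ((k : ℕ) : ℝ) := by exact_mod_cast k.pos
  have h1 : ‖A.trace‖ ≤ ∑ i, ‖A i i‖ := norm_sum_le _ _
  have h2 : (∑ i, ‖A i i‖) ^ 2 ≤ ((k : ℕ) : ℝ) * ∑ i, ‖A i i‖ ^ 2 := by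
    simpa using sq_sum_le_card_mul_sum_sq (s := Finset.univ) (f := fun i : Fin k => ‖A i i‖)
  have h3 : ∑ i, ‖A i i‖ ^ 2 ≤ ∑ i, ∑ j, ‖A i j‖ ^ 2 :=
    Finset.sum_le_sum fun i _ =>
      Finset.single_le_sum (f := fun j => ‖A i j‖ ^ 2) (fun j _ => sq_nonneg _)
        (Finset.mem_univ i)
  have h4 : ‖A.trace‖ ^ 2 ≤ ((k : ℕ) : ℝ) * ∑ i, ∑ j, ‖A i j‖ ^ 2 :=
    (pow_le_pow_left₀ (norm_nonneg _) h1 2).trans (h2.trans (by gcongr))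
  unfold ntrace frobSq
  rw [norm_mul, mul_pow, norm_inv, Complex.norm_natCast]
  calc (((k : ℕ) : ℝ)⁻¹) ^ 2 * ‖A.trace‖ ^ 2
      ≤ (((k : ℕ) : ℝ)⁻¹) ^ 2 * (((k : ℕ) : ℝ) * ∑ i, ∑ j, ‖A i j‖ ^ 2) := by gcongr
    _ = ((k : ℕ) : ℝ)⁻¹ * ∑ i, ∑ j, ‖A i j‖ ^ 2 := by field_simp

/-- The von Neumann algebra `ℓ^∞` of all norm-bounded sequences `(X_k)_k`, `X_k ∈ M_k(ℂ)`. -/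
abbrev BddSeq : Type := lp (fun k : ℕ+ => Mat k) ∞

/-- The `0`-ideal of the trace along `ω`: all `(X_k)_k` with `lim_{k → ω} τ_k(X_k* X_k) = 0`. -/
def nullIdeal (ω : Ultrafilter ℕ+) : Ideal BddSeq where
  carrier := {X | Tendsto (fun k => ntrace (star (X k) * X k)) (ω : Filter ℕ+) (𝓝 0)}
  zero_mem' := by simp [ntrace]
  add_mem' := by
    intro X Y hX hY
    simp only [Set.mem_ofPred_eq, ntrace_star_mul_self] at hX hY ⊢
    rw [← Complex.ofReal_zero, tendsto_ofReal_complex_iff] at hX hY ⊢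
    refine squeeze_zero (fun k => frobSq_nonneg _) (fun k => frobSq_add_le (X k) (Y k)) ?_
    simpa using (hX.const_mul 2).add (hY.const_mul 2)
  smul_mem' := by
    intro Z X hX
    simp only [Set.mem_ofPred_eq, ntrace_star_mul_self] at hX ⊢
    rw [← Complex.ofReal_zero, tendsto_ofReal_complex_iff] at hX ⊢
    refine squeeze_zero (fun k => frobSq_nonneg _) (fun k => ?_)
      (by simpa using hX.const_mul (‖Z‖ ^ 2))
    refine (frobSq_mul_le (Z k) (X k)).trans ?_
    have := lp.norm_apply_le_norm ENNReal.top_ne_zero Z k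
    have := frobSq_nonneg (X k)
    gcongr

lemma mem_nullIdeal_iff {ω : Ultrafilter ℕ+} {X : BddSeq} :
    X ∈ nullIdeal ω ↔ Tendsto (fun k => frobSq (X k)) (ω : Filter ℕ+) (𝓝 0) := by
  rw [← tendsto_ofReal_complex_iff, Complex.ofReal_zero]
  simp only [← ntrace_star_mul_self]
  rfl

lemma star_mem_nullIdeal {ω : Ultrafilter ℕ+} {X : BddSeq} (h : X ∈ nullIdeal ω) :
    star X ∈ nullIdeal ω := by
  rw [mem_nullIdeal_iff] at h ⊢
  simpa [lp.star_apply, frobSq_star] using h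

instance (ω : Ultrafilter ℕ+) : (nullIdeal ω).IsTwoSided where
  mul_mem_of_left {X} Y hX := by
    have h := star_mem_nullIdeal
      ((nullIdeal ω).mul_mem_left (star Y) (star_mem_nullIdeal hX))
    simpa using h

/-- The ultraproduct `M_k(ℂ)^ω` of the matrix algebras `M_k(ℂ)`, `k ≥ 1`, along `ω`. -/
abbrev MatUltra (ω : Ultrafilter ℕ+) : Type := BddSeq ⧸ nullIdeal ω

instance (ω : Ultrafilter ℕ+) : Ring (MatUltra ω) := Ideal.Quotient.ring (nullIdeal ω)

instance (ω : Ultrafilter ℕ+) : Semiring (MatUltra ω) :=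
  (Ideal.Quotient.ring (nullIdeal ω)).toSemiring

instance (ω : Ultrafilter ℕ+) : Algebra ℂ (MatUltra ω) :=
  Ideal.Quotient.algebra ℂ (I := nullIdeal ω)

instance (ω : Ultrafilter ℕ+) : StarRing (MatUltra ω) where
  star := Quotient.map' star (by
    intro X Y h
    rw [Submodule.quotientRel_def] at h ⊢
    rw [← star_sub]
    exact star_mem_nullIdeal h)
  star_involutive := by
    rintro ⟨X⟩
    exact congrArg (Ideal.Quotient.mk (nullIdeal ω)) (star_star X)
  star_mul := by
    rintro ⟨X⟩ ⟨Y⟩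
    exact congrArg (Ideal.Quotient.mk (nullIdeal ω)) (star_mul X Y)
  star_add := by
    rintro ⟨X⟩ ⟨Y⟩
    exact congrArg (Ideal.Quotient.mk (nullIdeal ω)) (star_add X Y)

instance (ω : Ultrafilter ℕ+) : StarModule ℂ (MatUltra ω) where
  star_smul := by
    rintro c ⟨X⟩
    exact congrArg (Ideal.Quotient.mk (nullIdeal ω)) (star_smul c X)

/-- The trace `τ_ω([(X_k)_k]) = lim_{k → ω} τ_k(X_k)` on `M_k(ℂ)^ω`. -/
def ultraTrace (ω : Ultrafilter ℕ+) : MatUltra ω → ℂ :=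
  Quotient.lift (fun X : BddSeq => limUnder (ω : Filter ℕ+) fun k => ntrace (X k)) (by
    intro X Y h
    have h' : X - Y ∈ nullIdeal ω := (Submodule.quotientRel_def _).1 h
    rw [mem_nullIdeal_iff] at h'
    have h0 : Tendsto (fun k => ntrace (X k) - ntrace (Y k)) (ω : Filter ℕ+) (𝓝 0) := by
      rw [tendsto_zero_iff_norm_tendsto_zero]
      have h2 : Tendsto (fun k => ‖ntrace (X k) - ntrace (Y k)‖ ^ 2) (ω : Filter ℕ+) (𝓝 0) := by
        refine squeeze_zero (fun k => sq_nonneg _) (fun k => ?_) h'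
        have := norm_ntrace_sq_le ((X - Y) k)
        simpa [ntrace, Matrix.trace_sub, mul_sub] using this
      simpa using h2.sqrt
    have key : ∀ a : ℂ, Tendsto (fun k => ntrace (X k)) (ω : Filter ℕ+) (𝓝 a) ↔
        Tendsto (fun k => ntrace (Y k)) (ω : Filter ℕ+) (𝓝 a) := fun a =>
      ⟨fun hX => by simpa using hX.sub h0, fun hY => by simpa using hY.add h0⟩
    have : (fun a : ℂ => Tendsto (fun k => ntrace (X k)) (ω : Filter ℕ+) (𝓝 a)) =
        fun a : ℂ => Tendsto (fun k => ntrace (Y k)) (ω : Filter ℕ+) (𝓝 a) :=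
      funext fun a => propext (key a)
    unfold Filter.Tendsto at this
    unfold limUnder lim
    simp only [this])

/-! ### Embeddings, neighbourhoods and embedding dimension -/

section Dim

variable {A : Type*} [Ring A] [StarRing A] [Algebra ℂ A]

/-- `Θ(A, M_k(ℂ)^ω)`: the faithful trace-preserving *-homomorphisms from `(A, τ)` into
`(M_k(ℂ)^ω, τ_ω)`. -/
def Embeddings (ω : Ultrafilter ℕ+) (τ : A → ℂ) : Set (A →⋆ₐ[ℂ] MatUltra ω) :=
  {θ | Function.Injective θ ∧ ∀ a, ultraTrace ω (θ a) = τ a}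

/-- The *-monomial `x_{j₁}^{ε₁} ⋯ x_{j_p}^{ε_p}`, where `ε = true` stands for `*` and
`ε = false` for `1`. -/
def starWord {B : Type*} [Ring B] [StarRing B] {n : ℕ} (x : Fin n → B)
    (w : List (Fin n × Bool)) : B :=
  (w.map fun q => if q.2 then star (x q.1) else x q.1).prod

/-- `Ξ`: the sequences `(k_m)_{m ≥ 1}` of positive integers that tend to infinity. -/
def Xi : Set (ℕ+ → ℕ+) := {ξ | Tendsto ξ atTop atTop}

/-- The neighbourhood `𝔑_{R,ξ}(y₁,…,y_n)` of elements of `M_k(ℂ)^ω`. -/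
def ultraNbhd {ω : Ultrafilter ℕ+} {n : ℕ} (R : ℝ) (ξ : ℕ+ → ℕ+) (y : Fin n → MatUltra ω) :
    Set (Fin n → (k : ℕ+) → Mat k) :=
  {Y | (∀ (i : Fin n) (k : ℕ+), ‖Y i k‖ < R) ∧
    ∀ m k : ℕ+, ξ m ≤ k → ∀ w : List (Fin n × Bool), 1 ≤ w.length → w.length ≤ (m : ℕ) →
      ‖ntrace (starWord (fun i => Y i k) w) - ultraTrace ω (starWord y w)‖ < 1 / ((m : ℕ) : ℝ)}

/-- The neighbourhood `𝔑_{R,ξ}(x₁,…,x_n)` of elements of `A`: the union of the neighbourhoods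
of `(θ(x₁),…,θ(x_n))` over all embeddings `θ`. -/
def nbhd (ω : Ultrafilter ℕ+) (τ : A → ℂ) {n : ℕ} (R : ℝ) (ξ : ℕ+ → ℕ+) (x : Fin n → A) :
    Set (Fin n → (k : ℕ+) → Mat k) :=
  ⋃ θ ∈ Embeddings ω τ, ultraNbhd R ξ fun i => θ (x i)

/-- The projection `ℙ_k` onto `M_k(ℂ)^n`. -/
def proj {n : ℕ} (k : ℕ+) (Y : Fin n → (k : ℕ+) → Mat k) : Fin n → Mat k := fun i => Y i k

/-- `ℋ_s^ω(x₁,…,x_n; R, ξ, δ) = lim_{k → ω} log ν(ℙ_k(𝔑_{R,ξ}(x₁,…,x_n)), δ) / k^{2s}`, an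
extended real number (`log 0 = -∞`). -/
def embDimAt (ω : Ultrafilter ℕ+) (s : ℝ) (τ : A → ℂ) {n : ℕ} (x : Fin n → A)
    (R : ℝ) (ξ : ℕ+ → ℕ+) (δ : ℝ) : EReal :=
  limUnder (ω : Filter ℕ+) fun k : ℕ+ =>
    ENNReal.log (orbitCoveringNumber (proj k '' nbhd ω τ R ξ x) δ : ℝ≥0∞) /
      ((((k : ℕ) : ℝ) ^ (2 * s) : ℝ) : EReal)

/-- The `s`-embedding dimension
`ℋ_s^ω(x₁,…,x_n) = limsup_{δ → 0} sup_{R > 0, ξ ∈ Ξ} ℋ_s^ω(x₁,…,x_n; R, ξ, δ)`. -/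
def embDim (ω : Ultrafilter ℕ+) (s : ℝ) (τ : A → ℂ) {n : ℕ} (x : Fin n → A) : EReal :=
  limsup (fun δ : ℝ => ⨆ (R : ℝ) (_ : 0 < R) (ξ : ℕ+ → ℕ+) (_ : ξ ∈ Xi),
    embDimAt ω s τ x R ξ δ) (𝓝[>] 0)

end Dim

/-! ### Von Neumann algebras -/

section VN

variable {H : Type*} [NormedAddCommGroup H] [InnerProductSpace ℂ H] [CompleteSpace H]

/-- The von Neumann algebra generated by a set `S` of operators: the double commutant of
`S ∪ S*`. -/
def vnGenerated (S : Set (H →L[ℂ] H)) : VonNeumannAlgebra H where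
  toStarSubalgebra :=
    StarSubalgebra.centralizer ℂ (StarSubalgebra.centralizer ℂ S : Set (H →L[ℂ] H))
  centralizer_centralizer' := by
    simp

/-- The finite family `x₁,…,x_n` of elements of `N` generates `N` as a von Neumann algebra. -/
def Generates (N : VonNeumannAlgebra H) {n : ℕ} (x : Fin n → N.toStarSubalgebra) : Prop :=
  vnGenerated (Set.range fun i => (x i : H →L[ℂ] H)) = N

/-- The assertion "`ℋ_s^ω(N)` is defined and equals `c`" for a von Neumann algebra `N` with
trace `τ`: `N` is finitely generated, `(N, τ)` embeds into `M_k(ℂ)^ω`, and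
`ℋ_s^ω(x₁,…,x_n) = c` for every finite family `x₁,…,x_n` of generators of `N`. -/
def HasEmbDim (ω : Ultrafilter ℕ+) (s : ℝ) (N : VonNeumannAlgebra H)
    (τ : N.toStarSubalgebra → ℂ) (c : EReal) : Prop :=
  (∃ (n : ℕ) (x : Fin n → N.toStarSubalgebra), Generates N x) ∧
  (Embeddings ω τ).Nonempty ∧
  ∀ (n : ℕ) (x : Fin n → N.toStarSubalgebra), Generates N x → embDim ω s τ x = c

end VN

/-! ### Group von Neumann algebras -/

section GroupVN

variable (G : Type*) [Group G]

/-- The Hilbert space `ℓ²(G)`. -/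
abbrev ell2 : Type _ := lp (fun _ : G => ℂ) 2

variable {G}

/-- The left regular representation, `(λ_g f)(h) = f(g⁻¹ h)`. -/
def leftRegular (g : G) : ell2 G →L[ℂ] ell2 G :=
  LinearMap.mkContinuous
    { toFun := fun f => ⟨fun h => f (g⁻¹ * h), by
        have hf := (memℓp_gen_iff (by norm_num)).1 (lp.memℓp f)
        exact (memℓp_gen_iff (by norm_num)).2 ((Equiv.mulLeft g⁻¹).summable_iff.2 hf)⟩
      map_add' := fun _ _ => rfl
      map_smul' := fun _ _ => rfl } 1 (by
    intro f
    rw [one_mul, lp.norm_eq_tsum_rpow (by norm_num), lp.norm_eq_tsum_rpow (by norm_num)]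
    exact le_of_eq (congrArg (· ^ (1 / (2 : ℝ≥0∞).toReal))
      ((Equiv.mulLeft g⁻¹).tsum_eq fun h => ‖f h‖ ^ (2 : ℝ≥0∞).toReal)))

lemma leftRegular_apply (g : G) (f : ell2 G) (h : G) : leftRegular g f h = f (g⁻¹ * h) := rfl

variable (G)

/-- The group von Neumann algebra `L(G)`, generated by the left regular representation of `G`
on `ℓ²(G)`. -/
def groupVN : VonNeumannAlgebra (ell2 G) := vnGenerated (Set.range leftRegular)

open Classical in
/-- The canonical trace `τ(a) = ⟨a δ_e, δ_e⟩` on `L(G)`. -/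
def groupTrace (a : (groupVN G).toStarSubalgebra) : ℂ :=
  ⟪(lp.single 2 (1 : G) (1 : ℂ) : ell2 G), (a : ell2 G →L[ℂ] ell2 G) (lp.single 2 (1 : G) (1 : ℂ))⟫_ℂ

end GroupVN

end EmbDim

end

open Filter Topology
open scoped ENNReal Matrix Matrix.Norms.L2Operator InnerProductSpace

noncomputable section

/-! Upper bound. Tuples of matrices whose moments approach those of the generators form a filter
(`momentFilter`), and along it every operator of the generated algebra lifts to a bounded
matrix-valued function of the tuple, unique up to families that are null in the trace norm
(`IsMatrixModel.exists_lift`). Hence each group element `g` has matrices `U g` at every tuple, and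
one can count the simultaneous unitary orbits of finitely many such functions up to small errors:
`HasSmallOrbits` says that for every `θ > 0` at most `exp (θ k²)` classes suffice. This count passes
to anything approximated in the trace norm by star polynomials (`HasSmallOrbits.of_isDetermined`),
so a bound for the group elements bounds the generators, whichever they are.

The group elements are controlled one at a time. A self-adjoint matrix is determined up to
conjugation by its `k` eigenvalues, which costs only `exp (O(k))`. The main step is
`HasSmallOrbits.insert_of_sandwich`. Suppose that `v` is almost fixed by `V ↦ ∑ a_p V c_p`, with
coefficients already controlled and with squared Hilbert–Schmidt norm at most `h k²` for a small
`h`. After the coefficients are conjugated close to those of a reference tuple, `v` is an almost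
fixed point of one operator, hence close to a subspace whose dimension is a small multiple of `k²`.
A volume estimate then allows only `exp (θ k²)` positions.

If `v` conjugates infinitely many controlled elements `s_p` to controlled ones, the averages of `(v
s_p v⁻¹) V s_p*` fix `v`. Orthogonality of distinct group elements under the trace gives them the
limiting normalized Hilbert–Schmidt square `1 / n` (`HasSmallOrbits.insert_of_conj`); a variant
starts from `g + g⁻¹` and recovers an element `g` of infinite order. In `SL_ι(ℤ)` with `|ι| ≥ 3`,
elementary matrices sharing a row or a column commute and have infinite order, so all of them are
reached in three rounds (`univ_of_centralizers`), and they generate the group. If `|ι| ≤ 1` the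
group is trivial.

Lower bound. It is enough to have one sequence of microstates. Congruence quotients give almost free
actions on sets of `k` points for large `k`; their permutation matrices form a matrix model along
`atTop`, and the same lifting theorem yields both the embedding and the microstates. -/

namespace EmbDim

/-! ### Bounded transforms in C*-algebras -/

section CStar

variable {A : Type*} [CStarAlgebra A]

/-- The bounded transform `a ↦ a (1 + a²)⁻¹` of a self-adjoint element, inside any closed
star subalgebra. -/
lemma exists_boundedTransform (R : StarSubalgebra ℂ A) (hR : IsClosed (R : Set A)) {a : A}
    (ha : a ∈ R) (hsa : IsSelfAdjoint a) :
    ∃ f ∈ R, ∃ u : A, ‖f‖ ≤ 1 / 2 ∧ ‖u‖ ≤ 1 ∧ u * (1 + a * a) = 1 ∧ (1 + a * a) * u = 1 ∧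
      f = u * a ∧ f = a * u := by
  have hlt : ∀ t : ℝ, 0 < 1 + t * t := fun t => by nlinarith [mul_self_nonneg t]
  have hpos : ∀ t : ℝ, 1 + t * t ≠ 0 := fun t => (hlt t).ne'
  have hcu : Continuous fun t : ℝ => (1 + t * t)⁻¹ := by fun_prop (disch := exact hpos _)
  have hcp : Continuous fun t : ℝ => 1 + t * t := by fun_prop
  have hP : cfc (fun t : ℝ => 1 + t * t) a = 1 + a * a := by
    rw [cfc_add (a := a) (fun _ => (1 : ℝ)) (fun t => t * t), cfc_mul (fun t : ℝ => t) (fun t => t) a,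
      cfc_id' ℝ a, cfc_const_one ℝ a]
  have hf : cfc (fun t : ℝ => (1 + t * t)⁻¹ * t) a = cfc (fun t : ℝ => (1 + t * t)⁻¹) a * a := by
    rw [cfc_mul (fun t : ℝ => (1 + t * t)⁻¹) (fun t => t) a hcu.continuousOn, cfc_id' ℝ a]
  have hf' : cfc (fun t : ℝ => (1 + t * t)⁻¹ * t) a = a * cfc (fun t : ℝ => (1 + t * t)⁻¹) a := by
    rw [show (fun t : ℝ => (1 + t * t)⁻¹ * t) = fun t => t * (1 + t * t)⁻¹ from
      funext fun t => mul_comm _ _, cfc_mul (fun t : ℝ => t) (fun t => (1 + t * t)⁻¹) a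
        continuousOn_id hcu.continuousOn, cfc_id' ℝ a]
  refine ⟨cfc (fun t : ℝ => (1 + t * t)⁻¹ * t) a, cfc_mem (hs := hR) _ ha,
    cfc (fun t : ℝ => (1 + t * t)⁻¹) a, ?_, ?_, ?_, ?_, hf, hf'⟩
  · refine norm_cfc_le (by norm_num) fun t _ => ?_
    rw [Real.norm_eq_abs, abs_mul, abs_inv, abs_of_pos (hlt t),
      inv_mul_le_iff₀ (hlt t)]
    nlinarith [sq_nonneg (|t| - 1), abs_mul_abs_self t]
  · refine norm_cfc_le zero_le_one fun t _ => ?_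
    rw [Real.norm_eq_abs, abs_inv, abs_of_pos (hlt t)]
    exact inv_le_one_of_one_le₀ (by nlinarith [mul_self_nonneg t])
  · rw [← hP, ← cfc_mul _ _ a hcu.continuousOn hcp.continuousOn]
    simp only [inv_mul_cancel₀ (hpos _)]
    exact cfc_const_one ℝ a
  · rw [← hP, ← cfc_mul _ _ a hcp.continuousOn hcu.continuousOn]
    simp only [mul_inv_cancel₀ (hpos _)]
    exact cfc_const_one ℝ a

/-- Every self-adjoint element of norm at most `1/2` is a bounded transform. -/
lemma exists_eq_boundedTransform (R : StarSubalgebra ℂ A) (hR : IsClosed (R : Set A)) {h : A}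
    (hh : h ∈ R) (hsa : IsSelfAdjoint h) (hn : ‖h‖ ≤ 1 / 2) :
    ∃ c ∈ R, IsSelfAdjoint c ∧ h * (1 + c * c) = c := by
  -- The root `s` of `t * (1 + s ^ 2) = s` that vanishes at `t = 0`, written without division by
  -- `t`. Outside `[-1/2, 1/2]` the square root is `0` by convention, which keeps `g` continuous on
  -- all of `ℝ`.
  let g : ℝ → ℝ := fun t => 2 * t * (1 + √(1 - 4 * t ^ 2))⁻¹
  have hg : Continuous g := by
    have : ∀ t : ℝ, 1 + √(1 - 4 * t ^ 2) ≠ 0 := fun t => by positivity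
    fun_prop (disch := exact this _)
  refine ⟨cfc g h, cfc_mem (hs := hR) _ hh, cfc_predicate g h, ?_⟩
  have h1 : cfc (fun t => t * (1 + g t * g t)) h = h * (1 + cfc g h * cfc g h) := by
    have hc : Continuous fun t => g t * g t := by fun_prop
    rw [cfc_mul (fun t : ℝ => t) (fun t => 1 + g t * g t) h continuousOn_id
      (by fun_prop), cfc_id' ℝ h,
      cfc_add (a := h) (fun _ => (1 : ℝ)) (fun t => g t * g t) continuousOn_const hc.continuousOn,
      cfc_mul g g h hg.continuousOn hg.continuousOn, cfc_const_one ℝ h]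
  rw [← h1]
  refine cfc_congr fun t ht => ?_
  have ht' : |t| ≤ 1 / 2 := by
    have := spectrum.norm_le_norm_mul_of_mem ht
    rw [Real.norm_eq_abs] at this
    refine this.trans ?_
    rcases subsingleton_or_nontrivial A with _ | _
    · simp [Subsingleton.elim (1 : A) 0]
    · simpa [CStarRing.norm_one] using hn
  have hnn : 0 ≤ 1 - 4 * t ^ 2 := by nlinarith [sq_abs t, abs_nonneg t]
  have hs := Real.sq_sqrt hnn
  have hs0 := Real.sqrt_nonneg (1 - 4 * t ^ 2)
  simp only [g]
  set s := √(1 - 4 * t ^ 2)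
  have : (1 + s) ≠ 0 := by positivity
  field_simp
  linear_combination t * hs

end CStar

/-! ### The normalized Hilbert–Schmidt norm -/

section HSNorm

variable {k : ℕ+}

/-- The normalized Hilbert–Schmidt norm `τ_k(A* A)^{1/2}`. -/
def hsNorm (A : Mat k) : ℝ := √(frobSq A)

/-- A matrix as a vector in a Euclidean space. -/
def toVec : Mat k ≃ₗ[ℂ] EuclideanSpace ℂ (Fin k × Fin k) where
  toFun A := WithLp.toLp 2 fun p => A p.1 p.2
  invFun v := Matrix.of fun i j => v (i, j)
  map_add' _ _ := rfl
  map_smul' _ _ := rfl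
  left_inv _ := rfl
  right_inv _ := rfl

lemma toVec_apply (A : Mat k) (p : Fin k × Fin k) : toVec A p = A p.1 p.2 := rfl

lemma sqrt_natCast_pos (k : ℕ+) : 0 < √((k : ℕ) : ℝ) :=
  Real.sqrt_pos.2 (by exact_mod_cast k.pos)

lemma norm_toVec (A : Mat k) : ‖toVec A‖ = √((k : ℕ) : ℝ) * hsNorm A := by
  have hk : (0 : ℝ) < ((k : ℕ) : ℝ) := by exact_mod_cast k.pos
  rw [hsNorm, ← Real.sqrt_mul hk.le, EuclideanSpace.norm_eq, frobSq,
    mul_inv_cancel_left₀ hk.ne', Fintype.sum_prod_type]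
  rfl

lemma hsNorm_eq (A : Mat k) : hsNorm A = ‖toVec A‖ / √((k : ℕ) : ℝ) := by
  rw [norm_toVec, mul_div_cancel_left₀ _ (sqrt_natCast_pos k).ne']

lemma hsNorm_nonneg (A : Mat k) : 0 ≤ hsNorm A := Real.sqrt_nonneg _

lemma hsNorm_sq (A : Mat k) : hsNorm A ^ 2 = frobSq A := Real.sq_sqrt (frobSq_nonneg A)

@[simp] lemma hsNorm_zero : hsNorm (0 : Mat k) = 0 := by simp [hsNorm_eq]

lemma hsNorm_add_le (A B : Mat k) : hsNorm (A + B) ≤ hsNorm A + hsNorm B := by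
  simp only [hsNorm_eq, map_add, ← add_div]
  exact div_le_div_of_nonneg_right (norm_add_le _ _) (Real.sqrt_nonneg _)

@[simp] lemma hsNorm_neg (A : Mat k) : hsNorm (-A) = hsNorm A := by simp [hsNorm_eq]

lemma hsNorm_sub_rev (A B : Mat k) : hsNorm (A - B) = hsNorm (B - A) := by
  rw [← hsNorm_neg, neg_sub]

lemma hsNorm_sub_le (A B C : Mat k) : hsNorm (A - C) ≤ hsNorm (A - B) + hsNorm (B - C) := by
  simpa using hsNorm_add_le (A - B) (B - C)

lemma hsNorm_smul (c : ℂ) (A : Mat k) : hsNorm (c • A) = ‖c‖ * hsNorm A := by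
  simp [hsNorm_eq, norm_smul, mul_div_assoc]

lemma hsNorm_sum_le {ι : Type*} (s : Finset ι) (A : ι → Mat k) :
    hsNorm (∑ i ∈ s, A i) ≤ ∑ i ∈ s, hsNorm (A i) := by
  classical
  induction s using Finset.induction_on with
  | empty => simp
  | insert a s ha ih =>
    rw [Finset.sum_insert ha, Finset.sum_insert ha]
    exact (hsNorm_add_le _ _).trans (by gcongr)

@[simp] lemma hsNorm_star (A : Mat k) : hsNorm (star A) = hsNorm A := by
  rw [hsNorm, frobSq_star, hsNorm]

lemma hsNorm_mul_le (A B : Mat k) : hsNorm (A * B) ≤ ‖A‖ * hsNorm B := by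
  refine Real.sqrt_le_iff.2 ⟨mul_nonneg (norm_nonneg _) (hsNorm_nonneg _), ?_⟩
  rw [mul_pow, hsNorm_sq]
  exact frobSq_mul_le A B

lemma hsNorm_mul_le' (A B : Mat k) : hsNorm (A * B) ≤ hsNorm A * ‖B‖ := by
  rw [← hsNorm_star, star_mul, mul_comm, ← norm_star B, ← hsNorm_star A]
  exact hsNorm_mul_le _ _

lemma hsNorm_one : hsNorm (1 : Mat k) = 1 := by
  have h := ntrace_star_mul_self (1 : Mat k)
  have hk : ((k : ℕ) : ℂ) ≠ 0 := by exact_mod_cast k.pos.ne'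
  rw [star_one, one_mul, ntrace, Matrix.trace_one, Fintype.card_fin, inv_mul_cancel₀ hk] at h
  rw [hsNorm, ← Complex.ofReal_one.symm.trans h |> Complex.ofReal_injective, Real.sqrt_one]

lemma hsNorm_le_norm (A : Mat k) : hsNorm A ≤ ‖A‖ := by
  simpa [hsNorm_one] using hsNorm_mul_le A 1

lemma norm_ntrace_le (A : Mat k) : ‖ntrace A‖ ≤ hsNorm A :=
  Real.le_sqrt_of_sq_le (norm_ntrace_sq_le A)

lemma ntrace_sub (A B : Mat k) : ntrace (A - B) = ntrace A - ntrace B := by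
  simp [ntrace, Matrix.trace_sub, mul_sub]

lemma ntrace_add (A B : Mat k) : ntrace (A + B) = ntrace A + ntrace B := by
  simp [ntrace, Matrix.trace_add, mul_add]

lemma ntrace_smul (c : ℂ) (A : Mat k) : ntrace (c • A) = c * ntrace A := by
  simp [ntrace, Matrix.trace_smul, mul_left_comm]

lemma ntrace_zero : ntrace (0 : Mat k) = 0 := by simp [ntrace]

lemma norm_unitary_le {W : Mat k} (hW : W ∈ Matrix.unitaryGroup (Fin k) ℂ) : ‖W‖ ≤ 1 := by
  exact (CStarRing.norm_of_mem_unitary hW).le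

lemma hsNorm_conj {W : Mat k} (hW : W ∈ Matrix.unitaryGroup (Fin k) ℂ) (A : Mat k) :
    hsNorm (W * A * star W) ≤ hsNorm A := by
  refine (hsNorm_mul_le' _ _).trans ?_
  rw [norm_star]
  refine (mul_le_of_le_one_right (hsNorm_nonneg _) (norm_unitary_le hW)).trans ?_
  exact (hsNorm_mul_le _ _).trans (mul_le_of_le_one_left (hsNorm_nonneg _) (norm_unitary_le hW))

end HSNorm

/-! ### Matrix models and lifts of operators -/

section Lift

variable {I : Type*} {H : Type*} [NormedAddCommGroup H] [InnerProductSpace ℂ H] [CompleteSpace H]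

/-- Bounded families of matrices of sizes `d i`. -/
abbrev MatFam (d : I → ℕ+) : Type _ := lp (fun i => Mat (d i)) ∞

instance (d : I → ℕ+) : CStarAlgebra (MatFam d) where

/-- `𝒜` consists of pairs `(a, b)` of a bounded family of matrices and an element `b` of `N`, such
that the normalized traces of `a` converge along `l` to the vector trace of `b` at `e`, and the
second components are dense in `N` in the trace norm. -/
structure IsMatrixModel {d : I → ℕ+} (l : Filter I) (N : VonNeumannAlgebra H) (e : H)
    (𝒜 : StarSubalgebra ℂ (MatFam d × (H →L[ℂ] H))) : Prop where
  mem : ∀ a ∈ 𝒜, a.2 ∈ N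
  dense : ∀ y ∈ N, ∀ η > 0, ∃ a ∈ 𝒜, ‖(a.2 - y) e‖ < η
  trace : ∀ a ∈ 𝒜, Tendsto (fun i => ntrace (a.1 i)) l (𝓝 ⟪e, a.2 e⟫_ℂ)
  norm_e : ‖e‖ = 1
  tracial : ∀ x ∈ N, ∀ y ∈ N, ⟪e, x (y e)⟫_ℂ = ⟪e, y (x e)⟫_ℂ

/-- Commutants are norm closed. This keeps continuous functional calculus inside `N`. -/
lemma VonNeumannAlgebra.isClosed (N : VonNeumannAlgebra H) :
    IsClosed (N.toStarSubalgebra : Set (H →L[ℂ] H)) := by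
  rw [VonNeumannAlgebra.coe_toStarSubalgebra, ← N.centralizer_centralizer]
  exact Set.isClosed_centralizer _

section TraceNorm

variable {N : VonNeumannAlgebra H} {e : H}

lemma inner_star_mul_self (y : H →L[ℂ] H) : ⟪e, (star y * y) e⟫_ℂ = ((‖y e‖ ^ 2 : ℝ) : ℂ) := by
  rw [ContinuousLinearMap.star_eq_adjoint, mul_apply_eq_comp,
    ContinuousLinearMap.adjoint_inner_right, inner_self_eq_norm_sq_to_K]
  norm_cast

/-- `‖y e‖ ^ 2` is the vector state of `star y * y`, and traciality exchanges the two factors. -/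
lemma norm_star_apply_of_tracial (ht : ∀ x ∈ N, ∀ y ∈ N, ⟪e, x (y e)⟫_ℂ = ⟪e, y (x e)⟫_ℂ)
    {y : H →L[ℂ] H} (hy : y ∈ N) : ‖(star y) e‖ = ‖y e‖ := by
  have h1 := inner_star_mul_self (e := e) y
  have h2 := inner_star_mul_self (e := e) (star y)
  rw [star_star, mul_apply_eq_comp, ht _ hy _ (star_mem hy)] at h2
  rw [mul_apply_eq_comp, h2] at h1
  have h3 := Complex.ofReal_injective h1
  exact (pow_left_inj₀ (norm_nonneg _) (norm_nonneg _) two_ne_zero).1 h3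

/-- Taking adjoints turns right multiplication into left multiplication at no cost in the trace
norm. -/
lemma norm_mul_apply_of_tracial (ht : ∀ x ∈ N, ∀ y ∈ N, ⟪e, x (y e)⟫_ℂ = ⟪e, y (x e)⟫_ℂ)
    {y z : H →L[ℂ] H} (hy : y ∈ N) (hz : z ∈ N) : ‖(y * z) e‖ ≤ ‖y e‖ * ‖z‖ := by
  rw [← norm_star_apply_of_tracial ht (mul_mem hy hz), star_mul,
    ← norm_star_apply_of_tracial ht hy, ← norm_star z, mul_comm]
  exact (star z).le_opNorm _

/-- The bounded transform is Lipschitz in the trace norm. -/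
lemma norm_boundedTransform_sub_le
    (ht : ∀ x ∈ N, ∀ y ∈ N, ⟪e, x (y e)⟫_ℂ = ⟪e, y (x e)⟫_ℂ)
    {a c f g u v : H →L[ℂ] H} (ha : a ∈ N) (hc : c ∈ N) (hf : f = u * a)
    (hv : (1 + c * c) * v = 1) (hu : u * (1 + a * a) = 1) (hvN : v ∈ N) (hgN : g ∈ N)
    (hun : ‖u‖ ≤ 1) (hvn : ‖v‖ ≤ 1) (hfn : ‖f‖ ≤ 1) (hgn : ‖g‖ ≤ 1) (hcv : g = c * v) :
    ‖(f - g) e‖ ≤ 2 * ‖(a - c) e‖ := by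
  have hac := sub_mem ha hc
  -- A resolvent identity, from `a (1 + c²) - (1 + a²) c = (a - c) - a (a - c) c`. Each term
  -- contains `a - c` once, between contractions, so no bound on `a` or `c` is needed.
  have key : f - g = u * ((a - c) * v) - f * ((a - c) * g) := by
    have h1 : f - g = u * (a * (1 + c * c) - (1 + a * a) * c) * v := by
      calc f - g = u * a * ((1 + c * c) * v) - (u * (1 + a * a)) * (c * v) := by
            rw [hv, hu, hf, hcv]; simp
        _ = _ := by noncomm_ring
    rw [h1, hf, hcv]
    noncomm_ring
  have b1 : ‖(u * ((a - c) * v)) e‖ ≤ ‖(a - c) e‖ := by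
    rw [mul_apply_eq_comp]
    refine (u.le_opNorm _).trans ?_
    refine (mul_le_of_le_one_left (norm_nonneg _) hun).trans ?_
    exact (norm_mul_apply_of_tracial ht hac hvN).trans
      (mul_le_of_le_one_right (norm_nonneg _) hvn)
  have b2 : ‖(f * ((a - c) * g)) e‖ ≤ ‖(a - c) e‖ := by
    rw [mul_apply_eq_comp]
    refine (f.le_opNorm _).trans ?_
    refine (mul_le_of_le_one_left (norm_nonneg _) hfn).trans ?_
    exact (norm_mul_apply_of_tracial ht hac hgN).trans
      (mul_le_of_le_one_right (norm_nonneg _) hgn)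
  rw [key, _root_.sub_apply]
  linarith [norm_sub_le ((u * ((a - c) * v)) e) ((f * ((a - c) * g)) e)]

end TraceNorm

namespace IsMatrixModel

variable {d : I → ℕ+} {l : Filter I} {N : VonNeumannAlgebra H} {e : H}
  {𝒜 : StarSubalgebra ℂ (MatFam d × (H →L[ℂ] H))}

lemma norm_apply_le (Y : MatFam d) (i : I) : ‖Y i‖ ≤ ‖Y‖ :=
  lp.norm_apply_le_norm ENNReal.top_ne_zero Y i

/-- The pairs which are limits of elements of `𝒜` in the trace norms along `l`. -/
def limitPairs (hM : IsMatrixModel l N e 𝒜) : StarSubalgebra ℂ (MatFam d × (H →L[ℂ] H)) where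
  carrier := {p | p.2 ∈ N ∧ ∀ η > 0, ∃ a ∈ 𝒜, ‖(a.2 - p.2) e‖ < η ∧
    ∀ᶠ i in l, hsNorm (a.1 i - p.1 i) < η}
  add_mem' := by
    rintro p q ⟨hp, hp'⟩ ⟨hq, hq'⟩
    refine ⟨add_mem hp hq, fun η hη => ?_⟩
    obtain ⟨a, ha, ha1, ha2⟩ := hp' (η / 2) (half_pos hη)
    obtain ⟨b, hb, hb1, hb2⟩ := hq' (η / 2) (half_pos hη)
    refine ⟨a + b, add_mem ha hb, ?_, ?_⟩
    · have : ((a + b).2 - (p + q).2) e = (a.2 - p.2) e + (b.2 - q.2) e := by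
        simp; abel
      rw [this]
      exact (norm_add_le _ _).trans_lt (by linarith)
    · filter_upwards [ha2, hb2] with i h1 h2
      have : (a + b).1 i - (p + q).1 i = (a.1 i - p.1 i) + (b.1 i - q.1 i) := by
        simp; abel
      rw [this]
      exact (hsNorm_add_le _ _).trans_lt (by linarith)
  mul_mem' := by
    rintro p q ⟨hp, hp'⟩ ⟨hq, hq'⟩
    refine ⟨mul_mem hp hq, fun η hη => ?_⟩
    -- The order of choice matters: the norm of an approximant is not controlled, so `b` comes first
    -- and the tolerance for `a` depends on `‖b‖`.
    obtain ⟨b, hb, hb1, hb2⟩ := hq' (η / 2 / (‖p‖ + 1)) (by positivity)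
    obtain ⟨a, ha, ha1, ha2⟩ := hp' (η / 2 / (‖b‖ + 1)) (by positivity)
    have hpn : ‖p‖ * (η / 2 / (‖p‖ + 1)) ≤ η / 2 := by
      rw [mul_div_assoc', div_le_iff₀ (by positivity)]
      nlinarith [norm_nonneg p]
    have hbn : (η / 2 / (‖b‖ + 1)) * ‖b‖ ≤ η / 2 := by
      rw [div_mul_eq_mul_div, div_le_iff₀ (by positivity)]
      nlinarith [norm_nonneg b]
    refine ⟨a * b, mul_mem ha hb, ?_, ?_⟩
    · have : ((a * b).2 - (p * q).2) e = ((a.2 - p.2) * b.2) e + p.2 ((b.2 - q.2) e) := by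
        simp
      rw [this]
      have h1 := norm_mul_apply_of_tracial hM.tracial (sub_mem (hM.mem a ha) hp) (hM.mem b hb)
      have h2 := p.2.le_opNorm ((b.2 - q.2) e)
      have h3 : ‖(a.2 - p.2) e‖ * ‖b.2‖ ≤ (η / 2 / (‖b‖ + 1)) * ‖b‖ :=
        mul_le_mul ha1.le (norm_snd_le b) (norm_nonneg _) (by positivity)
      have h4 : ‖p.2‖ * ‖(b.2 - q.2) e‖ < η / 2 := by
        rcases (norm_nonneg p.2).eq_or_lt with h0 | h0
        · rw [← h0, zero_mul]; positivity
        · refine (mul_lt_mul_of_pos_left hb1 h0).trans_le (le_trans ?_ hpn)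
          exact mul_le_mul_of_nonneg_right (norm_snd_le p) (by positivity)
      exact (norm_add_le _ _).trans_lt (by linarith)
    · filter_upwards [ha2, hb2] with i h1 h2
      have : (a * b).1 i - (p * q).1 i = (a.1 i - p.1 i) * b.1 i + p.1 i * (b.1 i - q.1 i) := by
        simp [lp.infty_coeFn_mul, sub_mul, mul_sub]
      rw [this]
      have h3 := hsNorm_mul_le' (a.1 i - p.1 i) (b.1 i)
      have h4 := hsNorm_mul_le (p.1 i) (b.1 i - q.1 i)
      have h5 : hsNorm (a.1 i - p.1 i) * ‖b.1 i‖ ≤ (η / 2 / (‖b‖ + 1)) * ‖b‖ :=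
        mul_le_mul h1.le ((norm_apply_le b.1 i).trans (norm_fst_le b)) (norm_nonneg _)
          (by positivity)
      have h6 : ‖p.1 i‖ * hsNorm (b.1 i - q.1 i) < η / 2 := by
        rcases (norm_nonneg (p.1 i)).eq_or_lt with h0 | h0
        · rw [← h0, zero_mul]; positivity
        · refine (mul_lt_mul_of_pos_left h2 h0).trans_le (le_trans ?_ hpn)
          exact mul_le_mul_of_nonneg_right ((norm_apply_le p.1 i).trans (norm_fst_le p))
            (by positivity)
      exact (hsNorm_add_le _ _).trans_lt (by linarith)
  algebraMap_mem' := by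
    intro r
    have h := 𝒜.algebraMap_mem r
    exact ⟨hM.mem _ h, fun η hη => ⟨_, h, by simpa using hη, by simpa using .of_forall fun _ => hη⟩⟩
  star_mem' := by
    rintro p ⟨hp, hp'⟩
    refine ⟨star_mem hp, fun η hη => ?_⟩
    obtain ⟨a, ha, ha1, ha2⟩ := hp' η hη
    refine ⟨star a, star_mem ha, ?_, ?_⟩
    · have : (star a).2 - (star p).2 = star (a.2 - p.2) := by simp
      rw [this, norm_star_apply_of_tracial hM.tracial (sub_mem (hM.mem a ha) hp)]
      exact ha1
    · filter_upwards [ha2] with i h1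
      have : (star a).1 i - (star p).1 i = star (a.1 i - p.1 i) := by simp [lp.star_apply]
      rwa [this, hsNorm_star]

variable (hM : IsMatrixModel l N e 𝒜)
include hM

lemma le_limitPairs : 𝒜 ≤ hM.limitPairs := fun a ha =>
  ⟨hM.mem a ha, fun η hη => ⟨a, ha, by simpa using hη, by simpa using .of_forall fun _ => hη⟩⟩

/-- `limitPairs` is closed under limits in the trace norms. -/
lemma mem_limitPairs_of_approx {p : MatFam d × (H →L[ℂ] H)} (hp : p.2 ∈ N)
    (h : ∀ η > 0, ∃ q ∈ hM.limitPairs, ‖(q.2 - p.2) e‖ < η ∧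
      ∀ᶠ i in l, hsNorm (q.1 i - p.1 i) < η) : p ∈ hM.limitPairs := by
  refine ⟨hp, fun η hη => ?_⟩
  obtain ⟨q, hq, h1, h2⟩ := h (η / 2) (half_pos hη)
  obtain ⟨a, ha, h3, h4⟩ := hq.2 (η / 2) (half_pos hη)
  refine ⟨a, ha, ?_, ?_⟩
  · have : (a.2 - p.2) e = (a.2 - q.2) e + (q.2 - p.2) e := by simp
    rw [this]
    exact (norm_add_le _ _).trans_lt (by linarith)
  · filter_upwards [h2, h4] with i h5 h6
    exact (hsNorm_sub_le _ (q.1 i) _).trans_lt (by linarith)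

/-- The operator norm dominates both trace norms. Closedness is what permits functional calculus on
limit pairs. -/
lemma isClosed_limitPairs : IsClosed (hM.limitPairs : Set (MatFam d × (H →L[ℂ] H))) := by
  refine isClosed_of_closure_subset fun p hp => ?_
  rw [Metric.mem_closure_iff] at hp
  refine hM.mem_limitPairs_of_approx ?_ fun η hη => ?_
  · have : p.2 ∈ closure (N.toStarSubalgebra : Set (H →L[ℂ] H)) := by
      refine Metric.mem_closure_iff.2 fun ε hε => ?_
      obtain ⟨b, hb, hpb⟩ := hp ε hε
      refine ⟨b.2, hb.1, lt_of_le_of_lt ?_ hpb⟩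
      rw [Prod.dist_eq]
      exact le_max_right _ _
    rwa [(VonNeumannAlgebra.isClosed N).closure_eq] at this
  · obtain ⟨q, hq, hpq⟩ := hp η hη
    rw [dist_comm, dist_eq_norm] at hpq
    refine ⟨q, hq, ?_, .of_forall fun i => ?_⟩
    · refine ((q.2 - p.2).le_opNorm e).trans_lt ?_
      rw [hM.norm_e, mul_one]
      exact (norm_snd_le (q - p)).trans_lt hpq
    · refine (hsNorm_le_norm _).trans_lt (lt_of_le_of_lt ?_ hpq)
      exact (norm_apply_le (q - p).1 i).trans (norm_fst_le (q - p))

lemma tendsto_ntrace {p : MatFam d × (H →L[ℂ] H)} (hp : p ∈ hM.limitPairs) :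
    Tendsto (fun i => ntrace (p.1 i)) l (𝓝 ⟪e, p.2 e⟫_ℂ) := by
  rw [Metric.tendsto_nhds]
  intro ε hε
  obtain ⟨a, ha, h1, h2⟩ := hp.2 (ε / 3) (by positivity)
  filter_upwards [h2, Metric.tendsto_nhds.1 (hM.trace a ha) (ε / 3) (by positivity)] with i h3 h4
  rw [dist_eq_norm] at h4 ⊢
  have e1 : ntrace (p.1 i) - ⟪e, p.2 e⟫_ℂ = -ntrace (a.1 i - p.1 i) +
      (ntrace (a.1 i) - ⟪e, a.2 e⟫_ℂ) + ⟪e, (a.2 - p.2) e⟫_ℂ := by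
    rw [ntrace_sub, _root_.sub_apply, inner_sub_right]; ring
  have e2 : ‖⟪e, (a.2 - p.2) e⟫_ℂ‖ ≤ ‖(a.2 - p.2) e‖ := by
    simpa only [hM.norm_e, one_mul] using norm_inner_le_norm (𝕜 := ℂ) e ((a.2 - p.2) e)
  rw [e1]
  have e3 := norm_ntrace_le (a.1 i - p.1 i)
  refine (norm_add_le _ _).trans_lt ?_
  have := norm_add_le (-ntrace (a.1 i - p.1 i)) (ntrace (a.1 i) - ⟪e, a.2 e⟫_ℂ)
  rw [norm_neg] at this
  linarith

/-- Convergence of traces applied to `star p * p`. Every trace-norm estimate between operators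
thereby becomes an eventual estimate between matrices. -/
lemma tendsto_hsNorm {p : MatFam d × (H →L[ℂ] H)} (hp : p ∈ hM.limitPairs) :
    Tendsto (fun i => hsNorm (p.1 i)) l (𝓝 ‖p.2 e‖) := by
  have h := hM.tendsto_ntrace (mul_mem (star_mem hp) hp)
  have h1 : (fun i => ntrace ((star p * p).1 i)) = fun i => ((hsNorm (p.1 i) ^ 2 : ℝ) : ℂ) := by
    funext i
    rw [hsNorm_sq, ← ntrace_star_mul_self]
    rfl
  rw [h1, Prod.snd_mul, Prod.snd_star, inner_star_mul_self, tendsto_ofReal_complex_iff] at h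
  simpa [Real.sqrt_sq, hsNorm_nonneg] using h.sqrt

/-- Applied to a difference, this is the uniqueness of lifts up to null families. -/
lemma tendsto_hsNorm_zero {Y : MatFam d} (hY : (Y, 0) ∈ hM.limitPairs) :
    Tendsto (fun i => hsNorm (Y i)) l (𝓝 0) := by
  simpa using hM.tendsto_hsNorm hY

/-- Bounded sequences of pairs whose second components converge in the trace norm have
limits (a diagonal argument). -/
lemma exists_limit {E : ℕ → Set I} (hE : ∀ m, E m ∈ l) (hEempty : ⋂ m, E m = ∅)
    {Y : ℕ → MatFam d × (H →L[ℂ] H)} (hY : ∀ m, Y m ∈ hM.limitPairs) {C : ℝ}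
    (hC : ∀ m, ‖(Y m).1‖ ≤ C) {y : H →L[ℂ] H} (hyN : y ∈ N)
    (hy : ∀ m : ℕ, ‖((Y m).2 - y) e‖ < 1 / (m + 1 : ℝ)) :
    ∃ Z : MatFam d, (Z, y) ∈ hM.limitPairs := by
  classical
  -- At an index in `G m` the terms up to `m` satisfy the Cauchy estimates that their operators
  -- satisfy in the limit. Since the `E m` have empty intersection, every index leaves `G` at some
  -- stage.
  let G : ℕ → Set I := fun m => {i | ∀ n ≤ m, i ∈ E n ∧ ∀ p ≤ n, ∀ q ≤ n,
    hsNorm ((Y p).1 i - (Y q).1 i) < 1 / (p + 1 : ℝ) + 1 / (q + 1 : ℝ)}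
  have hGl : ∀ m, G m ∈ l := by
    intro m
    refine (Filter.eventually_all_finite (Set.finite_Iic m)).2 fun n _ => ?_
    refine (show ∀ᶠ i in l, i ∈ E n from hE n).and ?_
    refine (Filter.eventually_all_finite (Set.finite_Iic n)).2 fun p _ => ?_
    refine (Filter.eventually_all_finite (Set.finite_Iic n)).2 fun q _ => ?_
    have h := hM.tendsto_hsNorm (sub_mem (hY p) (hY q))
    refine (h.eventually_lt_const (u := 1 / (p + 1 : ℝ) + 1 / (q + 1 : ℝ)) ?_).mono
      fun i hi => by simpa using hi
    have : ((Y p - Y q).2) e = ((Y p).2 - y) e - ((Y q).2 - y) e := by simp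
    rw [this]
    exact (norm_sub_le _ _).trans_lt (add_lt_add (hy p) (hy q))
  have hGempty : ∀ i, ∃ m, i ∉ G m := by
    intro i
    have : i ∉ ⋂ m, E m := by simp [hEempty]
    obtain ⟨m, hm⟩ := not_forall.1 (fun h => this (Set.mem_iInter.2 h))
    exact ⟨m, fun h => hm (h m le_rfl).1⟩
  have hGanti : ∀ {m n}, m ≤ n → G n ⊆ G m := fun h i hi p hp => hi p (hp.trans h)
  -- The last stage containing `i`. Truncated subtraction gives `0` when `i` is in no stage, which
  -- does no harm because `C` bounds all terms.
  let μ : I → ℕ := fun i => Nat.find (hGempty i) - 1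
  have hμ : ∀ {i m}, i ∈ G m → m ≤ μ i ∧ i ∈ G (μ i) := by
    intro i m hi
    have h1 : m < Nat.find (hGempty i) := by
      by_contra hcon
      exact Nat.find_spec (hGempty i) (hGanti (not_lt.1 hcon) hi)
    refine ⟨by simp only [μ]; omega, ?_⟩
    by_contra hcon
    have := Nat.find_min' (hGempty i) hcon
    simp only [μ] at this
    omega
  let Z : MatFam d := ⟨fun i => (Y (μ i)).1 i, memℓp_infty ⟨C, by
    rintro _ ⟨i, rfl⟩
    exact (norm_apply_le _ i).trans (hC _)⟩⟩
  refine ⟨Z, hM.mem_limitPairs_of_approx hyN fun η hη => ?_⟩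
  obtain ⟨m, hm⟩ := exists_nat_one_div_lt (half_pos hη)
  refine ⟨Y m, hY m, (hy m).trans (hm.trans (half_lt_self hη)), ?_⟩
  filter_upwards [hGl m] with i hi
  obtain ⟨h1, h2⟩ := hμ hi
  have h3 := (h2 (μ i) le_rfl).2 m h1 (μ i) le_rfl
  refine h3.trans_le ?_
  have : 1 / ((μ i : ℝ) + 1) ≤ 1 / ((m : ℝ) + 1) := by gcongr
  linarith

/-- Every element of `N` is the second component of a limit pair. -/
theorem exists_lift {E : ℕ → Set I} (hE : ∀ m, E m ∈ l) (hEempty : ⋂ m, E m = ∅)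
    {y : H →L[ℂ] H} (hy : y ∈ N) : ∃ Y : MatFam d, (Y, y) ∈ hM.limitPairs := by
  -- self-adjoint elements of small norm
  have small : ∀ h ∈ N, IsSelfAdjoint h → ‖h‖ ≤ 1 / 2 →
      ∃ Y : MatFam d, (Y, h) ∈ hM.limitPairs := by
    intro h hh hsa hn
    have hNc := VonNeumannAlgebra.isClosed N
    -- Kaplansky's device: write `h` as the bounded transform of `c`, approximate `c` in the trace
    -- norm by self-adjoint elements of `𝒜` of uncontrolled norm, and transform those. The results
    -- have norm at most `1 / 2` and converge to `h` in the trace norm, so `exists_limit` applies.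
    obtain ⟨c, hcN, hcsa, hc⟩ := exists_eq_boundedTransform N.toStarSubalgebra hNc hh hsa hn
    obtain ⟨g, -, v, hgn, hvn, hv1, hv2, hg1, hg2⟩ :=
      exists_boundedTransform N.toStarSubalgebra hNc hcN hcsa
    have hgh : g = h := by
      calc g = c * v := hg2
        _ = h * ((1 + c * c) * v) := by rw [← mul_assoc, hc]
        _ = h := by rw [hv2, mul_one]
    have hvN : v ∈ N := by
      have : v = 1 - c * g := by
        rw [hg2, eq_sub_iff_add_eq, ← hv2]
        noncomm_ring
      rw [this, hgh]
      exact sub_mem (one_mem _) (mul_mem hcN hh)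
    have step : ∀ m : ℕ, ∃ p ∈ hM.limitPairs, ‖p.1‖ ≤ 1 / 2 ∧
        ‖(p.2 - h) e‖ < 1 / (m + 1 : ℝ) := by
      intro m
      obtain ⟨b, hb, hbc⟩ := hM.dense c hcN (1 / (m + 1 : ℝ) / 2) (by positivity)
      let a : MatFam d × (H →L[ℂ] H) := (2⁻¹ : ℂ) • (b + star b)
      have ha : a ∈ 𝒜 := 𝒜.smul_mem (add_mem hb (star_mem hb)) _
      have hasa : IsSelfAdjoint a := by
        rw [isSelfAdjoint_iff]
        simp only [a, star_smul, star_add, star_star, add_comm (star b) b]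
        congr 1
        simp
      have hac : ‖(a.2 - c) e‖ < 1 / (m + 1 : ℝ) / 2 := by
        have e1 : a.2 - c = (2⁻¹ : ℂ) • ((b.2 - c) + star (b.2 - c)) := by
          rw [star_sub, hcsa.star_eq]
          simp only [a, Prod.smul_snd, Prod.snd_add, Prod.snd_star]
          rw [show b.2 - c + (star b.2 - c) = (b.2 + star b.2) - (2 : ℂ) • c by
            rw [two_smul]; abel, smul_sub, smul_smul]
          norm_num
        have e2 : ‖((b.2 - c) + star (b.2 - c)) e‖ ≤ 2 * ‖(b.2 - c) e‖ := by
          have e3 := norm_add_le ((b.2 - c) e) ((star (b.2 - c)) e)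
          rw [norm_star_apply_of_tracial hM.tracial (sub_mem (hM.mem b hb) hcN)] at e3
          rw [_root_.add_apply]
          linarith
        rw [e1, smul_apply, norm_smul, norm_inv, Complex.norm_ofNat]
        linarith
      obtain ⟨f, hf, u, hfn, hun, hu1, hu2, hf1, hf2⟩ :=
        exists_boundedTransform hM.limitPairs hM.isClosed_limitPairs (hM.le_limitPairs ha) hasa
      refine ⟨f, hf, (norm_fst_le f).trans hfn, ?_⟩
      have := norm_boundedTransform_sub_le (N := N) (e := e) hM.tracial (hM.mem a ha) hcN
        (f := f.2) (u := u.2) (congrArg Prod.snd hf1) hv2 (congrArg Prod.snd hu1) hvN hh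
        ((norm_snd_le u).trans hun) hvn ((norm_snd_le f).trans (hfn.trans (by norm_num)))
        (hn.trans (by norm_num)) (hgh ▸ hg2)
      linarith
    choose p hp hpn hpe using step
    exact hM.exists_limit hE hEempty hp hpn hh hpe
  have sa : ∀ h ∈ N, IsSelfAdjoint h → ∃ Y : MatFam d, (Y, h) ∈ hM.limitPairs := by
    intro h hh hsa
    let t : ℝ := 2 * ‖h‖ + 1
    have ht : 0 < t := by positivity
    obtain ⟨Y, hY⟩ := small (((t⁻¹ : ℝ) : ℂ) • h) (N.toStarSubalgebra.smul_mem hh _) (by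
      rw [isSelfAdjoint_iff, star_smul, hsa.star_eq]; simp) (by
      rw [norm_smul, Complex.norm_real, norm_inv, Real.norm_of_nonneg ht.le,
        inv_mul_le_iff₀ ht]
      simp only [t]; linarith)
    refine ⟨((t : ℝ) : ℂ) • Y, ?_⟩
    have := hM.limitPairs.smul_mem hY ((t : ℝ) : ℂ)
    rwa [Prod.smul_mk, smul_smul, ← Complex.ofReal_mul, mul_inv_cancel₀ ht.ne',
      Complex.ofReal_one, one_smul] at this
  obtain ⟨Y, hY⟩ := sa (y + star y) (add_mem hy (star_mem hy)) (IsSelfAdjoint.add_star_self y)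
  obtain ⟨Z, hZ⟩ := sa (Complex.I • (y - star y))
    (N.toStarSubalgebra.smul_mem (sub_mem hy (star_mem hy)) _) (by
      rw [isSelfAdjoint_iff, star_smul, star_sub, star_star]
      simp [← smul_neg])
  refine ⟨(2⁻¹ : ℂ) • (Y - Complex.I • Z), ?_⟩
  have := hM.limitPairs.smul_mem (sub_mem hY (hM.limitPairs.smul_mem hZ Complex.I)) (2⁻¹ : ℂ)
  have e1 : ((2⁻¹ : ℂ) • ((Y, y + star y) - Complex.I • (Z, Complex.I • (y - star y))) :
      MatFam d × (H →L[ℂ] H)) = ((2⁻¹ : ℂ) • (Y - Complex.I • Z), y) := by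
    refine Prod.ext rfl ?_
    simp only [Prod.smul_snd, Prod.snd_sub, smul_smul, Complex.I_mul_I]
    rw [show y + star y - (-1 : ℂ) • (y - star y) = (2 : ℂ) • y by
      rw [neg_one_smul, two_smul]; abel, smul_smul]
    norm_num
  rwa [e1] at this

end IsMatrixModel

end Lift

/-! ### Density in the double commutant -/

section Density

variable {H : Type*} [NormedAddCommGroup H] [InnerProductSpace ℂ H] [CompleteSpace H]

/-- A unital star algebra of operators is dense, on each vector, in its double commutant. -/
lemma exists_norm_sub_apply_lt (S : StarSubalgebra ℂ (H →L[ℂ] H)) {y : H →L[ℂ] H}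
    (hy : ∀ z : H →L[ℂ] H, (∀ a ∈ S, a * z = z * a) → z * y = y * z) (e : H) {η : ℝ} (hη : 0 < η) :
    ∃ a ∈ S, ‖(a - y) e‖ < η := by
  let K₀ : Submodule ℂ H :=
    { carrier := {v | ∃ a ∈ S, a e = v}
      add_mem' := by
        rintro _ _ ⟨a, ha, rfl⟩ ⟨b, hb, rfl⟩
        exact ⟨a + b, add_mem ha hb, rfl⟩
      zero_mem' := ⟨0, zero_mem _, rfl⟩
      smul_mem' := by
        rintro c _ ⟨a, ha, rfl⟩
        exact ⟨c • a, S.smul_mem ha c, rfl⟩ }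
  -- The closure of `S e` is invariant under `S`, so its projection commutes with `S` and therefore
  -- with `y`; as `e` lies in it, so does `y e`.
  let K := K₀.topologicalClosure
  have inv₀ : ∀ a ∈ S, ∀ v ∈ K₀, a v ∈ K₀ := by
    rintro a ha _ ⟨b, hb, rfl⟩
    exact ⟨a * b, mul_mem ha hb, rfl⟩
  have inv : ∀ a ∈ S, ∀ v ∈ K, a v ∈ K := fun a ha v hv =>
    map_mem_closure a.continuous hv (fun w hw => inv₀ a ha w hw)
  have inv' : ∀ a ∈ S, ∀ v ∈ Kᗮ, a v ∈ Kᗮ := by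
    intro a ha v hv
    rw [Submodule.mem_orthogonal] at hv ⊢
    intro u hu
    have := hv _ (inv _ (star_mem ha) u hu)
    rwa [ContinuousLinearMap.star_eq_adjoint, ContinuousLinearMap.adjoint_inner_left] at this
  have hcomm : ∀ a ∈ S, a * K.starProjection = K.starProjection * a := by
    intro a ha
    ext z
    simp only [mul_apply_eq_comp]
    refine (Submodule.eq_starProjection_of_mem_orthogonal
      (inv a ha _ (K.starProjection_apply_mem z)) ?_).symm
    rw [← map_sub]
    exact inv' a ha _ (K.sub_starProjection_mem_orthogonal z)
  have he : e ∈ K := K₀.le_topologicalClosure ⟨1, one_mem _, rfl⟩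
  have h1 := congrArg (fun T : H →L[ℂ] H => T e) (hy _ hcomm)
  simp only [mul_apply_eq_comp, Submodule.starProjection_eq_self_iff.2 he] at h1
  have h2 : y e ∈ K := Submodule.starProjection_eq_self_iff.1 h1
  obtain ⟨_, ⟨a, ha, rfl⟩, h3⟩ := Metric.mem_closure_iff.1 h2 η hη
  refine ⟨a, ha, ?_⟩
  rwa [dist_comm, dist_eq_norm] at h3

lemma mem_vnGenerated {S : Set (H →L[ℂ] H)} {y : H →L[ℂ] H} :
    y ∈ vnGenerated S ↔ ∀ z : H →L[ℂ] H,
      (∀ a ∈ S, a * z = z * a ∧ star a * z = z * star a) → z * y = y * z := by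
  show y ∈ StarSubalgebra.centralizer ℂ _ ↔ _
  rw [StarSubalgebra.mem_centralizer_iff]
  constructor
  · intro h z hz
    exact (h z (StarSubalgebra.mem_centralizer_iff ℂ |>.2 fun a ha => hz a ha)).1
  · intro h z hz
    exact ⟨h z (StarSubalgebra.mem_centralizer_iff ℂ |>.1 hz),
      h _ (StarSubalgebra.mem_centralizer_iff ℂ |>.1 (star_mem hz))⟩

lemma subset_vnGenerated {S : Set (H →L[ℂ] H)} {y : H →L[ℂ] H} (hy : y ∈ S) :
    y ∈ vnGenerated S := mem_vnGenerated.2 fun _ hz => ((hz y hy).1).symm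

/-- The star algebra generated by pairs of bounded matrix families and operators is a matrix model
as soon as the traces of all words converge. -/
lemma isMatrixModel_adjoin {I : Type*} {d : I → ℕ+} {l : Filter I} {e : H}
    (Γ : Set (MatFam d × (H →L[ℂ] H))) {N : VonNeumannAlgebra H}
    (hN : vnGenerated (Prod.snd '' Γ) = N) (he : ‖e‖ = 1)
    (ht : ∀ x ∈ N, ∀ y ∈ N, ⟪e, x (y e)⟫_ℂ = ⟪e, y (x e)⟫_ℂ)
    (hw : ∀ z ∈ Submonoid.closure (Γ ∪ star Γ),
      Tendsto (fun i => ntrace (z.1 i)) l (𝓝 ⟪e, z.2 e⟫_ℂ)) :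
    IsMatrixModel l N e (StarAlgebra.adjoin ℂ Γ) where
  mem := by
    subst hN
    intro a ha
    have hle : StarAlgebra.adjoin ℂ Γ ≤ (vnGenerated (Prod.snd '' Γ)).toStarSubalgebra.comap
        (StarAlgHom.snd ℂ (MatFam d) (H →L[ℂ] H)) :=
      StarAlgebra.adjoin_le fun b hb => subset_vnGenerated ⟨b, hb, rfl⟩
    exact hle ha
  dense := by
    subst hN
    intro y hy η hη
    obtain ⟨_, ⟨a, ha, rfl⟩, h⟩ := exists_norm_sub_apply_lt
      ((StarAlgebra.adjoin ℂ Γ).map (StarAlgHom.snd ℂ (MatFam d) (H →L[ℂ] H))) (y := y) (by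
        intro z hz
        refine mem_vnGenerated.1 hy z ?_
        rintro _ ⟨b, hb, rfl⟩
        have hb' := StarAlgebra.subset_adjoin ℂ Γ hb
        have hb'' : star b ∈ StarAlgebra.adjoin ℂ Γ := (StarAlgebra.adjoin ℂ Γ).star_mem' hb'
        exact ⟨hz _ ⟨b, hb', rfl⟩, hz _ ⟨star b, hb'', rfl⟩⟩) e hη
    exact ⟨a, ha, h⟩
  trace := by
    intro a ha
    have ha' : a ∈ Submodule.span ℂ
        (Submonoid.closure (Γ ∪ star Γ) : Set (MatFam d × (H →L[ℂ] H))) := by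
      rw [← StarAlgebra.adjoin_eq_span]; exact ha
    clear ha
    induction ha' using Submodule.span_induction with
    | mem z hz => exact hw z hz
    | zero => simpa [ntrace_zero] using tendsto_const_nhds
    | add x y _ _ hx hy =>
      have h := hx.add hy
      rw [← inner_add_right] at h
      exact h.congr fun i => (ntrace_add _ _).symm
    | smul c x _ hx =>
      have h := hx.const_mul c
      rw [← inner_smul_right] at h
      exact h.congr fun i => (ntrace_smul _ _).symm
  norm_e := he
  tracial := ht

end Density

/-! ### The Hilbert space `ℓ²(G)` and the trace of `L(G)` -/

section Delta

variable {G : Type*}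

open Classical in
/-- The basis vector `δ_g` of `ℓ²(G)`. -/
def delta (g : G) : ell2 G := lp.single 2 g (1 : ℂ)

open Classical in
lemma delta_apply (g h : G) : (delta g : ell2 G) h = if h = g then 1 else 0 := by
  simp [delta, lp.single_apply, Pi.single_apply]

open Classical in
lemma inner_delta (g : G) (f : ell2 G) : ⟪delta g, f⟫_ℂ = f g := by
  rw [delta, lp.inner_single_left]
  simp

open Classical in
lemma norm_delta (g : G) : ‖(delta g : ell2 G)‖ = 1 := by
  rw [delta, lp.norm_single (by norm_num)]
  simp

end Delta

section GroupVN

variable {G : Type*} [Group G]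

lemma groupTrace_eq (a : (groupVN G).toStarSubalgebra) :
    groupTrace G a = ⟪(delta 1 : ell2 G), (a : ell2 G →L[ℂ] ell2 G) (delta 1)⟫_ℂ := rfl

open Classical in
lemma leftRegular_delta (g h : G) : leftRegular g (delta h) = delta (g * h) := by
  ext x
  rw [leftRegular_apply, delta_apply, delta_apply]
  exact if_congr inv_mul_eq_iff_eq_mul rfl rfl

lemma leftRegular_mul (g h : G) : leftRegular (g * h) = leftRegular g * leftRegular h := by
  ext f x
  simp [leftRegular_apply, mul_assoc]

lemma leftRegular_one : leftRegular (1 : G) = 1 := by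
  ext f x
  simp [leftRegular_apply]

lemma star_leftRegular (g : G) : star (leftRegular g) = leftRegular g⁻¹ := by
  rw [ContinuousLinearMap.star_eq_adjoint, eq_comm, ContinuousLinearMap.eq_adjoint_iff]
  intro f h
  rw [lp.inner_eq_tsum, lp.inner_eq_tsum, ← (Equiv.mulLeft g⁻¹).tsum_eq]
  simp [leftRegular_apply]

/-- The right regular representation, `(ρ_g f)(h) = f(h g)`. -/
def rightRegular (g : G) : ell2 G →L[ℂ] ell2 G :=
  LinearMap.mkContinuous
    { toFun := fun f => ⟨fun h => f (h * g), by
        have hf := (memℓp_gen_iff (by norm_num)).1 (lp.memℓp f)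
        exact (memℓp_gen_iff (by norm_num)).2 ((Equiv.mulRight g).summable_iff.2 hf)⟩
      map_add' := fun _ _ => rfl
      map_smul' := fun _ _ => rfl } 1 (by
    intro f
    rw [one_mul, lp.norm_eq_tsum_rpow (by norm_num), lp.norm_eq_tsum_rpow (by norm_num)]
    exact le_of_eq (congrArg (· ^ (1 / (2 : ℝ≥0∞).toReal))
      ((Equiv.mulRight g).tsum_eq fun h => ‖f h‖ ^ (2 : ℝ≥0∞).toReal)))

lemma rightRegular_apply (g : G) (f : ell2 G) (h : G) : rightRegular g f h = f (h * g) := rfl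

open Classical in
lemma rightRegular_delta (g h : G) : rightRegular g (delta h) = delta (h * g⁻¹) := by
  ext x
  rw [rightRegular_apply, delta_apply, delta_apply]
  exact if_congr eq_mul_inv_iff_mul_eq.symm rfl rfl

lemma leftRegular_mem (g : G) : leftRegular g ∈ groupVN G := subset_vnGenerated ⟨g, rfl⟩

lemma rightRegular_comm (g : G) {x : ell2 G →L[ℂ] ell2 G} (hx : x ∈ groupVN G) :
    rightRegular g * x = x * rightRegular g := by
  refine mem_vnGenerated.1 hx _ ?_
  have h : ∀ a : G, leftRegular a * rightRegular g = rightRegular g * leftRegular a := by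
    intro a
    ext f z
    simp [leftRegular_apply, rightRegular_apply, mul_assoc]
  rintro _ ⟨a, rfl⟩
  rw [star_leftRegular]
  exact ⟨h a, h a⁻¹⟩

/-- Elements of `L(G)` commute with right translations, so their values on all basis vectors come
from the value on `delta 1`. -/
lemma groupVN_apply_delta {x : ell2 G →L[ℂ] ell2 G} (hx : x ∈ groupVN G) (g : G) :
    x (delta g) = rightRegular g⁻¹ (x (delta 1)) := by
  have := congrArg (fun T : ell2 G →L[ℂ] ell2 G => T (delta 1)) (rightRegular_comm g⁻¹ hx)
  simpa [rightRegular_delta] using this.symm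

lemma groupVN_star_apply {x : ell2 G →L[ℂ] ell2 G} (hx : x ∈ groupVN G) (g : G) :
    (star x) (delta 1) g = star (x (delta 1) g⁻¹) := by
  rw [← inner_delta, ContinuousLinearMap.star_eq_adjoint, ContinuousLinearMap.adjoint_inner_right,
    groupVN_apply_delta hx, ← inner_conj_symm, inner_delta, rightRegular_apply, one_mul]
  rfl

/-- With `x_g` the coordinates of `x (delta 1)`, both sides equal `∑ x_g y_{g⁻¹}`, up to the
substitution `g ↦ g⁻¹`. -/
lemma groupVN_tracial : ∀ x ∈ groupVN G, ∀ y ∈ groupVN G,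
    ⟪(delta 1 : ell2 G), x (y (delta 1))⟫_ℂ = ⟪(delta 1 : ell2 G), y (x (delta 1))⟫_ℂ := by
  have key : ∀ x ∈ groupVN G, ∀ y : ell2 G →L[ℂ] ell2 G,
      ⟪(delta 1 : ell2 G), x (y (delta 1))⟫_ℂ =
        ∑' g : G, (y (delta 1)) g * (x (delta 1)) g⁻¹ := by
    intro x hx y
    rw [← ContinuousLinearMap.adjoint_inner_left, ← ContinuousLinearMap.star_eq_adjoint,
      lp.inner_eq_tsum]
    refine tsum_congr fun g => ?_
    rw [groupVN_star_apply hx]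
    simp
  intro x hx y hy
  rw [key x hx, key y hy, ← (Equiv.inv G).tsum_eq]
  refine tsum_congr fun g => ?_
  simp [mul_comm]

/-- The vector `delta 1` is separating: `star x` kills it too, hence kills all its right translates
`delta g`, so every coordinate of `x f` vanishes. This gives faithfulness of the trace. -/
lemma groupVN_eq_zero {x : ell2 G →L[ℂ] ell2 G} (hx : x ∈ groupVN G) (h : x (delta 1) = 0) :
    x = 0 := by
  have h1 : (star x) (delta 1) = 0 := by
    ext g
    rw [groupVN_star_apply hx, h]
    simp
  ext f g
  rw [← inner_delta, ← ContinuousLinearMap.adjoint_inner_left,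
    ← ContinuousLinearMap.star_eq_adjoint, groupVN_apply_delta (star_mem hx), h1]
  simp

end GroupVN

/-! ### Volume packing -/

section Entropy

open Module MeasureTheory Metric

variable {E : Type*} [NormedAddCommGroup E] [NormedSpace ℝ E] [FiniteDimensional ℝ E]

open scoped Function in
/-- An `r`-separated set in a ball of radius `ρ` has at most `(1 + 2ρ/r)^dim` elements. -/
lemma card_le_of_separated_ball {ρ r : ℝ} (hρ : 0 ≤ ρ) (hr : 0 < r) (s : Finset E)
    (hs : ∀ c ∈ s, ‖c‖ ≤ ρ) (h : ∀ c ∈ s, ∀ d ∈ s, c ≠ d → r ≤ ‖c - d‖) :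
    (s.card : ℝ) ≤ (1 + 2 * ρ / r) ^ finrank ℝ E := by
  borelize E
  let μ : Measure E := Measure.addHaar
  have hr2 : 0 < r / 2 := half_pos hr
  have hR : 0 < ρ + r / 2 := by positivity
  set A := ⋃ c ∈ s, ball (c : E) (r / 2) with hA
  have D : Set.Pairwise (s : Set E) (Disjoint on fun c => ball (c : E) (r / 2)) := by
    rintro c hc d hd hcd
    apply ball_disjoint_ball
    rw [dist_eq_norm, add_halves]
    exact h c hc d hd hcd
  have A_subset : A ⊆ ball (0 : E) (ρ + r / 2) := by
    refine Set.iUnion₂_subset fun x hx => ball_subset_ball' ?_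
    rw [dist_zero_right]
    linarith [hs x hx]
  have hI : (s.card : ℝ≥0∞) * ENNReal.ofReal ((r / 2) ^ finrank ℝ E) * μ (ball 0 1) ≤
      ENNReal.ofReal ((ρ + r / 2) ^ finrank ℝ E) * μ (ball 0 1) :=
    calc
      (s.card : ℝ≥0∞) * ENNReal.ofReal ((r / 2) ^ finrank ℝ E) * μ (ball 0 1) = μ A := by
        rw [hA, measure_biUnion_finset D fun c _ => measurableSet_ball]
        simp only [μ.addHaar_ball_of_pos _ hr2]
        simp only [Finset.sum_const, nsmul_eq_mul, mul_assoc]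
      _ ≤ μ (ball (0 : E) (ρ + r / 2)) := measure_mono A_subset
      _ = ENNReal.ofReal ((ρ + r / 2) ^ finrank ℝ E) * μ (ball 0 1) := by
        simp only [μ.addHaar_ball_of_pos _ hR]
  have hJ := (ENNReal.mul_le_mul_iff_left (measure_ball_pos _ _ zero_lt_one).ne'
    measure_ball_lt_top.ne).1 hI
  have hK := ENNReal.toReal_le_of_le_ofReal (pow_nonneg hR.le _) hJ
  rw [ENNReal.toReal_mul, ENNReal.toReal_natCast,
    ENNReal.toReal_ofReal (pow_nonneg hr2.le _)] at hK
  rw [← mul_le_mul_iff_left₀ (pow_pos hr2 (finrank ℝ E)), ← mul_pow]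
  refine hK.trans (le_of_eq ?_)
  congr 1
  field_simp
  ring

/-- A ball of radius `ρ` splits into at most `(1 + 4ρ/r)^dim` pieces of diameter at most `r`. -/
lemma exists_ball_code {ρ r : ℝ} (hρ : 0 ≤ ρ) (hr : 0 < r) :
    ∃ (n : ℕ) (q : E → Fin n), (n : ℝ) ≤ (1 + 4 * ρ / r) ^ finrank ℝ E ∧
      ∀ u u', ‖u‖ ≤ ρ → ‖u'‖ ≤ ρ → q u = q u' → ‖u - u'‖ ≤ r := by
  classical
  let P : Finset E → Prop := fun s =>
    (∀ c ∈ s, ‖c‖ ≤ ρ) ∧ ∀ c ∈ s, ∀ d ∈ s, c ≠ d → r / 2 ≤ ‖c - d‖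
  have hbd : ∀ s, P s → (s.card : ℝ) ≤ (1 + 4 * ρ / r) ^ finrank ℝ E := by
    intro s hs
    refine (card_le_of_separated_ball hρ (half_pos hr) s hs.1 hs.2).trans (le_of_eq ?_)
    congr 2
    field_simp
    ring
  let T : Set ℕ := {m | ∃ s, P s ∧ s.card = m}
  have hT0 : 1 ∈ T := ⟨{0}, ⟨by simpa using hρ, by
    intro c hc d hd hcd
    simp only [Finset.mem_singleton] at hc hd
    exact absurd (hc.trans hd.symm) hcd⟩, by simp⟩
  have hTb : BddAbove T := by
    refine ⟨⌊(1 + 4 * ρ / r) ^ finrank ℝ E⌋₊, ?_⟩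
    rintro _ ⟨s, hs, rfl⟩
    exact Nat.le_floor (hbd s hs)
  -- A separated set of maximal size is an `r / 2`-net of the ball; points are coded by a nearby
  -- member of it.
  obtain ⟨s, hs, hcard⟩ := Nat.sSup_mem ⟨1, hT0⟩ hTb
  have hpos : 0 < s.card := by
    rw [hcard]; exact le_csSup hTb hT0
  have hcov : ∀ u, ‖u‖ ≤ ρ → ∃ c : s, ‖u - (c : E)‖ < r / 2 := by
    intro u hu
    by_contra! hcon
    have hus : u ∉ s := fun h => by
      have := hcon ⟨u, h⟩
      simp only [sub_self, norm_zero] at this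
      linarith
    have : s.card + 1 ∈ T := by
      refine ⟨insert u s, ⟨?_, ?_⟩, Finset.card_insert_of_notMem hus⟩
      · intro c hc
        rcases Finset.mem_insert.1 hc with rfl | hc
        exacts [hu, hs.1 c hc]
      · intro c hc d hd hcd
        rcases Finset.mem_insert.1 hc with rfl | hc' <;>
          rcases Finset.mem_insert.1 hd with rfl | hd'
        · exact absurd rfl hcd
        · exact hcon ⟨d, hd'⟩
        · rw [norm_sub_rev]; exact hcon ⟨c, hc'⟩
        · exact hs.2 c hc' d hd' hcd
    have := le_csSup hTb this
    omega
  have : Nonempty s := (Finset.card_pos.1 hpos).to_subtype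
  refine ⟨s.card, fun u => s.equivFin (Classical.epsilon fun c : s => ‖u - (c : E)‖ < r / 2),
    hbd s hs, fun u u' hu hu' h => ?_⟩
  have h1 := Classical.epsilon_spec (hcov u hu)
  have h2 := Classical.epsilon_spec (hcov u' hu')
  have h3 := s.equivFin.injective h
  rw [← h3] at h2
  set c := Classical.epsilon fun c : s => ‖u - (c : E)‖ < r / 2
  have : u - u' = (u - c) - (u' - c) := by abel
  rw [this]
  linarith [norm_sub_le (u - (c : E)) (u' - c)]

end Entropy

/-! ### Operators of small Hilbert–Schmidt norm -/

section HilbertSchmidt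

open Module

/-- An operator with small Hilbert–Schmidt norm maps balls close to a subspace of small
dimension. -/
lemma exists_subspace_of_hilbertSchmidt {E ι : Type*} [NormedAddCommGroup E]
    [InnerProductSpace ℂ E] [FiniteDimensional ℂ E] [Fintype ι] (b : OrthonormalBasis ι ℂ E)
    (T : E →ₗ[ℂ] E) {s : ℝ} (hs : 0 < s) :
    ∃ K : Submodule ℂ E, (finrank ℂ K : ℝ) * s ^ 2 ≤ ∑ i, ‖T (b i)‖ ^ 2 ∧
      ∀ v, ∃ κ ∈ K, ‖T v - κ‖ ≤ s * ‖v‖ := by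
  classical
  have hsymm : (LinearMap.adjoint T ∘ₗ T).IsSymmetric := T.isSymmetric_adjoint_mul_self
  let f := hsymm.eigenvectorBasis rfl
  let μ := hsymm.eigenvalues rfl
  have hinner : ∀ i j, ⟪T (f i), T (f j)⟫_ℂ = if i = j then (μ j : ℂ) else 0 := by
    intro i j
    rw [← LinearMap.adjoint_inner_right]
    have : LinearMap.adjoint T (T (f j)) = (μ j : ℂ) • f j :=
      hsymm.apply_eigenvectorBasis rfl j
    rw [this, inner_smul_right, f.inner_eq_ite]
    simp
  have hnorm : ∀ i, ‖T (f i)‖ ^ 2 = μ i := by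
    intro i
    have := hinner i i
    rw [inner_self_eq_norm_sq_to_K, if_pos rfl] at this
    exact Complex.ofReal_injective (by push_cast; exact this)
  have hsum : ∑ i, ‖T (f i)‖ ^ 2 = ∑ i, ‖T (b i)‖ ^ 2 := by
    have h1 := LinearMap.trace_eq_sum_inner (LinearMap.adjoint T ∘ₗ T) f
    have h2 := LinearMap.trace_eq_sum_inner (LinearMap.adjoint T ∘ₗ T) b
    have h3 := h1.symm.trans h2
    simp only [LinearMap.coe_comp, Function.comp_apply, LinearMap.adjoint_inner_right,
      inner_self_eq_norm_sq_to_K] at h3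
    exact Complex.ofReal_injective (by push_cast; exact h3)
  -- The singular values above `s`. Each contributes more than `s ^ 2` to the Hilbert–Schmidt sum,
  -- which bounds their number; on the remaining singular vectors `T` has norm at most `s`.
  let S : Finset (Fin (finrank ℂ E)) := Finset.univ.filter fun i => s < ‖T (f i)‖
  refine ⟨Submodule.span ℂ ((S.image fun i => T (f i) : Finset E) : Set E), ?_, ?_⟩
  · have h1 : finrank ℂ (Submodule.span ℂ ((S.image fun i => T (f i) : Finset E) : Set E)) ≤
        S.card := (finrank_span_finset_le_card _).trans Finset.card_image_le
    calc _ ≤ (S.card : ℝ) * s ^ 2 := by gcongr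
      _ = ∑ i ∈ S, s ^ 2 := by simp
      _ ≤ ∑ i ∈ S, ‖T (f i)‖ ^ 2 := by
        refine Finset.sum_le_sum fun i hi => ?_
        have := (Finset.mem_filter.1 hi).2
        gcongr
      _ ≤ ∑ i, ‖T (f i)‖ ^ 2 :=
        Finset.sum_le_sum_of_subset_of_nonneg (Finset.subset_univ _) fun _ _ _ => sq_nonneg _
      _ = _ := hsum
  · intro v
    refine ⟨∑ i ∈ S, f.repr v i • T (f i), Submodule.sum_mem _ fun i hi =>
      Submodule.smul_mem _ _ (Submodule.subset_span ?_), ?_⟩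
    · exact Finset.mem_coe.2 (Finset.mem_image_of_mem _ hi)
    have hv : T v - ∑ i ∈ S, f.repr v i • T (f i) = ∑ i ∈ Sᶜ, f.repr v i • T (f i) := by
      conv_lhs => rw [← f.sum_repr v, map_sum, ← Finset.sum_add_sum_compl S]
      simp [f.sum_repr]
    rw [hv]
    refine le_of_sq_le_sq ?_ (by positivity)
    have h1 : ((‖∑ i ∈ Sᶜ, f.repr v i • T (f i)‖ ^ 2 : ℝ) : ℂ) =
        ((∑ i ∈ Sᶜ, ‖f.repr v i‖ ^ 2 * μ i : ℝ) : ℂ) := by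
      have := inner_self_eq_norm_sq_to_K (𝕜 := ℂ) (∑ i ∈ Sᶜ, f.repr v i • T (f i))
      push_cast
      refine Eq.trans ?_ ((this.symm).trans ?_)
      · norm_cast
      · rw [sum_inner]
        refine Finset.sum_congr rfl fun i hi => ?_
        rw [inner_sum, Finset.sum_eq_single i]
        · rw [inner_smul_left, inner_smul_right, hinner, if_pos rfl, ← mul_assoc,
            Complex.conj_mul']
        · intro j _ hj
          rw [inner_smul_left, inner_smul_right, hinner, if_neg hj.symm]
          simp
        · exact fun h => absurd hi h
    have h2 := Complex.ofReal_injective h1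
    rw [h2]
    calc ∑ i ∈ Sᶜ, ‖f.repr v i‖ ^ 2 * μ i ≤ ∑ i ∈ Sᶜ, ‖f.repr v i‖ ^ 2 * s ^ 2 := by
          refine Finset.sum_le_sum fun i hi => ?_
          have : ‖T (f i)‖ ≤ s := by simpa [S] using hi
          rw [← hnorm]
          gcongr
      _ ≤ ∑ i, ‖f.repr v i‖ ^ 2 * s ^ 2 :=
        Finset.sum_le_sum_of_subset_of_nonneg (Finset.subset_univ _) fun _ _ _ => by positivity
      _ = (s * ‖v‖) ^ 2 := by
        rw [← Finset.sum_mul, ← EuclideanSpace.norm_sq_eq, f.repr.norm_map]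
        ring

end HilbertSchmidt

/-! ### Sandwich operators on matrices -/

section Sandwich

open Module

variable {k : ℕ+}

/-- The operator `V ↦ ∑ a_p V c_p` on `M_k(ℂ)`. -/
def sandwich {n : ℕ} (a c : Fin n → Mat k) : Mat k →ₗ[ℂ] Mat k where
  toFun V := ∑ p, a p * V * c p
  map_add' V W := by simp [mul_add, add_mul, Finset.sum_add_distrib]
  map_smul' r V := by simp [Finset.smul_sum]

lemma sandwich_apply {n : ℕ} (a c : Fin n → Mat k) (V : Mat k) :
    sandwich a c V = ∑ p, a p * V * c p := rfl

lemma ntrace_star_mul (A B : Mat k) :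
    ((k : ℕ) : ℂ) * ntrace (star A * B) = ∑ i, ∑ j, star (A i j) * B i j := by
  have hk : ((k : ℕ) : ℂ) ≠ 0 := by exact_mod_cast k.pos.ne'
  rw [ntrace, mul_inv_cancel_left₀ hk, Finset.sum_comm]
  simp [Matrix.trace, Matrix.mul_apply, Matrix.star_apply]

lemma ntrace_mul_star (A B : Mat k) :
    ((k : ℕ) : ℂ) * ntrace (B * star A) = ∑ i, ∑ j, star (A i j) * B i j := by
  have hk : ((k : ℕ) : ℂ) ≠ 0 := by exact_mod_cast k.pos.ne'
  rw [ntrace, mul_inv_cancel_left₀ hk]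
  simp [Matrix.trace, Matrix.mul_apply, Matrix.star_apply, mul_comm]

/-- The Hilbert–Schmidt norm of a sandwich operator. -/
lemma sum_norm_sandwich_sq {n : ℕ} (a c : Fin n → Mat k) :
    ((∑ p : Fin k × Fin k, ‖toVec (sandwich a c (Matrix.single p.1 p.2 1))‖ ^ 2 : ℝ) : ℂ) =
      ((k : ℕ) : ℂ) ^ 2 *
        ∑ i, ∑ j, ntrace (star (a i) * a j) * ntrace (c j * star (c i)) := by
  have hentry : ∀ (p q r s : Fin k), sandwich a c (Matrix.single p q 1) r s =
      ∑ j, a j r p * c j q s := by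
    intro p q r s
    rw [sandwich_apply, Matrix.sum_apply]
    refine Finset.sum_congr rfl fun j _ => ?_
    rw [Matrix.mul_apply, Finset.sum_eq_single q]
    · simp
    · intro b _ hb
      simp [Matrix.mul_single_apply_of_ne _ _ _ _ _ hb]
    · simp
  -- After vectorization the operator is `∑ a_p ⊗ c_pᵀ`. Its squared Hilbert–Schmidt norm expands
  -- into these terms, whose sum over `x` factors into a product of two traces.
  let F : Fin n → Fin n → (Fin k × Fin k) × (Fin k × Fin k) → ℂ := fun i j x =>
    (star (a i x.2.1 x.1.1) * star (c i x.1.2 x.2.2)) * (a j x.2.1 x.1.1 * c j x.1.2 x.2.2)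
  have hL : ∀ p : Fin k × Fin k,
      ((‖toVec (sandwich a c (Matrix.single p.1 p.2 1))‖ ^ 2 : ℝ) : ℂ) =
        ∑ x : Fin k × Fin k, ∑ i, ∑ j, F i j (p, x) := by
    intro p
    rw [EuclideanSpace.norm_sq_eq, Complex.ofReal_sum]
    refine Finset.sum_congr rfl fun x _ => ?_
    rw [Complex.ofReal_pow, ← Complex.conj_mul', toVec_apply, hentry, map_sum,
      Finset.sum_mul_sum]
    refine Finset.sum_congr rfl fun i _ => Finset.sum_congr rfl fun j _ => ?_
    rw [map_mul]
    rfl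
  have hR : ∀ i j, ((k : ℕ) : ℂ) ^ 2 * (ntrace (star (a i) * a j) * ntrace (c j * star (c i))) =
      ∑ x, F i j x := by
    intro i j
    rw [show ((k : ℕ) : ℂ) ^ 2 * (ntrace (star (a i) * a j) * ntrace (c j * star (c i))) =
      (((k : ℕ) : ℂ) * ntrace (star (a i) * a j)) * (((k : ℕ) : ℂ) * ntrace (c j * star (c i))) by
        ring, ntrace_star_mul, ntrace_mul_star, Finset.sum_comm, Finset.sum_mul_sum,
      Fintype.sum_prod_type, Fintype.sum_prod_type]
    refine Finset.sum_congr rfl fun p _ => Finset.sum_congr rfl fun q _ => ?_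
    rw [Finset.sum_mul_sum, Fintype.sum_prod_type]
    refine Finset.sum_congr rfl fun r _ => Finset.sum_congr rfl fun s _ => ?_
    simp only [F]
    ring
  rw [Complex.ofReal_sum, Finset.mul_sum, Finset.sum_congr rfl fun p _ => hL p,
    ← Fintype.sum_prod_type', Finset.sum_comm]
  refine Finset.sum_congr rfl fun i _ => ?_
  rw [Finset.mul_sum, Finset.sum_comm]
  exact Finset.sum_congr rfl fun j _ => (hR i j).symm

/-- A matrix `V` moved by at most `t` lies within `t + s * C` of a subspace of complex dimension at
most `h k² / s²`, because its image does within `s * C`. Coding the nearby point of the subspace by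
volume costs an exponent equal to the real dimension, hence the factor `2`. The factor `√k` between
`hsNorm` and the Euclidean norm cancels in the ratio of radii. -/
lemma exists_sandwich_code {n : ℕ} (a c : Fin n → Mat k) {h s C t r : ℝ} (hs : 0 < s)
    (hC : 0 ≤ C) (ht : 0 ≤ t) (hr : 0 < r)
    (hh : ‖∑ i, ∑ j, ntrace (star (a i) * a j) * ntrace (c j * star (c i))‖ ≤ h) :
    ∃ (N : ℕ) (q : Mat k → Fin N),
      (N : ℝ) ≤ (1 + 4 * (C + t + s * C) / r) ^ (2 * (h * ((k : ℕ) : ℝ) ^ 2 / s ^ 2)) ∧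
      ∀ V V', hsNorm V ≤ C → hsNorm V' ≤ C → hsNorm (sandwich a c V - V) ≤ t →
        hsNorm (sandwich a c V' - V') ≤ t → q V = q V' →
        hsNorm (V - V') ≤ 2 * (t + s * C) + r := by
  have hk := sqrt_natCast_pos k
  let T : EuclideanSpace ℂ (Fin k × Fin k) →ₗ[ℂ] EuclideanSpace ℂ (Fin k × Fin k) :=
    toVec.toLinearMap ∘ₗ sandwich a c ∘ₗ toVec.symm.toLinearMap
  have hT : ∀ V, T (toVec V) = toVec (sandwich a c V) := fun V => rfl
  obtain ⟨K, hK, hκ⟩ := exists_subspace_of_hilbertSchmidt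
    (EuclideanSpace.basisFun (Fin k × Fin k) ℂ) T hs
  have hbasis : ∀ p, T (EuclideanSpace.basisFun (Fin k × Fin k) ℂ p) =
      toVec (sandwich a c (Matrix.single p.1 p.2 1)) := by
    intro p
    rw [← hT]
    congr 1
    ext q
    simp [toVec_apply, Matrix.single_apply, Prod.ext_iff, eq_comm]
  have hHS : ∑ p, ‖T (EuclideanSpace.basisFun (Fin k × Fin k) ℂ p)‖ ^ 2 ≤
      h * ((k : ℕ) : ℝ) ^ 2 := by
    simp_rw [hbasis]
    have := congrArg norm (sum_norm_sandwich_sq a c)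
    rw [Complex.norm_of_nonneg (Finset.sum_nonneg fun _ _ => sq_nonneg _), norm_mul, norm_pow,
      Complex.norm_natCast] at this
    rw [this, mul_comm]
    exact mul_le_mul_of_nonneg_right hh (sq_nonneg _)
  obtain ⟨N, q, hN, hq⟩ := exists_ball_code (E := K) (ρ := √((k : ℕ) : ℝ) * (C + t + s * C))
    (r := √((k : ℕ) : ℝ) * r) (by positivity) (by positivity)
  choose κ hκK hκ using hκ
  refine ⟨N, fun V => q ⟨κ (toVec V), hκK _⟩, ?_, ?_⟩
  · refine hN.trans ?_
    rw [finrank_real_of_complex, ← Real.rpow_natCast]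
    have e1 : 4 * (√((k : ℕ) : ℝ) * (C + t + s * C)) / (√((k : ℕ) : ℝ) * r) =
        4 * (C + t + s * C) / r := by
      field_simp
    rw [e1]
    refine Real.rpow_le_rpow_of_exponent_le ?_ ?_
    · have : 0 ≤ 4 * (C + t + s * C) / r := by positivity
      linarith
    · push_cast
      have : (finrank ℂ K : ℝ) ≤ h * ((k : ℕ) : ℝ) ^ 2 / s ^ 2 := by
        rw [le_div_iff₀ (by positivity)]
        exact hK.trans hHS
      linarith
  · intro V V' hV hV' htV htV' hqq
    have hnear : ∀ V : Mat k, hsNorm V ≤ C → hsNorm (sandwich a c V - V) ≤ t →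
        ‖toVec V - κ (toVec V)‖ ≤ √((k : ℕ) : ℝ) * (t + s * C) := by
      intro V hV htV
      have h1 := hκ (toVec V)
      rw [hT, norm_toVec] at h1
      have h2 : ‖toVec V - toVec (sandwich a c V)‖ ≤ √((k : ℕ) : ℝ) * t := by
        rw [← map_sub, norm_toVec, hsNorm_sub_rev]
        gcongr
      have h3 : s * (√((k : ℕ) : ℝ) * hsNorm V) ≤ √((k : ℕ) : ℝ) * (s * C) := by
        rw [mul_left_comm]
        gcongr
      have h4 := norm_sub_le_norm_sub_add_norm_sub (toVec V) (toVec (sandwich a c V))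
        (κ (toVec V))
      linarith
    have hbound : ∀ V : Mat k, hsNorm V ≤ C → hsNorm (sandwich a c V - V) ≤ t →
        ‖κ (toVec V)‖ ≤ √((k : ℕ) : ℝ) * (C + t + s * C) := by
      intro V hV htV
      have h1 := hnear V hV htV
      have h2 : ‖toVec V‖ ≤ √((k : ℕ) : ℝ) * C := by
        rw [norm_toVec]; gcongr
      have h3 : κ (toVec V) = toVec V - (toVec V - κ (toVec V)) := by abel
      rw [h3]
      linarith [norm_sub_le (toVec V) (toVec V - κ (toVec V))]
    have h1 := hnear V hV htV
    have h2 := hnear V' hV' htV'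
    have h3 : ‖κ (toVec V) - κ (toVec V')‖ ≤ √((k : ℕ) : ℝ) * r :=
      hq ⟨κ (toVec V), hκK _⟩ ⟨κ (toVec V'), hκK _⟩ (hbound V hV htV) (hbound V' hV' htV') hqq
    have h4 : ‖toVec (V - V')‖ ≤ √((k : ℕ) : ℝ) * (2 * (t + s * C) + r) := by
      rw [map_sub, show toVec V - toVec V' = (toVec V - κ (toVec V)) +
        (κ (toVec V) - κ (toVec V')) - (toVec V' - κ (toVec V')) by abel]
      have := norm_sub_le ((toVec V - κ (toVec V)) + (κ (toVec V) - κ (toVec V')))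
        (toVec V' - κ (toVec V'))
      have := norm_add_le (toVec V - κ (toVec V)) (κ (toVec V) - κ (toVec V'))
      linarith
    rw [norm_toVec] at h4
    exact le_of_mul_le_mul_left h4 hk

end Sandwich

/-! ### Distance up to conjugation -/

section Orbit

variable {k : ℕ+}

/-- The distance, in the trace norm, from `A` to the conjugate of `B` by `W`. -/
def conjDist (W A B : Mat k) : ℝ := hsNorm (A - W * B * star W)

lemma conjDist_nonneg (W A B : Mat k) : 0 ≤ conjDist W A B := hsNorm_nonneg _

lemma conjDist_add_le (W A B A' B' : Mat k) :
    conjDist W (A + A') (B + B') ≤ conjDist W A B + conjDist W A' B' := by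
  unfold conjDist
  refine le_trans (le_of_eq ?_) (hsNorm_add_le _ _)
  congr 1
  noncomm_ring

lemma conjDist_smul (c : ℂ) (W A B : Mat k) :
    conjDist W (c • A) (c • B) = ‖c‖ * conjDist W A B := by
  unfold conjDist
  rw [← hsNorm_smul, smul_sub, mul_smul_comm, smul_mul_assoc]

lemma conjDist_star (W A B : Mat k) : conjDist W (star A) (star B) = conjDist W A B := by
  unfold conjDist
  rw [← hsNorm_star (A - _)]
  simp [mul_assoc]

variable {W : Mat k} (hW : W ∈ Matrix.unitaryGroup (Fin k) ℂ)
include hW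

lemma norm_conj_le (A : Mat k) : ‖W * A * star W‖ ≤ ‖A‖ := by
  have h1 := norm_unitary_le hW
  calc ‖W * A * star W‖ ≤ ‖W‖ * ‖A‖ * ‖star W‖ := by
        refine (norm_mul_le _ _).trans ?_
        gcongr
        exact norm_mul_le _ _
    _ ≤ 1 * ‖A‖ * 1 := by
        rw [norm_star]
        gcongr
    _ = ‖A‖ := by ring

lemma conjDist_scalar (c : ℂ) : conjDist W (algebraMap ℂ (Mat k) c) (algebraMap ℂ (Mat k) c) = 0 := by
  unfold conjDist
  rw [← Algebra.commutes, mul_assoc, Unitary.mul_star_self_of_mem hW, mul_one, sub_self, hsNorm_zero]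

lemma conjDist_mul_le (A B A' B' : Mat k) :
    conjDist W (A * A') (B * B') ≤ ‖A‖ * conjDist W A' B' + conjDist W A B * ‖B'‖ := by
  unfold conjDist
  have e : A * A' - W * (B * B') * star W = A * (A' - W * B' * star W) +
      (A - W * B * star W) * (W * B' * star W) := by
    have h : W * B * star W * (W * B' * star W) = W * (B * B') * star W := by
      calc _ = W * B * (star W * W) * B' * star W := by noncomm_ring
        _ = _ := by rw [Unitary.star_mul_self_of_mem hW]; noncomm_ring
    rw [sub_mul, h]
    noncomm_ring
  rw [e]
  refine (hsNorm_add_le _ _).trans (add_le_add (hsNorm_mul_le _ _) ?_)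
  refine (hsNorm_mul_le' _ _).trans ?_
  exact mul_le_mul_of_nonneg_left (norm_conj_le hW _) (hsNorm_nonneg _)

/-- Conjugation by a unitary does not increase the trace norm, so errors in the two arguments just
add. -/
lemma conjDist_le_of_near (A B A' B' : Mat k) :
    conjDist W A B ≤ hsNorm (A' - A) + conjDist W A' B' + hsNorm (B' - B) := by
  unfold conjDist
  have e : A - W * B * star W = -(A' - A) + (A' - W * B' * star W) +
      W * (B' - B) * star W := by noncomm_ring
  rw [e]
  refine (hsNorm_add_le _ _).trans (add_le_add ((hsNorm_add_le _ _).trans ?_) (hsNorm_conj hW _))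
  rw [hsNorm_neg]

/-- Moving the conjugating unitary to the other side. -/
lemma hsNorm_star_conj_sub_le (A B : Mat k) :
    hsNorm (star W * A * W - B) ≤ conjDist W A B := by
  have e : star W * A * W - B = star W * (A - W * B * star W) * star (star W) := by
    have h : star W * (W * B * star W) * W = B := by
      calc _ = (star W * W) * B * (star W * W) := by noncomm_ring
        _ = _ := by rw [Unitary.star_mul_self_of_mem hW]; simp
    rw [star_star, mul_sub, sub_mul, h]
  rw [e]
  exact hsNorm_conj (Unitary.star_mem hW) _

/-- Two matrices are compared through a common reference: if `W` carries it near `A` and `V` carries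
it near `B`, then `W * star V` carries `B` near `A`. -/
lemma conjDist_mul_star_le (V A B : Mat k) :
    conjDist (W * star V) A B ≤ hsNorm (star W * A * W - star V * B * V) := by
  unfold conjDist
  have e : A - W * star V * B * star (W * star V) =
      W * (star W * A * W - star V * B * V) * star W := by
    have h : W * (star W * A * W) * star W = A := by
      calc _ = (W * star W) * A * (W * star W) := by noncomm_ring
        _ = _ := by rw [Unitary.mul_star_self_of_mem hW]; simp
    rw [mul_sub, sub_mul, h, star_mul, star_star]
    noncomm_ring
  rw [e]
  exact hsNorm_conj hW _

end Orbit

/-! ### Determination by finitely many functions, and orbit counting -/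

section Fine

variable {C : ℕ+ → Type*}

/-- Bounded matrix-valued functions on a family of configuration spaces. -/
abbrev ConfFam (C : ℕ+ → Type*) : Type _ := MatFam (fun i : Σ k, C k => i.1)

/-- Evaluation at a configuration. -/
def ev (b : ConfFam C) {k : ℕ+} (X : C k) : Mat k := b ⟨k, X⟩

lemma norm_ev_le (b : ConfFam C) {k : ℕ+} (X : C k) : ‖ev b X‖ ≤ ‖b‖ :=
  lp.norm_apply_le_norm ENNReal.top_ne_zero b _

lemma ev_add (a b : ConfFam C) {k : ℕ+} (X : C k) : ev (a + b) X = ev a X + ev b X := rfl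

lemma ev_sub (a b : ConfFam C) {k : ℕ+} (X : C k) : ev (a - b) X = ev a X - ev b X := rfl

lemma ev_mul (a b : ConfFam C) {k : ℕ+} (X : C k) : ev (a * b) X = ev a X * ev b X := rfl

lemma ev_smul (c : ℂ) (b : ConfFam C) {k : ℕ+} (X : C k) : ev (c • b) X = c • ev b X := rfl

lemma ev_star (b : ConfFam C) {k : ℕ+} (X : C k) : ev (star b) X = star (ev b X) := rfl

lemma ev_algebraMap (c : ℂ) {k : ℕ+} (X : C k) :
    ev (algebraMap ℂ (ConfFam C) c) X = algebraMap ℂ (Mat k) c := rfl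

lemma ev_sum {ι : Type*} (s : Finset ι) (b : ι → ConfFam C) {k : ℕ+} (X : C k) :
    ev (∑ i ∈ s, b i) X = ∑ i ∈ s, ev (b i) X := by
  classical
  induction s using Finset.induction_on with
  | empty => rfl
  | insert a s ha ih => rw [Finset.sum_insert ha, Finset.sum_insert ha, ev_add, ih]

/-- `b` is approximately determined, up to simultaneous conjugation, by finitely many
members of `S`. -/
def IsDetermined (𝓕 : Filter (Σ k, C k)) (S : Set (ConfFam C)) (b : ConfFam C) : Prop :=
  ∀ ε > 0, ∃ F : Finset (ConfFam C), (F : Set (ConfFam C)) ⊆ S ∧ ∃ η > 0, ∃ E ∈ 𝓕,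
    ∀ (k : ℕ+) (X X' : C k), ⟨k, X⟩ ∈ E → ⟨k, X'⟩ ∈ E → ∀ W ∈ Matrix.unitaryGroup (Fin k) ℂ,
      (∀ f ∈ F, conjDist W (ev f X) (ev f X') ≤ η) → conjDist W (ev b X) (ev b X') ≤ ε

/-- Up to simultaneous conjugation, finitely many members of `S` take only `exp(o(k²))` values,
up to small errors in the trace norm. -/
def HasSmallOrbits (𝓕 : Filter (Σ k, C k)) (S : Set (ConfFam C)) : Prop :=
  ∀ F : Finset (ConfFam C), (F : Set (ConfFam C)) ⊆ S → ∀ ε > 0, ∀ θ > 0, ∃ E ∈ 𝓕, ∀ k : ℕ+,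
    ∃ (J : Type) (_ : Fintype J) (q : C k → J),
      (Fintype.card J : ℝ) ≤ Real.exp (θ * ((k : ℕ) : ℝ) ^ 2) ∧
      ∀ X X' : C k, ⟨k, X⟩ ∈ E → ⟨k, X'⟩ ∈ E → q X = q X' →
        ∃ W ∈ Matrix.unitaryGroup (Fin k) ℂ, ∀ f ∈ F, conjDist W (ev f X) (ev f X') ≤ ε

variable {𝓕 : Filter (Σ k, C k)} {S T : Set (ConfFam C)}

namespace IsDetermined

lemma of_mem {b : ConfFam C} (hb : b ∈ S) : IsDetermined 𝓕 S b := fun ε hε =>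
  ⟨{b}, by simpa using hb, ε, hε, Set.univ, Filter.univ_mem, fun k X X' _ _ W _ h => h b (by simp)⟩

lemma algebraMap (c : ℂ) : IsDetermined 𝓕 S (algebraMap ℂ (ConfFam C) c) := fun ε hε =>
  ⟨∅, by simp, 1, one_pos, Set.univ, Filter.univ_mem, fun k X X' _ _ W hW _ => by
    rw [ev_algebraMap, ev_algebraMap, conjDist_scalar hW]; exact hε.le⟩

lemma finite {ι : Type*} (s : Finset ι) {b : ι → ConfFam C}
    (hb : ∀ i ∈ s, IsDetermined 𝓕 S (b i)) {ε : ℝ} (hε : 0 < ε) :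
    ∃ F : Finset (ConfFam C), (F : Set (ConfFam C)) ⊆ S ∧ ∃ η > 0, ∃ E ∈ 𝓕,
      ∀ (k : ℕ+) (X X' : C k), ⟨k, X⟩ ∈ E → ⟨k, X'⟩ ∈ E → ∀ W ∈ Matrix.unitaryGroup (Fin k) ℂ,
        (∀ f ∈ F, conjDist W (ev f X) (ev f X') ≤ η) →
          ∀ i ∈ s, conjDist W (ev (b i) X) (ev (b i) X') ≤ ε := by
  classical
  induction s using Finset.induction_on with
  | empty => exact ⟨∅, by simp, 1, one_pos, Set.univ, Filter.univ_mem, by simp⟩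
  | insert a s ha ih =>
    obtain ⟨F, hF, η, hη, E, hE, h⟩ := ih fun i hi => hb i (Finset.mem_insert_of_mem hi)
    obtain ⟨F', hF', η', hη', E', hE', h'⟩ := hb a (Finset.mem_insert_self _ _) ε hε
    refine ⟨F ∪ F', by simp [hF, hF'], min η η', lt_min hη hη', E ∩ E',
      Filter.inter_mem hE hE', fun k X X' hX hX' W hW hd i hi => ?_⟩
    rcases Finset.mem_insert.1 hi with rfl | hi
    · exact h' k X X' hX.2 hX'.2 W hW fun f hf =>
        (hd f (Finset.mem_union_right _ hf)).trans (min_le_right _ _)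
    · exact h k X X' hX.1 hX'.1 W hW (fun f hf =>
        (hd f (Finset.mem_union_left _ hf)).trans (min_le_left _ _)) i hi

lemma add {a b : ConfFam C} (ha : IsDetermined 𝓕 S a) (hb : IsDetermined 𝓕 S b) :
    IsDetermined 𝓕 S (a + b) := by
  intro ε hε
  obtain ⟨F, hF, η, hη, E, hE, h⟩ := finite (S := S) (Finset.univ : Finset Bool)
    (b := fun i => bif i then a else b) (by rintro (_ | _) _ <;> assumption) (half_pos hε)
  refine ⟨F, hF, η, hη, E, hE, fun k X X' hX hX' W hW hd => ?_⟩
  have h1 := h k X X' hX hX' W hW hd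
  have h2 : conjDist W (ev a X) (ev a X') ≤ ε / 2 := h1 true (by simp)
  have h3 : conjDist W (ev b X) (ev b X') ≤ ε / 2 := h1 false (by simp)
  rw [ev_add, ev_add]
  linarith [conjDist_add_le W (ev a X) (ev a X') (ev b X) (ev b X')]

lemma smul (c : ℂ) {b : ConfFam C} (hb : IsDetermined 𝓕 S b) : IsDetermined 𝓕 S (c • b) := by
  intro ε hε
  obtain ⟨F, hF, η, hη, E, hE, h⟩ := hb (ε / (‖c‖ + 1)) (by positivity)
  refine ⟨F, hF, η, hη, E, hE, fun k X X' hX hX' W hW hd => ?_⟩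
  have h1 := h k X X' hX hX' W hW hd
  rw [ev_smul, ev_smul, conjDist_smul]
  rw [le_div_iff₀ (by positivity)] at h1
  nlinarith [conjDist_nonneg W (ev b X) (ev b X')]

lemma star {b : ConfFam C} (hb : IsDetermined 𝓕 S b) : IsDetermined 𝓕 S (star b) := by
  intro ε hε
  obtain ⟨F, hF, η, hη, E, hE, h⟩ := hb ε hε
  refine ⟨F, hF, η, hη, E, hE, fun k X X' hX hX' W hW hd => ?_⟩
  rw [ev_star, ev_star, conjDist_star]
  exact h k X X' hX hX' W hW hd

lemma mul {a b : ConfFam C} (ha : IsDetermined 𝓕 S a) (hb : IsDetermined 𝓕 S b) :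
    IsDetermined 𝓕 S (a * b) := by
  intro ε hε
  obtain ⟨F, hF, η, hη, E, hE, h⟩ := finite (S := S) (Finset.univ : Finset Bool)
    (b := fun i => bif i then a else b) (by rintro (_ | _) _ <;> assumption)
    (show 0 < ε / (‖a‖ + ‖b‖ + 1) by positivity)
  refine ⟨F, hF, η, hη, E, hE, fun k X X' hX hX' W hW hd => ?_⟩
  have h1 := h k X X' hX hX' W hW hd
  have h2 : conjDist W (ev a X) (ev a X') ≤ ε / (‖a‖ + ‖b‖ + 1) := h1 true (by simp)
  have h3 : conjDist W (ev b X) (ev b X') ≤ ε / (‖a‖ + ‖b‖ + 1) := h1 false (by simp)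
  rw [ev_mul, ev_mul]
  refine (conjDist_mul_le hW _ _ _ _).trans ?_
  have h4 : ‖ev a X‖ * conjDist W (ev b X) (ev b X') ≤ ‖a‖ * (ε / (‖a‖ + ‖b‖ + 1)) :=
    mul_le_mul (norm_ev_le a X) h3 (conjDist_nonneg _ _ _) (norm_nonneg _)
  have h5 : conjDist W (ev a X) (ev a X') * ‖ev b X'‖ ≤ (ε / (‖a‖ + ‖b‖ + 1)) * ‖b‖ :=
    mul_le_mul h2 (norm_ev_le b X') (norm_nonneg _) (by positivity)
  have h6 : (ε / (‖a‖ + ‖b‖ + 1)) * (‖a‖ + ‖b‖ + 1) = ε := div_mul_cancel₀ _ (by positivity)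
  have h7 : 0 < ε / (‖a‖ + ‖b‖ + 1) := by positivity
  nlinarith

/-- Makes trace-norm density sufficient: the approximation error is uniform on a member of the
filter. -/
lemma of_approx {b : ConfFam C}
    (h : ∀ ε > 0, ∃ b', IsDetermined 𝓕 S b' ∧ ∀ᶠ i in 𝓕, hsNorm (b' i - b i) ≤ ε) :
    IsDetermined 𝓕 S b := by
  intro ε hε
  obtain ⟨b', hb', hnear⟩ := h (ε / 3) (by positivity)
  obtain ⟨F, hF, η, hη, E, hE, h⟩ := hb' (ε / 3) (by positivity)
  refine ⟨F, hF, η, hη, E ∩ {i | hsNorm (b' i - b i) ≤ ε / 3}, Filter.inter_mem hE hnear,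
    fun k X X' hX hX' W hW hd => ?_⟩
  have h1 := h k X X' hX.1 hX'.1 W hW hd
  have h2 : hsNorm (ev b' X - ev b X) ≤ ε / 3 := hX.2
  have h3 : hsNorm (ev b' X' - ev b X') ≤ ε / 3 := hX'.2
  linarith [conjDist_le_of_near hW (ev b X) (ev b X') (ev b' X) (ev b' X')]

lemma of_tendsto {b b' : ConfFam C} (hb' : IsDetermined 𝓕 S b')
    (h : Tendsto (fun i => hsNorm ((b' - b) i)) 𝓕 (𝓝 0)) : IsDetermined 𝓕 S b :=
  of_approx fun _ hε => ⟨b', hb', (h.eventually_lt_const hε).mono fun _ hi => hi.le⟩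

end IsDetermined

namespace HasSmallOrbits

/-- A finite part of `T` is governed by a finite part of `S` at a finer tolerance, so the same codes
and the same unitaries serve for `T`. This is how one generating set is exchanged for another. -/
lemma of_isDetermined (hS : HasSmallOrbits 𝓕 S) (hT : ∀ b ∈ T, IsDetermined 𝓕 S b) :
    HasSmallOrbits 𝓕 T := by
  intro F hF ε hε θ hθ
  obtain ⟨F', hF', η, hη, E, hE, h⟩ :=
    IsDetermined.finite F (b := fun b => b) (fun b hb => hT b (hF hb)) hε
  obtain ⟨E', hE', h'⟩ := hS F' hF' η hη θ hθ
  refine ⟨E ∩ E', Filter.inter_mem hE hE', fun k => ?_⟩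
  obtain ⟨J, hJ, q, hcard, hq⟩ := h' k
  refine ⟨J, hJ, q, hcard, fun X X' hX hX' hXX' => ?_⟩
  obtain ⟨W, hW, hd⟩ := hq X X' hX.2 hX'.2 hXX'
  exact ⟨W, hW, h k X X' hX.1 hX'.1 W hW hd⟩

lemma empty : HasSmallOrbits 𝓕 (∅ : Set (ConfFam C)) := by
  intro F hF ε hε θ hθ
  refine ⟨Set.univ, Filter.univ_mem, fun k => ⟨Unit, inferInstance, fun _ => (), ?_,
    fun X X' _ _ _ => ⟨1, one_mem _, fun f hf => absurd (hF hf) (by simp)⟩⟩⟩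
  rw [Fintype.card_unit, Nat.cast_one]
  exact Real.one_le_exp (by positivity)

end HasSmallOrbits

end Fine

/-! ### One self-adjoint matrix, and one more almost fixed point -/

section SmallOrbits

variable {C : ℕ+ → Type*} {𝓕 : Filter (Σ k, C k)} {S : Set (ConfFam C)}

/-- A single self-adjoint matrix is determined up to conjugation by its eigenvalues. -/
lemma HasSmallOrbits.singleton_of_isSelfAdjoint {A : ConfFam C} (hA : IsSelfAdjoint A)
    (hk : ∀ m : ℕ, ∀ᶠ i in 𝓕, m ≤ (i.1 : ℕ)) : HasSmallOrbits 𝓕 {A} := by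
  intro F hF ε hε θ hθ
  -- The eigenvalues lie in `[-‖A‖, ‖A‖]` and are rounded at scale `ε`. This gives `M ^ k` codes, at
  -- most `exp (θ k²)` once `log M ≤ θ k`.
  let M : ℕ := ⌊2 * ‖A‖ / ε⌋₊ + 1
  obtain ⟨m, hm⟩ := exists_nat_ge (Real.log M / θ)
  refine ⟨{i | m ≤ (i.1 : ℕ)}, hk m, fun k => ?_⟩
  by_cases hmk : m ≤ (k : ℕ)
  swap
  · exact ⟨Unit, inferInstance, fun _ => (), by
      rw [Fintype.card_unit, Nat.cast_one]
      exact Real.one_le_exp (by positivity), fun X X' hX => absurd hX hmk⟩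
  have hherm : ∀ X : C k, (ev A X).IsHermitian := fun X => by
    show star (ev A X) = ev A X
    rw [← ev_star, hA.star_eq]
  have hbd : ∀ (X : C k) i, |(hherm X).eigenvalues i| ≤ ‖A‖ := fun X i => by
    have h1 := spectrum.norm_le_norm_of_mem ((hherm X).eigenvalues_mem_spectrum_real i)
    exact h1.trans (norm_ev_le A X)
  have hlt : ∀ (X : C k) i, ⌊((hherm X).eigenvalues i + ‖A‖) / ε⌋₊ < M := fun X i => by
    refine Nat.lt_succ_of_le (Nat.floor_mono ?_)
    have := (abs_le.1 (hbd X i)).2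
    gcongr
    linarith
  refine ⟨Fin k → Fin M, inferInstance,
    fun X i => ⟨⌊((hherm X).eigenvalues i + ‖A‖) / ε⌋₊, hlt X i⟩, ?_, ?_⟩
  · have hM : (0 : ℝ) < M := by positivity
    have hk1 : (0 : ℝ) < ((k : ℕ) : ℝ) := by exact_mod_cast k.pos
    have h1 : Real.log M ≤ θ * ((k : ℕ) : ℝ) := by
      rw [div_le_iff₀ hθ] at hm
      have : (m : ℝ) ≤ ((k : ℕ) : ℝ) := by exact_mod_cast hmk
      nlinarith
    rw [Fintype.card_fun, Fintype.card_fin, Fintype.card_fin]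
    push_cast
    calc ((M : ℝ)) ^ (k : ℕ) = Real.exp (((k : ℕ) : ℝ) * Real.log M) := by
          rw [Real.exp_nat_mul, Real.exp_log hM]
      _ ≤ _ := Real.exp_le_exp.2 (by nlinarith)
  · intro X X' _ _ hq
    -- This unitary carries the eigenbasis of one matrix to that of the other, index by index,
    -- leaving only the difference of two diagonal matrices.
    refine ⟨(hherm X).eigenvectorUnitary * star ((hherm X').eigenvectorUnitary : Mat k),
      mul_mem (SetLike.coe_mem _) (Unitary.star_mem (SetLike.coe_mem _)), ?_⟩
    intro f hf
    obtain rfl : f = A := hF hf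
    refine (conjDist_mul_star_le (SetLike.coe_mem _) _ _ _).trans ?_
    have hdiag : ∀ X : C k, star ((hherm X).eigenvectorUnitary : Mat k) * ev f X *
        (hherm X).eigenvectorUnitary =
          Matrix.diagonal (fun i => (((hherm X).eigenvalues i : ℝ) : ℂ)) := by
      intro X
      have := (hherm X).conjStarAlgAut_star_eigenvectorUnitary
      rw [Unitary.conjStarAlgAut_apply] at this
      simpa [Function.comp_def] using this
    rw [hdiag, hdiag, Matrix.diagonal_sub]
    refine (hsNorm_le_norm _).trans ?_
    rw [Matrix.l2_opNorm_diagonal, pi_norm_le_iff_of_nonneg hε.le]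
    intro i
    rw [← Complex.ofReal_sub, Complex.norm_real, Real.norm_eq_abs]
    have hqi := congrArg Fin.val (congrFun hq i)
    simp only at hqi
    have n1 : 0 ≤ ((hherm X).eigenvalues i + ‖f‖) / ε := by
      have := (abs_le.1 (hbd X i)).1
      exact div_nonneg (by linarith) hε.le
    have n2 : 0 ≤ ((hherm X').eigenvalues i + ‖f‖) / ε := by
      have := (abs_le.1 (hbd X' i)).1
      exact div_nonneg (by linarith) hε.le
    have f1 := Nat.floor_le n1
    have f2 := Nat.floor_le n2
    have g1 := Nat.lt_floor_add_one (((hherm X).eigenvalues i + ‖f‖) / ε)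
    have g2 := Nat.lt_floor_add_one (((hherm X').eigenvalues i + ‖f‖) / ε)
    rw [hqi] at f1 g1
    have key : |((hherm X).eigenvalues i + ‖f‖) / ε - ((hherm X').eigenvalues i + ‖f‖) / ε| ≤ 1 :=
      abs_le.2 ⟨by linarith, by linarith⟩
    rw [← sub_div, add_sub_add_right_eq_sub, abs_div, abs_of_pos hε, div_le_one hε] at key
    exact key

/-- Replacing the coefficients of a sandwich operator by nearby conjugates. -/
lemma hsNorm_sandwich_conj_sub_le {k : ℕ+} {n : ℕ} {U : Mat k}
    (hU : U ∈ Matrix.unitaryGroup (Fin k) ℂ) {a c a₀ c₀ : Fin n → Mat k} {v : Mat k}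
    {α γ : Fin n → ℝ} {η K : ℝ} (hη : 0 ≤ η) (hK : 0 ≤ K) (hv : ‖v‖ ≤ K) (ha : ∀ p, ‖a p‖ ≤ α p)
    (hc : ∀ p, ‖c₀ p‖ ≤ γ p) (hda : ∀ p, conjDist U (a p) (a₀ p) ≤ η)
    (hdc : ∀ p, conjDist U (c p) (c₀ p) ≤ η) :
    hsNorm (sandwich a₀ c₀ (star U * v * U) - star U * v * U) ≤
      hsNorm (∑ p, a p * v * c p - v) + η * K * ∑ p, (α p + γ p) := by
  have hUs := Unitary.star_mem hU
  have hUU : U * star U = 1 := Unitary.mul_star_self_of_mem hU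
  have hV : ‖star U * v * U‖ ≤ K := by
    have := norm_conj_le hUs v
    rw [star_star] at this
    exact this.trans hv
  have h1 := hsNorm_conj hUs (∑ p, a p * v * c p - v)
  have hterm : ∀ p, star U * (a p * v * c p) * U =
      (star U * a p * U) * (star U * v * U) * (star U * c p * U) := by
    intro p
    calc star U * (a p * v * c p) * U = star U * a p * 1 * v * 1 * c p * U := by noncomm_ring
      _ = star U * a p * (U * star U) * v * (U * star U) * c p * U := by rw [hUU]
      _ = _ := by noncomm_ring
  have h2 : star U * (∑ p, a p * v * c p - v) * star (star U) =
      ∑ p, (star U * a p * U) * (star U * v * U) * (star U * c p * U) - star U * v * U := by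
    have h0 : star U * (∑ p, a p * v * c p) * U =
        ∑ p, (star U * a p * U) * (star U * v * U) * (star U * c p * U) := by
      rw [Finset.mul_sum, Finset.sum_mul]
      exact Finset.sum_congr rfl fun p _ => hterm p
    rw [star_star, mul_sub, sub_mul, h0]
  rw [h2] at h1
  set V := star U * v * U
  have h3 : ∀ p, hsNorm (a₀ p * V * c₀ p - (star U * a p * U) * V * (star U * c p * U)) ≤
      η * K * (α p + γ p) := by
    intro p
    have da := (hsNorm_star_conj_sub_le hU _ _).trans (hda p)
    have dc := (hsNorm_star_conj_sub_le hU _ _).trans (hdc p)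
    rw [hsNorm_sub_rev] at da dc
    have na : ‖star U * a p * U‖ ≤ α p := by
      have := norm_conj_le hUs (a p)
      rw [star_star] at this
      exact this.trans (ha p)
    have e : a₀ p * V * c₀ p - (star U * a p * U) * V * (star U * c p * U) =
        (a₀ p - star U * a p * U) * (V * c₀ p) +
        ((star U * a p * U) * V) * (c₀ p - star U * c p * U) := by
      noncomm_ring
    rw [e]
    refine (hsNorm_add_le _ _).trans ?_
    have hα : 0 ≤ α p := (norm_nonneg _).trans (ha p)
    have b1 : ‖V * c₀ p‖ ≤ K * γ p :=
      (norm_mul_le _ _).trans (mul_le_mul hV (hc p) (norm_nonneg _) hK)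
    have b2 : ‖(star U * a p * U) * V‖ ≤ α p * K :=
      (norm_mul_le _ _).trans (mul_le_mul na hV (norm_nonneg _) hα)
    have c1 := (hsNorm_mul_le' (a₀ p - star U * a p * U) (V * c₀ p)).trans
      (mul_le_mul da b1 (norm_nonneg _) hη)
    have c2 := (hsNorm_mul_le ((star U * a p * U) * V) (c₀ p - star U * c p * U)).trans
      (mul_le_mul b2 dc (hsNorm_nonneg _) (by positivity))
    linarith
  have h4 : hsNorm (sandwich a₀ c₀ V -
      ∑ p, (star U * a p * U) * V * (star U * c p * U)) ≤ η * K * ∑ p, (α p + γ p) := by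
    rw [sandwich_apply, ← Finset.sum_sub_distrib, Finset.mul_sum]
    exact (hsNorm_sum_le _ _).trans (Finset.sum_le_sum fun p _ => h3 p)
  linarith [hsNorm_sub_le (sandwich a₀ c₀ V)
    (∑ p, (star U * a p * U) * V * (star U * c p * U)) V]

/-- If `v` is almost fixed by sandwich operators with coefficients determined by `S` and with
small Hilbert–Schmidt norm, then adjoining `v` to `S` keeps the orbits small. -/
theorem HasSmallOrbits.insert_of_sandwich (hS : HasSmallOrbits 𝓕 S) {v : ConfFam C}
    (hv : ∀ ε > 0, ∃ (n : ℕ) (a c : Fin n → ConfFam C),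
      (∀ p, IsDetermined 𝓕 S (a p)) ∧ (∀ p, IsDetermined 𝓕 S (c p)) ∧
      (∀ᶠ i in 𝓕, hsNorm ((∑ p, a p * v * c p - v) i) ≤ ε) ∧
      ∀ᶠ i in 𝓕, ‖∑ p, ∑ q, ntrace ((star (a p) * a q) i) * ntrace ((c q * star (c p)) i)‖ ≤ ε) :
    HasSmallOrbits 𝓕 (insert v S) := by
  classical
  intro F hF ε hε θ hθ
  let K : ℝ := ‖v‖
  have hK : 0 ≤ K := norm_nonneg v
  -- The constants give `2 * (t + s * K) + r ≤ ε`, the accuracy delivered by `exists_sandwich_code`.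
  let t : ℝ := ε / 8
  have ht : 0 < t := by positivity
  let s : ℝ := ε / (8 * (K + 1))
  have hs : 0 < s := by positivity
  have hsK : s * K ≤ ε / 8 := by
    have : s * (8 * (K + 1)) = ε := div_mul_cancel₀ _ (by positivity)
    nlinarith
  let r : ℝ := ε / 4
  have hr : 0 < r := by positivity
  let B : ℝ := 1 + 4 * (K + t + s * K) / r
  have hB : 1 ≤ B := by
    have : 0 ≤ 4 * (K + t + s * K) / r := by positivity
    linarith
  have hlogB : 0 ≤ Real.log B := Real.log_nonneg hB
  -- Chosen so that the code for `v` has at most `exp (θ / 2 * k²)` values; the other half of `θ`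
  -- pays for the families already in `S`.
  let h : ℝ := θ * s ^ 2 / (4 * (Real.log B + 1))
  have hh : 0 < h := by positivity
  have hBexp : ∀ k : ℕ+, B ^ (2 * (h * ((k : ℕ) : ℝ) ^ 2 / s ^ 2)) ≤
      Real.exp (θ / 2 * ((k : ℕ) : ℝ) ^ 2) := by
    intro k
    rw [Real.rpow_def_of_pos (by linarith)]
    refine Real.exp_le_exp.2 ?_
    have : Real.log B * (2 * (h * ((k : ℕ) : ℝ) ^ 2 / s ^ 2)) =
        (Real.log B / (Real.log B + 1)) * (θ / 2 * ((k : ℕ) : ℝ) ^ 2) := by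
      simp only [h]
      field_simp
      ring
    rw [this]
    refine mul_le_of_le_one_left (by positivity) ?_
    rw [div_le_one (by positivity)]
    linarith
  have hfinal : 2 * (t + s * K) + r ≤ ε := by
    simp only [t, r]
    linarith
  have hvK : ‖v‖ ≤ K := le_rfl
  have hBexp' : ∀ k : ℕ+, (1 + 4 * (K + t + s * K) / r) ^ (2 * (h * ((k : ℕ) : ℝ) ^ 2 / s ^ 2)) ≤
      Real.exp (θ / 2 * ((k : ℕ) : ℝ) ^ 2) := hBexp
  clear hBexp hlogB hB hsK
  clear_value h B r s t K
  -- The coefficients depend on `t` and `h`, and their norms are uncontrolled. The tolerance `ε₂`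
  -- for moving them to a reference configuration is therefore fixed only afterwards.
  obtain ⟨n, a, c, ha, hc, hfix, hsmall⟩ := hv (min (t / 2) h) (lt_min (half_pos ht) hh)
  let Z : ℝ := ∑ p, (‖a p‖ + ‖c p‖)
  have hZ : 0 ≤ Z := Finset.sum_nonneg fun _ _ => by positivity
  have hZdef : ∑ p, (‖a p‖ + ‖c p‖) = Z := rfl
  clear_value Z
  let ε₂ : ℝ := t / 2 / (K * Z + 1)
  have hε₂ : 0 < ε₂ := by positivity
  have hε₂Z : ε₂ * K * Z ≤ t / 2 := by
    have : ε₂ * (K * Z + 1) = t / 2 := div_mul_cancel₀ _ (by positivity)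
    nlinarith
  clear_value ε₂
  obtain ⟨F', hF', η, hη, E₁, hE₁, hdet⟩ := IsDetermined.finite (𝓕 := 𝓕) (S := S)
    (Finset.univ : Finset (Fin n ⊕ Fin n)) (b := Sum.elim a c)
    (by rintro (p | p) _; exacts [ha p, hc p]) hε₂
  obtain ⟨E₂, hE₂, horb⟩ := hS (F' ∪ F.erase v) (by
    intro b hb
    rcases Finset.mem_union.1 (Finset.mem_coe.1 hb) with hb | hb
    · exact hF' hb
    · exact (hF (Finset.mem_of_mem_erase hb)).resolve_left (Finset.ne_of_mem_erase hb))
    (min η (ε / 2)) (lt_min hη (half_pos hε)) (θ / 2) (half_pos hθ)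
  let E : Set (Σ k, C k) := (E₁ ∩ E₂) ∩
    ({i | hsNorm ((∑ p, a p * v * c p - v) i) ≤ min (t / 2) h} ∩
      {i | ‖∑ p, ∑ q, ntrace ((star (a p) * a q) i) * ntrace ((c q * star (c p)) i)‖ ≤
        min (t / 2) h})
  refine ⟨E, Filter.inter_mem (Filter.inter_mem hE₁ hE₂) (Filter.inter_mem hfix hsmall),
    fun k => ?_⟩
  have hEfix : ∀ X : C k, ⟨k, X⟩ ∈ E →
      hsNorm (∑ p, ev (a p) X * ev v X * ev (c p) X - ev v X) ≤ t / 2 := by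
    intro X hX
    have h1 : hsNorm (ev (∑ p, a p * v * c p - v) X) ≤ min (t / 2) h := hX.2.1
    rw [ev_sub, ev_sum] at h1
    exact h1.trans (min_le_left _ _)
  have hEsmall : ∀ X : C k, ⟨k, X⟩ ∈ E → ‖∑ p, ∑ q, ntrace (star (ev (a p) X) * ev (a q) X) *
      ntrace (ev (c q) X * star (ev (c p) X))‖ ≤ h := fun X hX =>
    le_trans hX.2.2 (min_le_right _ _)
  have hE12 : ∀ X : C k, ⟨k, X⟩ ∈ E → ⟨k, X⟩ ∈ E₁ ∧ ⟨k, X⟩ ∈ E₂ := fun X hX => hX.1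
  clear_value E
  obtain ⟨J, hJ, q, hcard, hq⟩ := horb k
  let N : ℕ := ⌊Real.exp (θ / 2 * ((k : ℕ) : ℝ) ^ 2)⌋₊
  have hN1 : 0 < N := Nat.floor_pos.2 (Real.one_le_exp (by positivity))
  have hrefine : ∀ j : J, ∃ q' : C k → Fin N, ∀ X X' : C k, ⟨k, X⟩ ∈ E → ⟨k, X'⟩ ∈ E →
      q X = j → q X' = j → q' X = q' X' →
        ∃ W ∈ Matrix.unitaryGroup (Fin k) ℂ, ∀ f ∈ F, conjDist W (ev f X) (ev f X') ≤ ε := by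
    intro j
    by_cases hj : ∃ X₀ : C k, (⟨k, X₀⟩ : Σ k, C k) ∈ E ∧ q X₀ = j
    swap
    · exact ⟨fun _ => ⟨0, hN1⟩, fun X X' hX _ hXj => absurd ⟨X, hX, hXj⟩ hj⟩
    -- A reference configuration for the class `j`. Every configuration of the class is first
    -- conjugated so that the old families nearly agree with those at `X₀`; the conjugated `v` is
    -- then almost fixed by the single sandwich operator with coefficients taken at `X₀`.
    obtain ⟨X₀, hX₀, hX₀j⟩ := hj
    have hex : ∀ X : C k, ∃ W ∈ Matrix.unitaryGroup (Fin k) ℂ, (⟨k, X⟩ : Σ k, C k) ∈ E →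
        q X = j → ∀ f ∈ F' ∪ F.erase v, conjDist W (ev f X) (ev f X₀) ≤ min η (ε / 2) := by
      intro X
      by_cases hX : (⟨k, X⟩ : Σ k, C k) ∈ E ∧ q X = j
      · obtain ⟨W, hW, hd⟩ := hq X X₀ (hE12 X hX.1).2 (hE12 X₀ hX₀).2 (hX.2.trans hX₀j.symm)
        exact ⟨W, hW, fun _ _ => hd⟩
      · exact ⟨1, one_mem _, fun h1 h2 => absurd ⟨h1, h2⟩ hX⟩
    choose W hW hWd using hex
    obtain ⟨N', q', hN', hq'⟩ := exists_sandwich_code (fun p => ev (a p) X₀) (fun p => ev (c p) X₀)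
      (h := h) (s := s) (C := K) (t := t) (r := r) hs hK ht.le hr
      (hEsmall X₀ hX₀)
    have hle : N' ≤ N := Nat.le_floor (hN'.trans (hBexp' k))
    refine ⟨fun X => Fin.castLE hle (q' (star (W X) * ev v X * W X)),
      fun X X' hX hX' hXj hXj' hqq => ?_⟩
    have hqq' := Fin.castLE_injective hle hqq
    have hnorm : ∀ X, ‖star (W X) * ev v X * W X‖ ≤ K := fun X => by
      have := norm_conj_le (Unitary.star_mem (hW X)) (ev v X)
      rw [star_star] at this
      exact this.trans ((norm_ev_le v X).trans hvK)
    have happrox : ∀ X : C k, (⟨k, X⟩ : Σ k, C k) ∈ E → q X = j →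
        hsNorm (sandwich (fun p => ev (a p) X₀) (fun p => ev (c p) X₀)
          (star (W X) * ev v X * W X) - star (W X) * ev v X * W X) ≤ t := by
      intro X hX hXj
      have hd := hdet k X X₀ (hE12 X hX).1 (hE12 X₀ hX₀).1 (W X) (hW X) fun f hf =>
        (hWd X hX hXj f (Finset.mem_union_left _ hf)).trans (min_le_left _ _)
      refine (hsNorm_sandwich_conj_sub_le (a := fun p => ev (a p) X) (c := fun p => ev (c p) X)
        (hW X) hε₂.le hK ((norm_ev_le v X).trans hvK)
        (fun p => norm_ev_le (a p) X) (fun p => norm_ev_le (c p) X₀)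
        (fun p => hd (Sum.inl p) (Finset.mem_univ _))
        (fun p => hd (Sum.inr p) (Finset.mem_univ _))).trans ?_
      rw [hZdef]
      linarith [hEfix X hX]
    have hfin := hq' _ _ ((hsNorm_le_norm _).trans (hnorm X)) ((hsNorm_le_norm _).trans (hnorm X'))
      (happrox X hX hXj) (happrox X' hX' hXj') hqq'
    refine ⟨W X * star (W X'), mul_mem (hW X) (Unitary.star_mem (hW X')), fun f hf => ?_⟩
    refine (conjDist_mul_star_le (hW X) _ _ _).trans ?_
    by_cases hfv : f = v
    · subst hfv
      exact hfin.trans hfinal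
    · have hf' : f ∈ F' ∪ F.erase v := Finset.mem_union_right _ (Finset.mem_erase.2 ⟨hfv, hf⟩)
      have d1 := (hsNorm_star_conj_sub_le (hW X) (ev f X) (ev f X₀)).trans
        ((hWd X hX hXj f hf').trans (min_le_right _ _))
      have d2 := (hsNorm_star_conj_sub_le (hW X') (ev f X') (ev f X₀)).trans
        ((hWd X' hX' hXj' f hf').trans (min_le_right _ _))
      rw [hsNorm_sub_rev] at d2
      linarith [hsNorm_sub_le (star (W X) * ev f X * W X) (ev f X₀)
        (star (W X') * ev f X' * W X')]
  choose q' hq' using hrefine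
  refine ⟨J × Fin N, inferInstance, fun X => (q X, q' (q X) X), ?_, fun X X' hX hX' hqq => ?_⟩
  · rw [Fintype.card_prod, Fintype.card_fin, Nat.cast_mul]
    have : (N : ℝ) ≤ Real.exp (θ / 2 * ((k : ℕ) : ℝ) ^ 2) := Nat.floor_le (Real.exp_pos _).le
    calc _ ≤ Real.exp (θ / 2 * ((k : ℕ) : ℝ) ^ 2) * Real.exp (θ / 2 * ((k : ℕ) : ℝ) ^ 2) :=
          mul_le_mul hcard this (Nat.cast_nonneg _) (Real.exp_pos _).le
      _ = _ := by rw [← Real.exp_add]; congr 1; ring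
  · obtain ⟨h1, h2⟩ := Prod.mk.inj hqq
    rw [← h1] at h2
    exact hq' (q X) X X' hX hX' rfl h1.symm h2

end SmallOrbits

/-! ### Algebra of pairs -/

section Pairs

variable {I : Type*} {d : I → ℕ+} {H : Type*} [NormedAddCommGroup H] [InnerProductSpace ℂ H]
  [CompleteSpace H] {R : StarSubalgebra ℂ (MatFam d × (H →L[ℂ] H))}
  {a b : MatFam d} {α β : H →L[ℂ] H}

lemma pair_mul (ha : (a, α) ∈ R) (hb : (b, β) ∈ R) : (a * b, α * β) ∈ R := mul_mem ha hb

lemma pair_add (ha : (a, α) ∈ R) (hb : (b, β) ∈ R) : (a + b, α + β) ∈ R := add_mem ha hb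

lemma pair_sub (ha : (a, α) ∈ R) (hb : (b, β) ∈ R) : (a - b, α - β) ∈ R := sub_mem ha hb

lemma pair_star (ha : (a, α) ∈ R) : (star a, star α) ∈ R := star_mem ha

lemma pair_smul (c : ℂ) (ha : (a, α) ∈ R) : (c • a, c • α) ∈ R := R.smul_mem ha c

lemma pair_algebraMap (c : ℂ) :
    (algebraMap ℂ (MatFam d) c, algebraMap ℂ (H →L[ℂ] H) c) ∈ R := R.algebraMap_mem c

lemma pair_sum {ι : Type*} {s : Finset ι} {a : ι → MatFam d} {α : ι → (H →L[ℂ] H)}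
    (h : ∀ i ∈ s, (a i, α i) ∈ R) : (∑ i ∈ s, a i, ∑ i ∈ s, α i) ∈ R := by
  have e : (∑ i ∈ s, a i, ∑ i ∈ s, α i) = ∑ i ∈ s, (a i, α i) :=
    Prod.ext (by rw [Prod.fst_sum]) (by rw [Prod.snd_sum])
  rw [e]
  exact sum_mem h

end Pairs

/-! ### Adjoining group elements -/

section GroupOrbits

variable {C : ℕ+ → Type*} {𝓕 : Filter (Σ k, C k)} {S : Set (ConfFam C)}

section Model

variable {H : Type*} [NormedAddCommGroup H] [InnerProductSpace ℂ H] [CompleteSpace H]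
  {N : VonNeumannAlgebra H} {e : H} {𝒜 : StarSubalgebra ℂ (ConfFam C × (H →L[ℂ] H))}
  (hM : IsMatrixModel 𝓕 N e 𝒜)

include hM

/-- Two lifts of the same operator are determined by the same families. -/
lemma IsDetermined.congr {b b' : ConfFam C} {y : H →L[ℂ] H} (hb' : (b', y) ∈ hM.limitPairs)
    (hb : (b, y) ∈ hM.limitPairs) (h : IsDetermined 𝓕 S b') : IsDetermined 𝓕 S b := by
  refine h.of_tendsto (hM.tendsto_hsNorm_zero ?_)
  simpa using pair_sub hb' hb

/-- The sandwich criterion, with the estimates read off in the limit. -/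
lemma HasSmallOrbits.insert_of_limit (hS : HasSmallOrbits 𝓕 S) {v : ConfFam C} {y : H →L[ℂ] H}
    (hvy : (v, y) ∈ hM.limitPairs)
    (h : ∀ ε > 0, ∃ (n : ℕ) (a c : Fin n → ConfFam C) (α γ : Fin n → (H →L[ℂ] H)),
      (∀ p, IsDetermined 𝓕 S (a p)) ∧ (∀ p, IsDetermined 𝓕 S (c p)) ∧
      (∀ p, (a p, α p) ∈ hM.limitPairs) ∧ (∀ p, (c p, γ p) ∈ hM.limitPairs) ∧
      ‖(∑ p, α p * y * γ p - y) e‖ < ε ∧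
      ‖∑ p, ∑ q, ⟪e, (star (α p) * α q) e⟫_ℂ * ⟪e, (γ q * star (γ p)) e⟫_ℂ‖ < ε) :
    HasSmallOrbits 𝓕 (insert v S) := by
  refine hS.insert_of_sandwich fun ε hε => ?_
  obtain ⟨n, a, c, α, γ, ha, hc, haα, hcγ, h1, h2⟩ := h ε hε
  refine ⟨n, a, c, ha, hc, ?_, ?_⟩
  · have hp : (∑ p, a p * v * c p - v, ∑ p, α p * y * γ p - y) ∈ hM.limitPairs :=
      pair_sub (pair_sum fun p _ => pair_mul (pair_mul (haα p) hvy) (hcγ p)) hvy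
    exact ((hM.tendsto_hsNorm hp).eventually_lt_const h1).mono fun _ hi => hi.le
  · have t1 : ∀ p q, Tendsto (fun i => ntrace ((star (a p) * a q) i)) 𝓕
        (𝓝 ⟪e, (star (α p) * α q) e⟫_ℂ) := fun p q =>
      hM.tendsto_ntrace (p := (star (a p) * a q, star (α p) * α q))
        (pair_mul (pair_star (haα p)) (haα q))
    have t2 : ∀ p q, Tendsto (fun i => ntrace ((c q * star (c p)) i)) 𝓕
        (𝓝 ⟪e, (γ q * star (γ p)) e⟫_ℂ) := fun p q =>
      hM.tendsto_ntrace (p := (c q * star (c p), γ q * star (γ p)))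
        (pair_mul (hcγ q) (pair_star (hcγ p)))
    have ht := (tendsto_finsetSum Finset.univ fun p _ =>
      tendsto_finsetSum Finset.univ fun q _ => (t1 p q).mul (t2 p q)).norm
    exact (ht.eventually_lt_const h2).mono fun _ hi => hi.le

end Model

variable {G : Type*} [Group G] {𝒜 : StarSubalgebra ℂ (ConfFam C × (ell2 G →L[ℂ] ell2 G))}
  (hM : IsMatrixModel 𝓕 (groupVN G) (delta (1 : G)) 𝒜) {U : G → ConfFam C}
  (hU : ∀ g, (U g, leftRegular g) ∈ hM.limitPairs)

omit [Group G] in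
open Classical in
lemma inner_delta_delta (g h : G) : ⟪(delta g : ell2 G), delta h⟫_ℂ = if g = h then 1 else 0 := by
  rw [inner_delta, delta_apply]

open Classical in
lemma inner_leftRegular (g : G) :
    ⟪(delta (1 : G) : ell2 G), leftRegular g (delta 1)⟫_ℂ = if g = 1 then 1 else 0 := by
  rw [leftRegular_delta, mul_one, inner_delta_delta]
  exact if_congr eq_comm rfl rfl

include hU

/-- Products and inverses of determined group elements are determined. -/
lemma isDetermined_closure {K : Set G} {g : G} (hg : g ∈ Subgroup.closure K) :
    IsDetermined 𝓕 (U '' K) (U g) := by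
  induction hg using Subgroup.closure_induction with
  | mem x hx => exact IsDetermined.of_mem ⟨x, hx, rfl⟩
  | one =>
    refine IsDetermined.congr hM (y := 1) (b' := algebraMap ℂ (ConfFam C) 1) ?_ ?_
      (IsDetermined.algebraMap 1)
    · rw [← map_one (algebraMap ℂ (ell2 G →L[ℂ] ell2 G))]; exact pair_algebraMap 1
    · simpa [leftRegular_one] using hU 1
  | mul x y _ _ hx hy =>
    refine IsDetermined.congr hM (pair_mul (hU x) (hU y)) ?_ (hx.mul hy)
    have := hU (x * y)
    rwa [leftRegular_mul] at this
  | inv x _ hx =>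
    refine IsDetermined.congr hM (pair_star (hU x)) ?_ hx.star
    have := hU x⁻¹
    rwa [← star_leftRegular] at this

lemma HasSmallOrbits.closure {K : Set G} (hK : HasSmallOrbits 𝓕 (U '' K)) :
    HasSmallOrbits 𝓕 (U '' (Subgroup.closure K : Set G)) :=
  hK.of_isDetermined (by rintro _ ⟨g, hg, rfl⟩; exact isDetermined_closure hM hU hg)

/-- A group element which conjugates infinitely many elements of `K` into `K` may be adjoined
to `K`. -/
lemma HasSmallOrbits.insert_of_conj {K : Set G} (hK : HasSmallOrbits 𝓕 (U '' K)) {v : G}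
    (s : ℕ → G) (hs : Function.Injective s) (hsK : ∀ j, s j ∈ Subgroup.closure K)
    (hvs : ∀ j, v * s j * v⁻¹ ∈ Subgroup.closure K) :
    HasSmallOrbits 𝓕 (U '' (insert v K)) := by
  classical
  rw [Set.image_insert_eq]
  refine hK.insert_of_limit hM (hU v) fun ε hε => ?_
  obtain ⟨m, hm⟩ := exists_nat_one_div_lt hε
  let n := m + 1
  have hn : (n : ℂ) ≠ 0 := by exact_mod_cast Nat.succ_ne_zero m
  -- Each summand sends `v` to `n⁻¹ v`, so the sum fixes it exactly. Distinct group elements are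
  -- orthogonal, so in the Hilbert–Schmidt sum only `n` diagonal terms `n⁻²` survive.
  refine ⟨n, fun p => (n : ℂ)⁻¹ • U (v * s p * v⁻¹), fun p => star (U (s p)),
    fun p => (n : ℂ)⁻¹ • leftRegular (v * s p * v⁻¹), fun p => star (leftRegular (s p)),
    fun p => (isDetermined_closure hM hU (hvs p)).smul _,
    fun p => (isDetermined_closure hM hU (hsK p)).star,
    fun p => pair_smul _ (hU _), fun p => pair_star (hU _), ?_, ?_⟩
  · have h1 : ∀ p : Fin n, (n : ℂ)⁻¹ • leftRegular (v * s p * v⁻¹) * leftRegular v *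
        star (leftRegular (s p)) = (n : ℂ)⁻¹ • leftRegular v := by
      intro p
      rw [star_leftRegular, smul_mul_assoc, smul_mul_assoc, ← leftRegular_mul, ← leftRegular_mul]
      congr 2
      group
    simp_rw [h1]
    rw [Finset.sum_const, Finset.card_univ, Fintype.card_fin, ← Nat.cast_smul_eq_nsmul ℂ,
      smul_smul, mul_inv_cancel₀ hn, one_smul, sub_self]
    simpa using hε
  · have h1 : ∀ p q : Fin n,
        ⟪(delta (1 : G) : ell2 G), (star ((n : ℂ)⁻¹ • leftRegular (v * s p * v⁻¹)) *
          ((n : ℂ)⁻¹ • leftRegular (v * s q * v⁻¹))) (delta 1)⟫_ℂ *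
        ⟪(delta (1 : G) : ell2 G), (star (leftRegular (s q)) * star (star (leftRegular (s p))))
          (delta 1)⟫_ℂ = if p = q then ((n : ℂ)⁻¹ * (n : ℂ)⁻¹) else 0 := by
      intro p q
      rw [star_smul, star_star, star_leftRegular, star_leftRegular, smul_mul_smul_comm,
        ← leftRegular_mul, ← leftRegular_mul, smul_apply, inner_smul_right, inner_leftRegular,
        inner_leftRegular]
      have e1 : (v * s p * v⁻¹)⁻¹ * (v * s q * v⁻¹) = 1 ↔ p = q := by
        rw [inv_mul_eq_one, mul_left_inj, mul_right_inj, hs.eq_iff, Fin.val_inj]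
      have e2 : (s q)⁻¹ * s p = 1 ↔ p = q := by
        rw [inv_mul_eq_one, hs.eq_iff, Fin.val_inj, eq_comm]
      simp only [e1, e2]
      split_ifs <;> simp
    simp_rw [h1]
    simp only [Finset.sum_ite_eq, Finset.mem_univ, if_true, Finset.sum_const, Finset.card_univ,
      Fintype.card_fin, nsmul_eq_mul]
    rw [mul_inv_cancel_left₀ hn, norm_inv, Complex.norm_natCast, ← one_div]
    exact_mod_cast hm

omit hU in
/-- The sum of a power of `g` and its inverse. -/
def symPow (g : G) (j : ℕ) : ell2 G →L[ℂ] ell2 G := leftRegular (g ^ j) + leftRegular (g ^ j)⁻¹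

omit hU in
-- The Chebyshev recursion. It makes every `symPow g j` a polynomial in the self-adjoint `symPow g
-- 1`.
lemma symPow_succ_succ (g : G) (j : ℕ) :
    symPow g (j + 2) = symPow g 1 * symPow g (j + 1) - symPow g j := by
  simp only [symPow, mul_add, add_mul, ← leftRegular_mul]
  rw [eq_sub_iff_add_eq]
  have e1 : g ^ 1 * g ^ (j + 1) = g ^ (j + 2) := by rw [← pow_add]; congr 1; omega
  have e2 : (g ^ 1)⁻¹ * g ^ (j + 1) = g ^ j := by
    rw [add_comm j 1, pow_add, inv_mul_cancel_left]
  have e3 : g ^ 1 * (g ^ (j + 1))⁻¹ = (g ^ j)⁻¹ := by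
    rw [pow_one, pow_succ, mul_inv_rev, mul_inv_cancel_left]
  have e4 : (g ^ 1)⁻¹ * (g ^ (j + 1))⁻¹ = (g ^ (j + 2))⁻¹ := by
    rw [← mul_inv_rev, ← pow_add]
  rw [e1, e2, e3, e4]
  abel

omit hU in
/-- Lifts of the `symPow g j` are determined by a lift of `symPow g 1`. -/
lemma exists_isDetermined_symPow (g : G) {A : ConfFam C}
    (hA : (A, symPow g 1) ∈ hM.limitPairs) (j : ℕ) :
    ∃ b, (b, symPow g j) ∈ hM.limitPairs ∧ IsDetermined 𝓕 {A} b := by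
  suffices h : ∀ j, (∃ b, (b, symPow g j) ∈ hM.limitPairs ∧ IsDetermined 𝓕 {A} b) ∧
      ∃ b, (b, symPow g (j + 1)) ∈ hM.limitPairs ∧ IsDetermined 𝓕 {A} b from (h j).1
  intro j
  induction j with
  | zero =>
    refine ⟨⟨algebraMap ℂ (ConfFam C) 2, ?_, IsDetermined.algebraMap 2⟩,
      A, hA, IsDetermined.of_mem rfl⟩
    have h2 : symPow g 0 = algebraMap ℂ (ell2 G →L[ℂ] ell2 G) 2 := by
      rw [symPow, pow_zero, inv_one, leftRegular_one, one_add_one_eq_two, map_ofNat]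
    rw [h2]
    exact pair_algebraMap 2
  | succ j ih =>
    obtain ⟨⟨b, hb, hb'⟩, c, hc, hc'⟩ := ih
    refine ⟨⟨c, hc, hc'⟩, A * c - b, ?_, ?_⟩
    · rw [symPow_succ_succ]
      exact pair_sub (pair_mul hA hc) hb
    · have := ((IsDetermined.of_mem (𝓕 := 𝓕) (Set.mem_singleton A)).mul hc').add (hb'.smul (-1))
      rwa [neg_one_smul, ← sub_eq_add_neg] at this

end GroupOrbits

/-! ### A single element of infinite order -/

section InfiniteOrder

variable {G : Type*} [Group G]

omit [Group G] in
lemma norm_sum_delta_sq {ι : Type*} [Fintype ι] {f : ι → G} (hf : Function.Injective f) :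
    ‖∑ i, (delta (f i) : ell2 G)‖ ^ 2 = Fintype.card ι := by
  classical
  have h := inner_self_eq_norm_sq_to_K (𝕜 := ℂ) (∑ i, (delta (f i) : ell2 G))
  rw [sum_inner] at h
  simp_rw [inner_sum, inner_delta_delta, hf.eq_iff] at h
  simp only [Finset.sum_ite_eq, Finset.mem_univ, if_true, Finset.sum_const, Finset.card_univ,
    nsmul_eq_mul, mul_one] at h
  exact Complex.ofReal_injective (by push_cast; exact h.symm)

lemma star_symPow (g : G) (j : ℕ) : star (symPow g j) = symPow g j := by
  rw [symPow, star_add, star_leftRegular, star_leftRegular, inv_inv, add_comm]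

/-- Of the four products of powers, only those with cancelling exponents have nonzero trace. The
exponents start at `1` because `symPow g 0` is twice the identity, for which the value would be `4`.
-/
lemma inner_symPow_mul {g : G} (hg : ¬ IsOfFinOrder g) (i j : ℕ) :
    ⟪(delta (1 : G) : ell2 G), (symPow g (i + 1) * symPow g (j + 1)) (delta 1)⟫_ℂ =
      if i = j then 2 else 0 := by
  classical
  have hinj := injective_pow_iff_not_isOfFinOrder.2 hg
  simp only [symPow, mul_add, add_mul, ← leftRegular_mul, _root_.add_apply, inner_add_right,
    inner_leftRegular]
  have h1 : ¬ g ^ (i + 1) * g ^ (j + 1) = 1 := by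
    rw [← pow_add, ← pow_zero g, hinj.eq_iff]; omega
  have h2 : ¬ (g ^ (i + 1))⁻¹ * (g ^ (j + 1))⁻¹ = 1 := by
    rw [← mul_inv_rev, inv_eq_one, ← pow_add, ← pow_zero g, hinj.eq_iff]; omega
  have h3 : (g ^ (i + 1))⁻¹ * g ^ (j + 1) = 1 ↔ i = j := by
    rw [inv_mul_eq_one, hinj.eq_iff]; omega
  have h4 : g ^ (i + 1) * (g ^ (j + 1))⁻¹ = 1 ↔ i = j := by
    rw [mul_inv_eq_one, hinj.eq_iff]; omega
  simp only [h1, h2, h3, h4, if_false]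
  split_ifs <;> norm_num

/-- The average of the `symPow g j * symPow g j / 2` is close to `1`. -/
lemma norm_sum_symPow_sub {g v : G} (hg : ¬ IsOfFinOrder g) (hgv : Commute v g) {n : ℕ}
    (hn : n ≠ 0) :
    ‖(∑ p : Fin n, ((2 * n : ℂ)⁻¹ • symPow g (p + 1)) * leftRegular v * symPow g (p + 1) -
      leftRegular v) (delta 1 : ell2 G)‖ ^ 2 = (2 * n : ℝ)⁻¹ := by
  have hn' : (n : ℂ) ≠ 0 := by exact_mod_cast hn
  -- Since `v` commutes with `g`, each summand before scaling is `2 v + v g^{2j} + v g^{-2j}`. The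
  -- multiples of `v` cancel and `2 n` distinct group elements remain, each with coefficient `1 / (2
  -- n)`; `z` lists their exponents.
  let z : Fin n × Bool → ℤ := fun x => bif x.2 then 2 * ((x.1 : ℕ) + 1) else -(2 * ((x.1 : ℕ) + 1))
  have hz : Function.Injective z := by
    rintro ⟨p, b⟩ ⟨q, c⟩ h
    rcases b <;> rcases c <;> simp only [z, cond_true, cond_false] at h <;>
      first
        | (exfalso; omega)
        | (have : (p : ℕ) = q := by omega
           rw [Fin.ext this])
  have hf : Function.Injective fun x : Fin n × Bool => v * g ^ z x := fun x y h =>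
    hz (injective_zpow_iff_not_isOfFinOrder.2 hg (mul_left_cancel h))
  have hterm : ∀ p : Fin n, ((2 * n : ℂ)⁻¹ • symPow g (p + 1)) * leftRegular v *
      symPow g (p + 1) = (2 * n : ℂ)⁻¹ • ((2 : ℂ) • leftRegular v +
        (leftRegular (v * g ^ z (p, true)) + leftRegular (v * g ^ z (p, false)))) := by
    intro p
    rw [smul_mul_assoc, smul_mul_assoc]
    congr 1
    have c1 : ∀ j : ℕ, g ^ j * v = v * g ^ j := fun j => (hgv.pow_right j).eq.symm
    have c2 : ∀ j : ℕ, (g ^ j)⁻¹ * v = v * (g ^ j)⁻¹ := fun j =>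
      ((hgv.pow_right j).inv_right).eq.symm
    simp only [symPow, mul_add, add_mul, ← leftRegular_mul, c1, c2, mul_assoc, inv_mul_cancel,
      mul_inv_cancel, mul_one]
    have e1 : g ^ ((p : ℕ) + 1) * g ^ ((p : ℕ) + 1) = g ^ z (p, true) := by
      rw [← pow_add, ← zpow_natCast]
      congr 1
      simp only [z, cond_true]
      push_cast
      ring
    have e2 : (g ^ ((p : ℕ) + 1))⁻¹ * (g ^ ((p : ℕ) + 1))⁻¹ = g ^ z (p, false) := by
      rw [← mul_inv_rev, e1, ← zpow_neg]
      rfl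
    rw [e1, e2, two_smul]
    abel
  have hsum : ∑ p : Fin n, ((2 * n : ℂ)⁻¹ • symPow g (p + 1)) * leftRegular v *
      symPow g (p + 1) - leftRegular v =
        (2 * n : ℂ)⁻¹ • ∑ x : Fin n × Bool, leftRegular (v * g ^ z x) := by
    simp_rw [hterm]
    rw [← Finset.smul_sum, Finset.sum_add_distrib, smul_add, Finset.sum_const, Finset.card_univ,
      Fintype.card_fin, ← Nat.cast_smul_eq_nsmul ℂ, smul_smul, smul_smul, Fintype.sum_prod_type]
    have : (2 * n : ℂ)⁻¹ * ((n : ℂ) * 2) = 1 := by field_simp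
    rw [← mul_assoc] at this
    simp only [Fintype.sum_bool]
    rw [this, one_smul, add_sub_cancel_left]
  rw [hsum, smul_apply, norm_smul, mul_pow, _root_.sum_apply]
  simp_rw [leftRegular_delta, mul_one]
  rw [norm_sum_delta_sq hf, norm_inv, norm_mul, Complex.norm_natCast, Complex.norm_ofNat,
    Fintype.card_prod, Fintype.card_fin, Fintype.card_bool]
  have hn'' : (n : ℝ) ≠ 0 := by exact_mod_cast hn
  push_cast
  field_simp

variable {C : ℕ+ → Type*} {𝓕 : Filter (Σ k, C k)}
  {𝒜 : StarSubalgebra ℂ (ConfFam C × (ell2 G →L[ℂ] ell2 G))}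
  (hM : IsMatrixModel 𝓕 (groupVN G) (delta (1 : G)) 𝒜) {U : G → ConfFam C}
  (hU : ∀ g, (U g, leftRegular g) ∈ hM.limitPairs)

include hU

/-- An element of infinite order has small orbits. -/
lemma HasSmallOrbits.of_not_isOfFinOrder (hk : ∀ m : ℕ, ∀ᶠ i in 𝓕, m ≤ (i.1 : ℕ)) {g : G}
    (hg : ¬ IsOfFinOrder g) : HasSmallOrbits 𝓕 (U '' {g}) := by
  let A : ConfFam C := U g + star (U g)
  have hA : (A, symPow g 1) ∈ hM.limitPairs := by
    rw [symPow, pow_one, ← star_leftRegular]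
    exact pair_add (hU g) (pair_star (hU g))
  have hbase : HasSmallOrbits 𝓕 {A} :=
    HasSmallOrbits.singleton_of_isSelfAdjoint (IsSelfAdjoint.add_star_self (U g)) hk
  choose b hb hb' using exists_isDetermined_symPow hM g hA
  -- `A` alone need not determine `U g`. But `g` commutes with the `symPow g j` and is almost fixed
  -- by averages of `symPow g j * V * symPow g j`, whose coefficients are polynomials in `A` up to
  -- null families.
  have hstep : HasSmallOrbits 𝓕 (insert (U g) {A}) := by
    refine hbase.insert_of_limit hM (hU g) fun ε hε => ?_
    obtain ⟨m, hm⟩ := exists_nat_one_div_lt (show 0 < min ε (ε ^ 2) by positivity)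
    let n := m + 1
    have hn : n ≠ 0 := Nat.succ_ne_zero m
    have hnR : (0 : ℝ) < n := by positivity
    have hm' : (n : ℝ)⁻¹ < min ε (ε ^ 2) := by
      rw [← one_div]; exact_mod_cast hm
    refine ⟨n, fun p => (2 * n : ℂ)⁻¹ • b (p + 1), fun p => b (p + 1),
      fun p => (2 * n : ℂ)⁻¹ • symPow g (p + 1), fun p => symPow g (p + 1),
      fun p => (hb' _).smul _, fun p => hb' _, fun p => pair_smul _ (hb _), fun p => hb _, ?_, ?_⟩
    · have h := norm_sum_symPow_sub hg (Commute.refl g) hn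
      refine lt_of_pow_lt_pow_left₀ 2 hε.le (h.trans_lt ?_)
      refine lt_of_le_of_lt ?_ (hm'.trans_le (min_le_right _ _))
      exact inv_anti₀ hnR (by linarith)
    · have h1 : ∀ p q : Fin n,
          ⟪(delta (1 : G) : ell2 G), (star ((2 * n : ℂ)⁻¹ • symPow g (p + 1)) *
            ((2 * n : ℂ)⁻¹ • symPow g (q + 1))) (delta 1)⟫_ℂ *
          ⟪(delta (1 : G) : ell2 G), (symPow g (q + 1) * star (symPow g (p + 1)))
            (delta 1)⟫_ℂ = if p = q then (n : ℂ)⁻¹ * (n : ℂ)⁻¹ else 0 := by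
        intro p q
        rw [star_smul, star_symPow, smul_mul_smul_comm, smul_apply, inner_smul_right,
          inner_symPow_mul hg, inner_symPow_mul hg]
        simp only [Fin.val_inj, eq_comm (a := q)]
        split_ifs
        · simp only [star_inv₀, star_mul', star_ofNat, star_natCast, mul_inv]
          ring
        · simp
      have hn' : (n : ℂ) ≠ 0 := by exact_mod_cast hn
      simp_rw [h1]
      simp only [Finset.sum_ite_eq, Finset.mem_univ, if_true, Finset.sum_const, Finset.card_univ,
        Fintype.card_fin, nsmul_eq_mul]
      rw [mul_inv_cancel_left₀ hn', norm_inv, Complex.norm_natCast]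
      exact hm'.trans_le (min_le_left _ _)
  exact hstep.of_isDetermined fun c hc => IsDetermined.of_mem (by
    rw [Set.image_singleton] at hc
    exact Or.inl hc)

/-- Every lift of an element of `L(G)` is determined by lifts of the group elements. -/
lemma isDetermined_of_mem_groupVN {b : ConfFam C} {y : ell2 G →L[ℂ] ell2 G}
    (hb : (b, y) ∈ hM.limitPairs) : IsDetermined 𝓕 (U '' Set.univ) b := by
  have hlift : ∀ a ∈ StarAlgebra.adjoin ℂ (Set.range (leftRegular : G → _)),
      ∃ c, (c, a) ∈ hM.limitPairs ∧ IsDetermined 𝓕 (U '' Set.univ) c := by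
    intro a ha
    induction ha using StarAlgebra.adjoin_induction with
    | mem x hx =>
      obtain ⟨g, rfl⟩ := hx
      exact ⟨U g, hU g, IsDetermined.of_mem ⟨g, trivial, rfl⟩⟩
    | algebraMap r => exact ⟨_, pair_algebraMap r, IsDetermined.algebraMap r⟩
    | add x y _ _ hx hy =>
      obtain ⟨c, hc, hc'⟩ := hx
      obtain ⟨d, hd, hd'⟩ := hy
      exact ⟨_, pair_add hc hd, hc'.add hd'⟩
    | mul x y _ _ hx hy =>
      obtain ⟨c, hc, hc'⟩ := hx
      obtain ⟨d, hd, hd'⟩ := hy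
      exact ⟨_, pair_mul hc hd, hc'.mul hd'⟩
    | star x _ hx =>
      obtain ⟨c, hc, hc'⟩ := hx
      exact ⟨_, pair_star hc, hc'.star⟩
  have hy : y ∈ groupVN G := hb.1
  refine IsDetermined.of_approx fun ε hε => ?_
  obtain ⟨a, ha, hay⟩ := exists_norm_sub_apply_lt
    (StarAlgebra.adjoin ℂ (Set.range (leftRegular : G → _))) (y := y) (by
      intro z hz
      refine mem_vnGenerated.1 hy z ?_
      intro c hc
      have hc' := StarAlgebra.subset_adjoin ℂ _ hc
      exact ⟨hz _ hc', hz _ (star_mem hc')⟩) (delta (1 : G)) hε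
  obtain ⟨c, hc, hc'⟩ := hlift a ha
  refine ⟨c, hc', ?_⟩
  have := hM.tendsto_hsNorm (pair_sub hc hb)
  exact (this.eventually_lt_const hay).mono fun _ hi => hi.le

end InfiniteOrder

/-! ### Elementary matrices -/

section Transvections

open Matrix SpecialLinearGroup

variable {ι : Type*} [Fintype ι] [DecidableEq ι]

/-- The set of the elementary matrices `1 + E_{ij}`, `i ≠ j`. -/
def elementaryMatrices (ι : Type*) [Fintype ι] [DecidableEq ι] : Set (SpecialLinearGroup ι ℤ) :=
  {g | ∃ (i j : ι) (h : i ≠ j), g = SpecialLinearGroup.transvection h 1}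

lemma transvection_eq_zpow {i j : ι} (h : i ≠ j) (c : ℤ) :
    SpecialLinearGroup.transvection h c = SpecialLinearGroup.transvection h (1 : ℤ) ^ c := by
  induction c using Int.induction_on with
  | zero => rw [transvection_coeff_zero, zpow_zero]
  | succ n ih => rw [transvection_add, ih, _root_.zpow_add_one]
  | pred n ih => rw [sub_eq_add_neg, transvection_add, ih, ← transvection_inv, _root_.zpow_add,
      _root_.zpow_neg_one]

lemma transvection_mem_closure {i j : ι} (h : i ≠ j) (c : ℤ) :
    SpecialLinearGroup.transvection h c ∈ Subgroup.closure (elementaryMatrices ι) := by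
  rw [transvection_eq_zpow]
  exact Subgroup.zpow_mem _ (Subgroup.subset_closure (show _ ∈ elementaryMatrices ι from ⟨i, j, h, rfl⟩)) c

/-- The row `m` being added is outside `t`, so it never changes and the transvections do not
interfere. -/
lemma exists_rowOperation {m : ι} (t : Finset ι) (hm : m ∉ t) (c : ι → ℤ) :
    ∃ h ∈ Subgroup.closure (elementaryMatrices ι), ∀ (g : SpecialLinearGroup ι ℤ) (i b : ι),
      (h * g).1 i b = g.1 i b + if i ∈ t then c i * g.1 m b else 0 := by
  induction t using Finset.induction_on with
  | empty => exact ⟨1, one_mem _, fun g i b => by simp⟩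
  | insert a t ha ih =>
    obtain ⟨hma, hmt⟩ : m ≠ a ∧ m ∉ t := by simpa using hm
    obtain ⟨h, hh, H⟩ := ih hmt
    refine ⟨SpecialLinearGroup.transvection hma.symm (c a) * h,
      mul_mem (transvection_mem_closure _ _) hh, fun g i b => ?_⟩
    have h1 : (SpecialLinearGroup.transvection hma.symm (c a) * h * g).1 =
      Matrix.transvection a m (c a) * (h * g).1 := by
      rw [mul_assoc]; rfl
    rw [h1]
    by_cases hi : i = a
    · subst hi
      rw [transvection_mul_apply_same, H, H]
      simp [hmt, ha]
    · rw [transvection_mul_apply_of_ne _ _ _ _ hi, H]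
      simp [hi]

/-- The columns of `g` with index in `s` are those of the identity matrix. -/
def HasStandardColumns (s : Finset ι) (g : SpecialLinearGroup ι ℤ) : Prop :=
  ∀ j ∈ s, ∀ i, g.1 i j = (1 : Matrix ι ι ℤ) i j

/-- The standard columns force row `m` of `g⁻¹` to vanish on `s`. The resulting relation shows that
the entries of column `m` outside `s` are coprime. -/
lemma HasStandardColumns.sum_inv_mul {s : Finset ι} {g : SpecialLinearGroup ι ℤ}
    (hg : HasStandardColumns s g) {m : ι} (hm : m ∉ s) :
    ∑ i ∈ sᶜ, (g⁻¹).1 m i * g.1 i m = 1 := by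
  have h : ∀ j, ∑ i, (g⁻¹).1 m i * g.1 i j = (1 : Matrix ι ι ℤ) m j := by
    intro j
    rw [← Matrix.mul_apply]
    exact congrFun (congrFun (congrArg Subtype.val (inv_mul_cancel g)) m) j
  have h0 : ∀ j ∈ s, (g⁻¹).1 m j = 0 := by
    intro j hj
    have := h j
    simp_rw [hg j hj] at this
    rw [← Matrix.mul_apply, mul_one, Matrix.one_apply_ne (by rintro rfl; exact hm hj)] at this
    exact this
  have h1 := h m
  rw [Matrix.one_apply_eq, ← Finset.sum_add_sum_compl s, Finset.sum_eq_zero, zero_add] at h1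
  · exact h1
  · intro i hi
    rw [h0 i hi, zero_mul]

/-- Rows outside `s` vanish in the standard columns, so adding them to other rows preserves these
columns. The Euclidean algorithm on column `m`, in the rows outside `s`, leaves one nonzero entry
there; it is a unit by `sum_inv_mul`, and is moved to the diagonal as `1` and used to clear the
column. -/
lemma HasStandardColumns.mem_closure_of_insert {s : Finset ι} {m : ι} (hm : m ∉ s)
    (H : ∀ g, HasStandardColumns (insert m s) g →
      g ∈ Subgroup.closure (elementaryMatrices ι))
    {g : SpecialLinearGroup ι ℤ} (hg : HasStandardColumns s g) :
    g ∈ Subgroup.closure (elementaryMatrices ι) := by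
  -- adding a multiple of a row outside of `s`
  have hop : ∀ (g : SpecialLinearGroup ι ℤ), HasStandardColumns s g → ∀ (a : ι), a ∉ s →
      ∀ (t : Finset ι), a ∉ t → ∀ (c : ι → ℤ), ∃ g' : SpecialLinearGroup ι ℤ,
        HasStandardColumns s g' ∧ (g' ∈ Subgroup.closure (elementaryMatrices ι) →
          g ∈ Subgroup.closure (elementaryMatrices ι)) ∧
        ∀ i, g'.1 i m = g.1 i m + if i ∈ t then c i * g.1 a m else 0 := by
    intro g hg a ha t hat c
    obtain ⟨h, hh, hh'⟩ := exists_rowOperation t hat c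
    refine ⟨h * g, fun j hj i => ?_, fun h1 => (Subgroup.mul_mem_cancel_left _ hh).1 h1,
      fun i => hh' g i m⟩
    rw [hh', hg j hj, hg j hj, Matrix.one_apply_ne (show a ≠ j by rintro rfl; exact ha hj)]
    simp
  have hone : ∀ g, HasStandardColumns s g → g.1 m m = 1 →
      g ∈ Subgroup.closure (elementaryMatrices ι) := by
    intro g hg hgm
    obtain ⟨g', hg', hmem, h⟩ := hop g hg m hm {m}ᶜ (by simp) fun i => - g.1 i m
    refine hmem (H g' fun j hj i => ?_)
    rcases Finset.mem_insert.1 hj with rfl | hj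
    · rw [h, hgm]
      by_cases hi : i = j
      · subst hi; simp [hgm]
      · simp [hi]
    · exact hg' j hj i
  have hunit : ∀ (g : SpecialLinearGroup ι ℤ), HasStandardColumns s g → ∀ a ∉ s,
      (∀ i ∉ s, i ≠ a → g.1 i m = 0) → g ∈ Subgroup.closure (elementaryMatrices ι) := by
    intro g hg a ha h0
    have h1 := hg.sum_inv_mul hm
    rw [Finset.sum_eq_single_of_mem a (by simpa using ha) fun i hi hia => by
      rw [h0 i (by simpa using hi) hia, mul_zero]] at h1
    have h2 := Int.eq_one_or_neg_one_of_mul_eq_one' (by rw [mul_comm]; exact h1)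
    by_cases ham : a = m
    · subst ham
      rcases h2 with ⟨h2, -⟩ | ⟨h2, -⟩
      · exact hone g hg h2
      · by_cases hl : ∃ l ∉ s, l ≠ a
        · obtain ⟨l, hls, hla⟩ := hl
          -- A pivot `-1` becomes `1` with the help of a second row: subtracting row `a` puts `1`
          -- into row `l`, and adding row `l` twice gives `-1 + 2 = 1`.
          obtain ⟨g', hg', hmem, h⟩ := hop g hg a ha {l} (by simpa using hla.symm) fun i => -1
          obtain ⟨g'', hg'', hmem', h'⟩ := hop g' hg' l hls {a} (by simpa using hla) fun i => 2
          refine hmem (hmem' (hone g'' hg'' ?_))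
          rw [h', h, h, h2, h0 l hls hla]
          simp [hla.symm]
        -- Without a second row outside `s`, the matrix differs from the identity only in column
        -- `a`, and its determinant would be `-1`.
        · push Not at hl
          exfalso
          have h3 : g.1 = (1 : Matrix ι ι ℤ).updateCol a fun i => g.1 i a := by
            ext i j
            by_cases hj : j = a
            · subst hj; simp
            · rw [Matrix.updateCol_ne hj, hg j (by by_contra hjs; exact hj (hl j hjs))]
          have h4 := g.2
          rw [h3, ← Matrix.cramer_apply, Matrix.cramer_one] at h4
          simp [h2] at h4
    · obtain ⟨g', hg', hmem, h⟩ := hop g hg a ha {m} (by simpa using ham) fun i => g.1 a m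
      refine hmem (hone g' hg' ?_)
      rw [h, h0 m hm (Ne.symm ham)]
      rcases h2 with ⟨h2, -⟩ | ⟨h2, -⟩ <;> simp [h2]
  -- the Euclidean algorithm on the column `m`
  induction hd : ∑ i ∈ sᶜ, (g.1 i m).natAbs using Nat.strong_induction_on generalizing g with
  | _ d ih =>
  have hred : ∀ a ∉ s, ∀ b ∉ s, a ≠ b → g.1 a m ≠ 0 → (g.1 a m).natAbs ≤ (g.1 b m).natAbs →
      g ∈ Subgroup.closure (elementaryMatrices ι) := by
    intro a ha b hb hab ha0 hle
    obtain ⟨c, hc⟩ : ∃ c : ℤ, (g.1 b m + c * g.1 a m).natAbs < (g.1 b m).natAbs := by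
      rcases le_or_gt 0 (g.1 a m * g.1 b m) with h | h
      · refine ⟨-1, ?_⟩
        rcases mul_nonneg_iff.1 h with h | h <;> omega
      · refine ⟨1, ?_⟩
        rcases mul_neg_iff.1 h with h | h <;> omega
    obtain ⟨g', hg', hmem, h⟩ := hop g hg a ha {b} (by simpa using hab) fun i => c
    refine hmem (ih _ ?_ hg' rfl)
    rw [← hd]
    refine Finset.sum_lt_sum (fun i _ => ?_) ⟨b, by simpa using hb, ?_⟩
    · rw [h]
      by_cases hi : i = b
      · subst hi; simpa using hc.le
      · simp [hi]
    · rw [h]; simpa using hc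
  by_cases hex : ∃ a ∉ s, g.1 a m ≠ 0
  · obtain ⟨a, ha, ha0⟩ := hex
    by_cases hex' : ∃ b ∉ s, b ≠ a ∧ g.1 b m ≠ 0
    · obtain ⟨b, hb, hba, hb0⟩ := hex'
      rcases le_total (g.1 a m).natAbs (g.1 b m).natAbs with h | h
      · exact hred a ha b hb hba.symm ha0 h
      · exact hred b hb a ha hba hb0 h
    · push Not at hex'
      exact hunit g hg a ha hex'
  · push Not at hex
    exact hunit g hg m hm fun i hi _ => hex i hi

/-- `SL_ι(ℤ)` is generated by the elementary matrices. -/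
theorem closure_elementaryMatrices : Subgroup.closure (elementaryMatrices ι) = ⊤ := by
  have key : ∀ t : Finset ι, ∀ g, HasStandardColumns tᶜ g →
      g ∈ Subgroup.closure (elementaryMatrices ι) := by
    intro t
    induction t using Finset.induction_on with
    | empty =>
      intro g hg
      have : g = 1 := by
        ext i j
        exact hg j (by simp) i
      rw [this]
      exact one_mem _
    | insert m t hm ih =>
      intro g hg
      refine HasStandardColumns.mem_closure_of_insert (m := m) (by simp) ?_ hg
      have : insert m (insert m t)ᶜ = tᶜ := by
        ext i
        by_cases hi : i = m
        · subst hi; simp [hm]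
        · simp [hi]
      rw [this]
      exact ih
  refine (Subgroup.eq_top_iff' _).2 fun g => key Finset.univ g fun j hj => ?_
  simp at hj

lemma finite_elementaryMatrices : (elementaryMatrices ι).Finite := by
  refine (Set.finite_range fun p : {p : ι × ι // p.1 ≠ p.2} =>
    SpecialLinearGroup.transvection p.2 (1 : ℤ)).subset ?_
  rintro _ ⟨i, j, h, rfl⟩
  exact ⟨⟨(i, j), h⟩, rfl⟩

lemma not_isOfFinOrder_transvection {i j : ι} (h : i ≠ j) :
    ¬ IsOfFinOrder (SpecialLinearGroup.transvection h (1 : ℤ)) := by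
  rw [← injective_zpow_iff_not_isOfFinOrder]
  intro a b hab
  simp only [← transvection_eq_zpow] at hab
  have := congrArg (fun g : SpecialLinearGroup ι ℤ => g.1 i j) hab
  simpa [transvection_coe, h] using this

lemma commute_transvection_of_row {i j k : ι} (hj : i ≠ j) (hk : i ≠ k) (a b : ℤ) :
    Commute (SpecialLinearGroup.transvection hj a) (SpecialLinearGroup.transvection hk b) := by
  refine Subtype.ext ?_
  simp [transvection_coe, mul_add, add_mul, hj.symm, hk.symm, add_comm, add_left_comm]

lemma commute_transvection_of_col {i j k : ι} (hi : i ≠ k) (hj : j ≠ k) (a b : ℤ) :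
    Commute (SpecialLinearGroup.transvection hi a) (SpecialLinearGroup.transvection hj b) := by
  refine Subtype.ext ?_
  simp [transvection_coe, mul_add, add_mul, hi.symm, hj.symm, add_comm, add_left_comm]

/-- A property of subsets of `SL_ι(ℤ)`, `|ι| ≥ 3`, that holds for the elements of infinite order
and passes to centralizers of elements of infinite order holds for the whole group. -/
theorem univ_of_centralizers (hι : 3 ≤ Fintype.card ι) {P : Set (SpecialLinearGroup ι ℤ) → Prop}
    (hmono : ∀ K L, K ⊆ L → P L → P K)
    (hsing : ∀ g, ¬ IsOfFinOrder g → P {g})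
    (hins : ∀ K, P K → ∀ t ∈ K, ¬ IsOfFinOrder t → ∀ v, Commute v t → P (insert v K))
    (hcl : ∀ K, P K → P (Subgroup.closure K)) : P Set.univ := by
  have hunion : ∀ K, P K → ∀ F : Set (SpecialLinearGroup ι ℤ), F.Finite →
      (∀ v ∈ F, ∃ t ∈ K, ¬ IsOfFinOrder t ∧ Commute v t) → P (K ∪ F) := by
    intro K hK F hF
    induction F, hF using Set.Finite.induction_on with
    | empty => intro _; simpa using hK
    | @insert v F _ _ ih =>
      intro h
      obtain ⟨t, ht, ht', hvt⟩ := h v (Set.mem_insert _ _)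
      rw [Set.union_insert]
      exact hins _ (ih fun w hw => h w (Set.mem_insert_of_mem _ hw)) t (Or.inl ht) ht' v hvt
  obtain ⟨a, b, c, hab, -, -⟩ := Fintype.two_lt_card_iff.1 hι
  -- Three rounds. Row `a` commutes with the first transvection. An elementary matrix at `(i, j)`
  -- with `j ≠ a` shares its column with the one at `(a, j)`. An arbitrary one at `(i, j)` shares
  -- its row with the one at `(i, k)`, where `k` differs from `a` and `i`; such a `k` exists because
  -- `|ι| ≥ 3`.
  let F₁ : Set (SpecialLinearGroup ι ℤ) :=
    {g | ∃ (j : ι) (h : a ≠ j), g = SpecialLinearGroup.transvection h 1}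
  let F₂ : Set (SpecialLinearGroup ι ℤ) :=
    {g | ∃ (i j : ι) (_ : a ≠ j) (h : i ≠ j), g = SpecialLinearGroup.transvection h 1}
  have h1 : P ({SpecialLinearGroup.transvection hab 1} ∪ F₁) := by
    refine hunion _ (hsing _ (not_isOfFinOrder_transvection hab)) _
      (finite_elementaryMatrices.subset ?_) ?_
    · rintro _ ⟨j, h, rfl⟩; exact ⟨a, j, h, rfl⟩
    · rintro _ ⟨j, h, rfl⟩
      exact ⟨_, rfl, not_isOfFinOrder_transvection hab, commute_transvection_of_row h hab 1 1⟩
  have h2 := hunion _ h1 F₂ (finite_elementaryMatrices.subset (by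
    rintro _ ⟨i, j, _, h, rfl⟩; exact ⟨i, j, h, rfl⟩)) (by
    rintro _ ⟨i, j, hj, h, rfl⟩
    exact ⟨_, Or.inr ⟨j, hj, rfl⟩, not_isOfFinOrder_transvection hj,
      commute_transvection_of_col h hj 1 1⟩)
  have h3 := hunion _ h2 _ finite_elementaryMatrices (by
    rintro _ ⟨i, j, h, rfl⟩
    obtain ⟨k, hk⟩ : ∃ k, k ∉ ({a, i} : Finset ι) := by
      by_contra! hall
      have h5 : Finset.univ ⊆ ({a, i} : Finset ι) := fun x _ => hall x
      have := (Finset.card_le_card h5).trans Finset.card_le_two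
      rw [Finset.card_univ] at this
      omega
    obtain ⟨hka, hki⟩ : k ≠ a ∧ k ≠ i := by simpa using hk
    exact ⟨_, Or.inr ⟨i, k, hka.symm, hki.symm, rfl⟩, not_isOfFinOrder_transvection hki.symm,
      commute_transvection_of_row h hki.symm 1 1⟩)
  have h4 := hcl _ (hmono _ _ Set.subset_union_right h3)
  rwa [closure_elementaryMatrices, Subgroup.coe_top] at h4

end Transvections

/-! ### Small orbits for `SL_ι(ℤ)` -/

section SmallOrbits

open Matrix

variable {ι : Type*} [Fintype ι] [DecidableEq ι] {C : ℕ+ → Type*} {𝓕 : Filter (Σ k, C k)}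
  {𝒜 : StarSubalgebra ℂ (ConfFam C ×
    (ell2 (SpecialLinearGroup ι ℤ) →L[ℂ] ell2 (SpecialLinearGroup ι ℤ)))}

/-- Matrix models of `L(SL_ι(ℤ))`, `|ι| ≠ 2`, have small orbits. -/
theorem hasSmallOrbits_specialLinearGroup (hι : Fintype.card ι ≠ 2)
    (hM : IsMatrixModel 𝓕 (groupVN (SpecialLinearGroup ι ℤ)) (delta 1) 𝒜)
    {U : SpecialLinearGroup ι ℤ → ConfFam C} (hU : ∀ g, (U g, leftRegular g) ∈ hM.limitPairs)
    (hk : ∀ m : ℕ, ∀ᶠ i in 𝓕, m ≤ (i.1 : ℕ)) : HasSmallOrbits 𝓕 (U '' Set.univ) := by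
  rcases lt_or_ge (Fintype.card ι) 3 with h | h
  · have hι' : Fintype.card ι ≤ 1 := by omega
    have hs : Subsingleton ι := Fintype.card_le_one_iff_subsingleton.1 hι'
    have h0 : Subgroup.closure (elementaryMatrices ι) = Subgroup.closure ∅ := by
      congr 1
      refine Set.eq_empty_of_forall_notMem ?_
      rintro _ ⟨i, j, hij, -⟩
      exact hij (Subsingleton.elim i j)
    have h1 : HasSmallOrbits 𝓕 (U '' ∅) := by
      rw [Set.image_empty]
      exact HasSmallOrbits.empty
    have h2 := h1.closure hM hU
    rwa [← h0, closure_elementaryMatrices, Subgroup.coe_top] at h2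
  · refine univ_of_centralizers h (P := fun K => HasSmallOrbits 𝓕 (U '' K)) ?_ ?_ ?_ ?_
    · exact fun K L hKL hL => hL.of_isDetermined fun b hb =>
        IsDetermined.of_mem (Set.image_mono hKL hb)
    · exact fun g hg => HasSmallOrbits.of_not_isOfFinOrder hM hU hk hg
    · intro K hK t ht ht' v hvt
      have hmem : ∀ j : ℕ, t ^ j ∈ Subgroup.closure K := fun j =>
        Subgroup.pow_mem _ (Subgroup.subset_closure ht) j
      -- An element commuting with `t` conjugates the infinitely many powers of `t` to themselves.
      refine HasSmallOrbits.insert_of_conj hM hU hK (fun j => t ^ j)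
        (injective_pow_iff_not_isOfFinOrder.2 ht') hmem fun j => ?_
      rw [(hvt.pow_right j).eq, mul_inv_cancel_right]
      exact hmem j
    · exact fun K hK => hK.closure hM hU

end SmallOrbits

/-! ### Almost free actions on finite sets -/

section Sofic

/-- Let `Q` act by translation on as many copies of itself as fit into `k` points, and trivially on
the remaining `k % |Q|` points. -/
lemma exists_hom_perm (Q : Type*) [Group Q] [Finite Q] (k : ℕ) :
    ∃ π : Q →* Equiv.Perm (Fin k), ∀ x ≠ 1,
      (Function.fixedPoints (π x)).ncard ≤ Nat.card Q := by
  classical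
  have := Fintype.ofFinite Q
  let a := k / Fintype.card Q
  have hle : Fintype.card (Q × Fin a) ≤ Fintype.card (Fin k) := by
    rw [Fintype.card_prod, Fintype.card_fin, Fintype.card_fin]
    exact Nat.mul_div_le k _
  obtain ⟨e⟩ := Function.Embedding.nonempty_of_card_le hle
  let ρ : Q →* Equiv.Perm (Q × Fin a) :=
    { toFun := fun x => Equiv.prodCongr (Equiv.mulLeft x) (Equiv.refl _)
      map_one' := by ext ⟨y, i⟩ <;> simp
      map_mul' := fun x y => by ext ⟨z, i⟩ <;> simp [mul_assoc] }
  refine ⟨(Equiv.Perm.viaEmbeddingHom e).comp ρ, fun x hx => ?_⟩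
  have hsub : Function.fixedPoints (((Equiv.Perm.viaEmbeddingHom e).comp ρ) x) ⊆
      (Set.range e)ᶜ := by
    rintro _ hi ⟨⟨y, j⟩, rfl⟩
    have h : (ρ x).viaEmbedding e (e (y, j)) = e (y, j) := hi
    rw [Equiv.Perm.viaEmbedding_apply, e.injective.eq_iff] at h
    have h1 : x * y = y := congrArg Prod.fst h
    exact hx (by simpa using h1)
  refine (Set.ncard_le_ncard hsub (Set.toFinite _)).trans ?_
  have h1 := Set.ncard_add_ncard_compl (Set.range e)
  rw [Set.ncard_range_of_injective e.injective, Nat.card_eq_fintype_card,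
    Nat.card_eq_fintype_card, Fintype.card_prod, Fintype.card_fin, Fintype.card_fin] at h1
  have h2 := Nat.div_add_mod k (Fintype.card Q)
  have h3 : k % Fintype.card Q < Fintype.card Q := Nat.mod_lt _ Fintype.card_pos
  rw [Nat.card_eq_fintype_card]
  simp only [a] at h1
  omega

/-- A group with sufficiently many finite quotients acts almost freely on finite sets of any
large cardinality. -/
lemma exists_hom_perm_tendsto {G : Type*} [Group G] {Q : ℕ → Type*} [∀ q, Group (Q q)]
    [∀ q, Finite (Q q)] (ρ : ∀ q, G →* Q q) (hρ : ∀ g ≠ 1, ∀ᶠ q in atTop, ρ q g ≠ 1) :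
    ∃ π : (k : ℕ+) → G →* Equiv.Perm (Fin k), ∀ g ≠ 1,
      Tendsto (fun k : ℕ+ => ((Function.fixedPoints (π k g)).ncard : ℝ) / ((k : ℕ) : ℝ))
        atTop (𝓝 0) := by
  classical
  -- The quotient grows so slowly that the proportion `|Q| / k` of leftover points is at most `1 /
  -- q`. The index `0` always qualifies.
  let q : ℕ+ → ℕ := fun k => Nat.findGreatest (fun q => q * Nat.card (Q q) ≤ k) k
  have hq : ∀ k : ℕ+, q k * Nat.card (Q (q k)) ≤ k := fun k =>
    Nat.findGreatest_spec (P := fun q => q * Nat.card (Q q) ≤ k) (Nat.zero_le k) (by simp)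
  have hcoe : Tendsto (fun k : ℕ+ => (k : ℕ)) atTop atTop := tendsto_atTop.2 fun m =>
    (eventually_ge_atTop (⟨m + 1, m.succ_pos⟩ : ℕ+)).mono fun k hk =>
      (Nat.le_succ m).trans (show (⟨m + 1, m.succ_pos⟩ : ℕ+) ≤ k from hk)
  have hqt : Tendsto q atTop atTop := by
    refine tendsto_atTop.2 fun m => ?_
    filter_upwards [hcoe.eventually_ge_atTop m, hcoe.eventually_ge_atTop (m * Nat.card (Q m))]
      with k h1 h2
    exact Nat.le_findGreatest h1 h2
  choose π hπ using fun k : ℕ+ => exists_hom_perm (Q (q k)) k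
  refine ⟨fun k => (π k).comp (ρ (q k)), fun g hg => ?_⟩
  have hlim : Tendsto (fun k : ℕ+ => ((q k : ℕ) : ℝ)⁻¹) atTop (𝓝 0) :=
    tendsto_inv_atTop_zero.comp (tendsto_natCast_atTop_atTop.comp hqt)
  refine squeeze_zero' (Eventually.of_forall fun k => by positivity) ?_ hlim
  filter_upwards [hqt.eventually (hρ g hg), hqt.eventually_gt_atTop 0] with k h1 h2
  have h3 := hπ k _ h1
  have h4 : ((q k : ℕ) : ℝ) * Nat.card (Q (q k)) ≤ (k : ℕ) := by exact_mod_cast hq k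
  have h5 : (0 : ℝ) < q k := by exact_mod_cast h2
  have h6 : (0 : ℝ) < ((k : ℕ) : ℝ) := by exact_mod_cast k.pos
  rw [div_le_iff₀ h6]
  calc _ ≤ (Nat.card (Q (q k)) : ℝ) := by exact_mod_cast h3
    _ ≤ ((q k : ℕ) : ℝ)⁻¹ * (k : ℕ) := by rw [← div_eq_inv_mul, le_div_iff₀ h5]; linarith

/-- Residual finiteness by congruence quotients: a nonzero entry of `g - 1` survives once the
modulus exceeds its absolute value. The modulus is `q + 1` because `ZMod 0` is infinite. -/
lemma exists_hom_perm_specialLinearGroup (ι : Type*) [Fintype ι] [DecidableEq ι] :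
    ∃ π : (k : ℕ+) → Matrix.SpecialLinearGroup ι ℤ →* Equiv.Perm (Fin k), ∀ g ≠ 1,
      Tendsto (fun k : ℕ+ => ((Function.fixedPoints (π k g)).ncard : ℝ) / ((k : ℕ) : ℝ))
        atTop (𝓝 0) := by
  have : ∀ q : ℕ, Finite (Matrix.SpecialLinearGroup ι (ZMod (q + 1))) := fun q =>
    Subtype.finite
  refine exists_hom_perm_tendsto
    (fun q => Matrix.SpecialLinearGroup.map (Int.castRingHom (ZMod (q + 1)))) fun g hg => ?_
  obtain ⟨i, j, hij⟩ : ∃ i j, g.1 i j ≠ (1 : Matrix ι ι ℤ) i j := by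
    by_contra! h
    exact hg (Matrix.SpecialLinearGroup.ext _ _ h)
  filter_upwards [eventually_ge_atTop (g.1 i j - (1 : Matrix ι ι ℤ) i j).natAbs] with q hq h
  have h1 : ((g.1 i j : ℤ) : ZMod (q + 1)) = (((1 : Matrix ι ι ℤ) i j : ℤ) : ZMod (q + 1)) := by
    have := congrArg (fun x : Matrix.SpecialLinearGroup ι (ZMod (q + 1)) => x.1 i j) h
    refine Eq.trans this ?_
    by_cases hij : i = j
    · subst hij; simp
    · simp [hij]
  rw [← sub_eq_zero, ← Int.cast_sub, ZMod.intCast_zmod_eq_zero_iff_dvd] at h1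
  have h2 := Int.eq_zero_of_abs_lt_dvd h1 (by
    rw [Int.abs_eq_natAbs]; exact Int.ofNat_lt.2 (Nat.lt_succ_of_le hq))
  exact hij (sub_eq_zero.1 h2)

end Sofic

/-! ### Permutation matrices as a matrix model -/

section PermModel

variable {G : Type*} [Group G]

/-- The permutation matrices of an action of `G` on finite sets. -/
def permFam (π : (k : ℕ+) → G →* Equiv.Perm (Fin k)) : G →* BddSeq where
  toFun g := ⟨fun k => (Matrix.permMatrixHom (π k g) : Mat k), memℓp_infty ⟨1, by
    rintro _ ⟨k, rfl⟩
    exact Matrix.permMatrix_l2_opNorm_le _⟩⟩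
  map_one' := by
    ext1; funext k
    exact (congrArg _ (map_one (π k))).trans (map_one _)
  map_mul' g h := by
    ext1; funext k
    exact (congrArg _ (map_mul (π k) g h)).trans (map_mul _ _ _)

lemma permFam_apply (π : (k : ℕ+) → G →* Equiv.Perm (Fin k)) (g : G) (k : ℕ+) :
    permFam π g k = ((π k g)⁻¹).permMatrix ℂ := rfl

lemma star_permFam (π : (k : ℕ+) → G →* Equiv.Perm (Fin k)) (g : G) :
    star (permFam π g) = permFam π g⁻¹ := by
  ext1; funext k
  rw [lp.star_apply, permFam_apply, permFam_apply, Matrix.star_eq_conjTranspose,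
    Matrix.conjTranspose_permMatrix, map_inv]

/-- Almost free actions on finite sets yield a matrix model of `L(G)`. -/
theorem exists_isMatrixModel_of_perm (π : (k : ℕ+) → G →* Equiv.Perm (Fin k))
    (hπ : ∀ g ≠ 1, Tendsto (fun k : ℕ+ => ((Function.fixedPoints (π k g)).ncard : ℝ) /
      ((k : ℕ) : ℝ)) atTop (𝓝 0)) :
    ∃ 𝒜, IsMatrixModel (d := fun k : ℕ+ => k) atTop (groupVN G) (delta (1 : G)) 𝒜 := by
  classical
  let f : G →* MatFam (fun k : ℕ+ => k) × (ell2 G →L[ℂ] ell2 G) :=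
    { toFun := fun g => (permFam π g, leftRegular g)
      map_one' := Prod.ext (map_one _) leftRegular_one
      map_mul' := fun g h => Prod.ext (map_mul _ _ _) (leftRegular_mul g h) }
  refine ⟨_, isMatrixModel_adjoin (Set.range f) ?_ (norm_delta 1) groupVN_tracial ?_⟩
  · rw [← Set.range_comp]; rfl
  · intro z hz
    have hz' : z ∈ MonoidHom.mrange f := by
      refine (Submonoid.closure_le.2 ?_) hz
      rintro x (⟨g, rfl⟩ | ⟨g, hg⟩)
      · exact ⟨g, rfl⟩
      · refine ⟨g⁻¹, ?_⟩
        rw [← star_star x, ← hg]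
        exact Prod.ext (star_permFam π g).symm (star_leftRegular g).symm
    obtain ⟨g, rfl⟩ := hz'
    -- The normalized trace of a permutation matrix is the proportion of fixed points; passing to
    -- the inverse permutation does not change it.
    have h1 : ∀ k : ℕ+, ntrace (permFam π g k) =
        ((((Function.fixedPoints (π k g)).ncard : ℝ) / ((k : ℕ) : ℝ) : ℝ) : ℂ) := by
      intro k
      rw [ntrace, permFam_apply, ← map_inv, Matrix.trace_permutation, map_inv]
      have h2 : Function.fixedPoints ⇑(π k g)⁻¹ = Function.fixedPoints (π k g) := by
        ext i
        rw [Function.mem_fixedPoints_iff, Function.mem_fixedPoints_iff, Equiv.Perm.inv_eq_iff_eq, eq_comm]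
      rw [h2]
      push_cast
      rw [div_eq_inv_mul]
    have h2 : Tendsto (fun k : ℕ+ => ntrace (permFam π g k)) atTop
        (𝓝 ⟪delta (1 : G), leftRegular g (delta 1)⟫_ℂ) := by
      simp_rw [h1, inner_leftRegular]
      by_cases hg : g = 1
      · subst hg
        simp only [map_one, if_true]
        rw [← Complex.ofReal_one, tendsto_ofReal_complex_iff]
        refine tendsto_const_nhds.congr fun k => ?_
        have : Function.fixedPoints ⇑(1 : Equiv.Perm (Fin k)) = Set.univ := by
          ext i; simp
        have h6 : ((k : ℕ) : ℝ) ≠ 0 := by exact_mod_cast k.pos.ne'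
        rw [this, Set.ncard_univ, Nat.card_eq_fintype_card, Fintype.card_fin, div_self h6]
      · rw [if_neg hg, ← Complex.ofReal_zero, tendsto_ofReal_complex_iff]
        exact hπ g hg
    exact h2

end PermModel

/-! ### The embedding into the ultraproduct -/

section Embedding

variable {H : Type*} [NormedAddCommGroup H] [InnerProductSpace ℂ H] [CompleteSpace H]
  {N : VonNeumannAlgebra H} {e : H}
  {𝒜 : StarSubalgebra ℂ (MatFam (fun k : ℕ+ => k) × (H →L[ℂ] H))}
  (hM : IsMatrixModel (d := fun k : ℕ+ => k) atTop N e 𝒜)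

include hM in
lemma IsMatrixModel.exists_lift_atTop (y : N.toStarSubalgebra) :
    ∃ Y : MatFam (fun k : ℕ+ => k), (Y, (y : H →L[ℂ] H)) ∈ hM.limitPairs := by
  refine hM.exists_lift (E := fun m : ℕ => {k : ℕ+ | m < (k : ℕ)}) (fun m => ?_) ?_ y.2
  · exact eventually_ge_atTop (⟨m + 1, m.succ_pos⟩ : ℕ+)
  · refine Set.eq_empty_of_forall_notMem fun k hk => ?_
    exact lt_irrefl (k : ℕ) (Set.mem_iInter.1 hk (k : ℕ))

/-- Makes the chosen lifts in `embedding` immaterial, so that its algebraic laws reduce to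
`limitPairs` being a star subalgebra. -/
lemma IsMatrixModel.mk_eq_mk {ω : Ultrafilter ℕ+} (hω : (ω : Filter ℕ+) ≤ atTop)
    {Y Y' : MatFam (fun k : ℕ+ => k)} {y : H →L[ℂ] H} (hY : (Y, y) ∈ hM.limitPairs)
    (hY' : (Y', y) ∈ hM.limitPairs) :
    Ideal.Quotient.mk (nullIdeal ω) Y = Ideal.Quotient.mk (nullIdeal ω) Y' := by
  refine Ideal.Quotient.eq.2 (mem_nullIdeal_iff.2 ?_)
  have h := pair_sub hY hY'
  rw [sub_self] at h
  have h1 := ((hM.tendsto_hsNorm_zero h).mono_left hω).pow 2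
  simpa [hsNorm_sq] using h1

/-- The embedding into the matrix ultraproduct given by a matrix model. -/
def IsMatrixModel.embedding {ω : Ultrafilter ℕ+} (hω : (ω : Filter ℕ+) ≤ atTop) :
    N.toStarSubalgebra →⋆ₐ[ℂ] MatUltra ω where
  toFun y := Ideal.Quotient.mk (nullIdeal ω) (hM.exists_lift_atTop y).choose
  map_one' := by
    refine (hM.mk_eq_mk hω (hM.exists_lift_atTop 1).choose_spec (one_mem _)).trans ?_
    exact RingHom.map_one (Ideal.Quotient.mk (nullIdeal ω))
  map_mul' x y := by
    refine (hM.mk_eq_mk hω (hM.exists_lift_atTop (x * y)).choose_spec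
      (pair_mul (hM.exists_lift_atTop x).choose_spec (hM.exists_lift_atTop y).choose_spec)).trans ?_
    exact RingHom.map_mul (Ideal.Quotient.mk (nullIdeal ω)) _ _
  map_zero' := by
    refine (hM.mk_eq_mk hω (hM.exists_lift_atTop 0).choose_spec (zero_mem _)).trans ?_
    exact RingHom.map_zero (Ideal.Quotient.mk (nullIdeal ω))
  map_add' x y := by
    refine (hM.mk_eq_mk hω (hM.exists_lift_atTop (x + y)).choose_spec
      (pair_add (hM.exists_lift_atTop x).choose_spec (hM.exists_lift_atTop y).choose_spec)).trans ?_
    exact RingHom.map_add (Ideal.Quotient.mk (nullIdeal ω)) _ _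
  commutes' r := hM.mk_eq_mk hω (hM.exists_lift_atTop (algebraMap ℂ _ r)).choose_spec
    (pair_algebraMap r)
  map_star' x := hM.mk_eq_mk hω (hM.exists_lift_atTop (star x)).choose_spec
    (pair_star (hM.exists_lift_atTop x).choose_spec)

lemma IsMatrixModel.ultraTrace_embedding {ω : Ultrafilter ℕ+} (hω : (ω : Filter ℕ+) ≤ atTop)
    (y : N.toStarSubalgebra) :
    ultraTrace ω (hM.embedding hω y) = ⟪e, (y : H →L[ℂ] H) e⟫_ℂ :=
  Tendsto.limUnder_eq ((hM.tendsto_ntrace (hM.exists_lift_atTop y).choose_spec).mono_left hω)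

end Embedding

/-- The embedding of `L(G)` given by a matrix model is faithful and trace-preserving. -/
lemma embedding_mem_embeddings {G : Type*} [Group G]
    {𝒜 : StarSubalgebra ℂ (MatFam (fun k : ℕ+ => k) × (ell2 G →L[ℂ] ell2 G))}
    (hM : IsMatrixModel (d := fun k : ℕ+ => k) atTop (groupVN G) (delta (1 : G)) 𝒜)
    {ω : Ultrafilter ℕ+} (hω : (ω : Filter ℕ+) ≤ atTop) :
    hM.embedding hω ∈ Embeddings ω (groupTrace G) := by
  refine ⟨?_, fun a => hM.ultraTrace_embedding hω a⟩
  refine (injective_iff_map_eq_zero _).2 fun y hy => ?_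
  have h1 := hM.ultraTrace_embedding hω (star y * y)
  rw [map_mul, hy, mul_zero] at h1
  have h2 : ultraTrace ω (0 : MatUltra ω) = 0 :=
    Tendsto.limUnder_eq (by simp [ntrace])
  rw [h2] at h1
  have h3 : ⟪(delta (1 : G) : ell2 G), (star (y : ell2 G →L[ℂ] ell2 G) *
      (y : ell2 G →L[ℂ] ell2 G)) (delta 1)⟫_ℂ = 0 := h1.symm
  rw [mul_apply_eq_comp, ContinuousLinearMap.star_eq_adjoint,
    ContinuousLinearMap.adjoint_inner_right, inner_self_eq_zero] at h3
  exact Subtype.ext (groupVN_eq_zero y.2 h3)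

lemma ultrafilter_le_atTop {ω : Ultrafilter ℕ+} (hω : (ω : Filter ℕ+) ≤ Filter.cofinite) :
    (ω : Filter ℕ+) ≤ atTop := by
  refine hω.trans fun s hs => ?_
  obtain ⟨m, hm⟩ := mem_atTop_sets.1 hs
  refine mem_cofinite.2 ((Set.finite_Iio m).subset fun k hk => ?_)
  exact lt_of_not_ge fun h => hk (hm k h)

/-! ### Star words -/

section StarWord

variable {A B : Type*} [Ring A] [StarRing A] [Ring B] [StarRing B] {n : ℕ}

lemma starWord_nil (x : Fin n → A) : starWord x [] = 1 := rfl

lemma starWord_cons (x : Fin n → A) (q : Fin n × Bool) (w : List (Fin n × Bool)) :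
    starWord x (q :: w) = (if q.2 then star (x q.1) else x q.1) * starWord x w := rfl

lemma starWord_append (x : Fin n → A) (v w : List (Fin n × Bool)) :
    starWord x (v ++ w) = starWord x v * starWord x w := by
  rw [starWord, List.map_append, List.prod_append]
  rfl

lemma map_starWord (f : A → B) (h1 : f 1 = 1) (hmul : ∀ a b, f (a * b) = f a * f b)
    (hstar : ∀ a, f (star a) = star (f a)) (x : Fin n → A) (w : List (Fin n × Bool)) :
    f (starWord x w) = starWord (fun i => f (x i)) w := by
  induction w with
  | nil => exact h1
  | cons q w ih =>
    rw [starWord_cons, starWord_cons, hmul, ih]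
    split_ifs
    · rw [hstar]
    · rfl

end StarWord

/-! ### The filter of microstates -/

section Tuples

variable {p : ℕ} {H : Type*} [NormedAddCommGroup H] [InnerProductSpace ℂ H] [CompleteSpace H]

/-- The `p`-tuples of matrices of norm at most `R`. -/
def BddTuple (p : ℕ) (R : ℝ) (k : ℕ+) : Type := {X : Fin p → Mat k // ∀ i, ‖X i‖ ≤ R}

/-- The tuples of large matrices whose *-moments of length at most `m + 1` are close to those
of `x`. -/
def nearMoments (R : ℝ) (x : Fin p → H →L[ℂ] H) (e : H) (m : ℕ) : Set (Σ k, BddTuple p R k) :=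
  {c | m ≤ (c.1 : ℕ) ∧ ∀ w : List (Fin p × Bool), 1 ≤ w.length → w.length ≤ m + 1 →
    ‖ntrace (starWord c.2.1 w) - ⟪e, starWord x w e⟫_ℂ‖ < 1 / ((m : ℝ) + 1)}

lemma nearMoments_antitone (R : ℝ) (x : Fin p → H →L[ℂ] H) (e : H) :
    Antitone (nearMoments R x e) := by
  intro m m' hm c hc
  refine ⟨hm.trans hc.1, fun w h1 h2 => (hc.2 w h1 (by omega)).trans_le ?_⟩
  have : (m : ℝ) ≤ m' := by exact_mod_cast hm
  gcongr

/-- The filter of tuples of matrices whose *-moments converge to those of `x`. -/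
def momentFilter (R : ℝ) (x : Fin p → H →L[ℂ] H) (e : H) : Filter (Σ k, BddTuple p R k) :=
  ⨅ m, 𝓟 (nearMoments R x e m)

lemma mem_momentFilter {R : ℝ} {x : Fin p → H →L[ℂ] H} {e : H} {s : Set (Σ k, BddTuple p R k)} :
    s ∈ momentFilter R x e ↔ ∃ m, nearMoments R x e m ⊆ s := by
  refine (hasBasis_iInf_principal ?_).mem_iff.trans (by simp)
  exact (nearMoments_antitone R x e).directed_ge

lemma nearMoments_mem (R : ℝ) (x : Fin p → H →L[ℂ] H) (e : H) (m : ℕ) :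
    nearMoments R x e m ∈ momentFilter R x e := mem_momentFilter.2 ⟨m, subset_rfl⟩

/-- The `i`-th member of a tuple, as a matrix-valued function of the tuple. -/
def coordFam (R : ℝ) (i : Fin p) : ConfFam (BddTuple p R) :=
  ⟨fun c => c.2.1 i, memℓp_infty ⟨R, by rintro _ ⟨c, rfl⟩; exact c.2.2 i⟩⟩

/-- The star algebra generated by the pairs of coordinate functions and elements of `x`. -/
def tupleAlgebra (R : ℝ) (x : Fin p → H →L[ℂ] H) :
    StarSubalgebra ℂ (ConfFam (BddTuple p R) × (H →L[ℂ] H)) :=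
  StarAlgebra.adjoin ℂ (Set.range fun i => (coordFam R i, x i))

/-- The monoid generated by the pairs and their adjoints consists of star words, and the filter is
built to make traces of words converge. -/
theorem isMatrixModel_tupleAlgebra (R : ℝ) {x : Fin p → H →L[ℂ] H} {e : H}
    {N : VonNeumannAlgebra H} (hN : vnGenerated (Set.range x) = N) (he : ‖e‖ = 1)
    (ht : ∀ x ∈ N, ∀ y ∈ N, ⟪e, x (y e)⟫_ℂ = ⟪e, y (x e)⟫_ℂ) :
    IsMatrixModel (momentFilter R x e) N e (tupleAlgebra R x) := by
  refine isMatrixModel_adjoin _ ?_ he ht ?_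
  · rw [← hN, ← Set.range_comp]; rfl
  · intro z hz
    obtain ⟨w, rfl⟩ : ∃ w, z = starWord (fun i : Fin p =>
        ((coordFam R i, x i) : ConfFam (BddTuple p R) × (H →L[ℂ] H))) w := by
      induction hz using Submonoid.closure_induction with
      | mem z hz =>
        rcases hz with ⟨i, rfl⟩ | ⟨i, hi⟩
        · exact ⟨[(i, false)], by simp [starWord]⟩
        · refine ⟨[(i, true)], ?_⟩
          rw [← star_star z, ← hi]
          simp [starWord]
      | one => exact ⟨[], rfl⟩
      | mul y z _ _ hy hz =>
        obtain ⟨v, rfl⟩ := hy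
        obtain ⟨w, rfl⟩ := hz
        exact ⟨v ++ w, (starWord_append _ _ _).symm⟩
    have h1 : ∀ c : Σ k, BddTuple p R k, (starWord (fun i : Fin p =>
        ((coordFam R i, x i) : ConfFam (BddTuple p R) × (H →L[ℂ] H))) w).1 c =
          starWord c.2.1 w := fun c =>
      map_starWord (fun a : ConfFam (BddTuple p R) × (H →L[ℂ] H) => a.1 c) rfl
        (fun _ _ => rfl) (fun _ => rfl) _ w
    have h2 : (starWord (fun i : Fin p =>
        ((coordFam R i, x i) : ConfFam (BddTuple p R) × (H →L[ℂ] H))) w).2 = starWord x w :=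
      map_starWord Prod.snd rfl (fun _ _ => rfl) (fun _ => rfl) _ w
    rw [h2]
    refine Metric.tendsto_nhds.2 fun ε hε => ?_
    obtain ⟨m, hm⟩ := exists_nat_one_div_lt hε
    filter_upwards [nearMoments_mem R x e (max m w.length)] with c hc
    rw [h1, dist_eq_norm]
    -- `nearMoments` says nothing about the empty word, whose trace is `1` on both sides.
    rcases Nat.eq_zero_or_pos w.length with hw | hw
    · rw [List.length_eq_zero_iff.1 hw, starWord_nil, starWord_nil]
      have h3 : ntrace (1 : Mat c.1) = 1 := by
        have : ((c.1 : ℕ) : ℂ) ≠ 0 := by exact_mod_cast c.1.pos.ne'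
        rw [ntrace, Matrix.trace_one, Fintype.card_fin, inv_mul_cancel₀ this]
      have h4 : ⟪e, (1 : H →L[ℂ] H) e⟫_ℂ = 1 := by
        rw [one_apply_eq_self, inner_self_eq_norm_sq_to_K, he]; simp
      rw [h3, h4, sub_self, norm_zero]
      exact hε
    · refine (hc.2 w hw (by omega)).trans (lt_of_le_of_lt ?_ hm)
      have : (m : ℝ) ≤ (max m w.length : ℕ) := by exact_mod_cast le_max_left _ _
      gcongr

/-- The size condition `m ≤ k` in `nearMoments` is there for this: the diagonal argument behind
`exists_lift` needs an empty intersection. -/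
lemma iInter_nearMoments (R : ℝ) (x : Fin p → H →L[ℂ] H) (e : H) :
    ⋂ m, nearMoments R x e m = ∅ := by
  refine Set.eq_empty_of_forall_notMem fun c hc => ?_
  have := (Set.mem_iInter.1 hc ((c.1 : ℕ) + 1)).1
  omega

end Tuples

/-! ### Covering numbers from codes -/

section Covering

/-- One representative of each attained code serves as a center, so the centers lie in `Γ`. -/
lemma orbitCoveringNumber_le {n : ℕ} {k : ℕ+} {Γ : Set (Fin n → Mat k)} {δ : ℝ} {J : Type*}
    [Fintype J] (q : Γ → J) (hq : ∀ A B : Γ, q A = q B → ∃ W ∈ Matrix.unitaryGroup (Fin k) ℂ,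
      twoNorm (fun i => A.1 i - W * B.1 i * star W) < δ) :
    orbitCoveringNumber Γ δ ≤ Fintype.card J := by
  let F : Set (Fin n → Mat k) := Set.range fun j : Set.range q => (j.2.choose : Fin n → Mat k)
  refine iInf₂_le_of_le F ?_ (iInf_le_of_le ?_ ?_)
  · rintro _ ⟨j, rfl⟩
    exact j.2.choose.2
  · intro A hA
    have hj : q ⟨A, hA⟩ ∈ Set.range q := ⟨_, rfl⟩
    exact Set.mem_biUnion ⟨⟨_, hj⟩, rfl⟩ (hq ⟨A, hA⟩ _ hj.choose_spec.symm)
  · calc F.encard ≤ (Set.univ : Set (Set.range q)).encard := by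
          simp only [F]
          rw [← Set.image_univ]
          exact Set.encard_image_le _ _
      _ = (Set.range q).encard := Set.encard_univ _
      _ ≤ (Set.univ : Set J).encard := Set.encard_le_encard (Set.subset_univ _)
      _ = Fintype.card J := by rw [Set.encard_univ, ENat.card_eq_coe_fintype_card]

lemma one_le_orbitCoveringNumber {n : ℕ} {k : ℕ+} {Γ : Set (Fin n → Mat k)} (hΓ : Γ.Nonempty)
    (δ : ℝ) : 1 ≤ orbitCoveringNumber Γ δ := by
  refine le_iInf fun F => le_iInf₂ fun _ hF => Set.one_le_encard_iff_nonempty.2 ?_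
  obtain ⟨A, hA⟩ := hΓ
  obtain ⟨B, hB, -⟩ := Set.mem_iUnion₂.1 (hF hA)
  exact ⟨B, hB⟩

lemma twoNorm_lt {n : ℕ} {k : ℕ+} {A : Fin n → Mat k} {δ : ℝ} (hδ : 0 < δ)
    (hA : ∀ i, hsNorm (A i) ≤ δ / (n + 1)) : twoNorm A < δ := by
  rw [twoNorm, Real.sqrt_lt' hδ]
  have h1 : ∀ i, (ntrace (star (A i) * A i)).re ≤ (δ / (n + 1)) ^ 2 := fun i => by
    rw [ntrace_star_mul_self, Complex.ofReal_re, ← hsNorm_sq]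
    exact pow_le_pow_left₀ (hsNorm_nonneg _) (hA i) 2
  have hn : (0 : ℝ) ≤ n := Nat.cast_nonneg n
  calc _ ≤ ∑ _i : Fin n, (δ / (n + 1)) ^ 2 := Finset.sum_le_sum fun i _ => h1 i
    _ = n / (n + 1) ^ 2 * δ ^ 2 := by
        rw [Finset.sum_const, Finset.card_univ, Fintype.card_fin, nsmul_eq_mul]
        field_simp
    _ < 1 * δ ^ 2 := by
        refine mul_lt_mul_of_pos_right ?_ (by positivity)
        rw [div_lt_one (by positivity)]
        nlinarith
    _ = δ ^ 2 := one_mul _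

end Covering

/-! ### Microstates of `L(G)` -/

section Nbhd

variable {G : Type*} [Group G] {p : ℕ} {ω : Ultrafilter ℕ+}

lemma coe_starWord (x : Fin p → (groupVN G).toStarSubalgebra) (w : List (Fin p × Bool)) :
    ((starWord x w : (groupVN G).toStarSubalgebra) : ell2 G →L[ℂ] ell2 G) =
      starWord (fun i => (x i : ell2 G →L[ℂ] ell2 G)) w :=
  map_starWord (fun a : (groupVN G).toStarSubalgebra => (a : ell2 G →L[ℂ] ell2 G)) rfl
    (fun _ _ => rfl) (fun _ => rfl) x w

lemma ultraTrace_starWord {θ : (groupVN G).toStarSubalgebra →⋆ₐ[ℂ] MatUltra ω}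
    (hθ : θ ∈ Embeddings ω (groupTrace G)) (x : Fin p → (groupVN G).toStarSubalgebra)
    (w : List (Fin p × Bool)) :
    ultraTrace ω (starWord (fun i => θ (x i)) w) =
      ⟪(delta (1 : G) : ell2 G),
        starWord (fun i => (x i : ell2 G →L[ℂ] ell2 G)) w (delta 1)⟫_ℂ := by
  rw [← map_starWord θ (map_one θ) (map_mul θ) (map_star θ), hθ.2, groupTrace_eq, coe_starWord]

lemma nbhd_norm_le {R : ℝ} {ξ : ℕ+ → ℕ+} {x : Fin p → (groupVN G).toStarSubalgebra}
    {Y : Fin p → (k : ℕ+) → Mat k} (hY : Y ∈ nbhd ω (groupTrace G) R ξ x) (k : ℕ+) (i : Fin p) :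
    ‖proj k Y i‖ ≤ R := by
  obtain ⟨θ, -, hY⟩ := Set.mem_iUnion₂.1 hY
  exact (hY.1 i k).le

/-- Embeddings preserve the trace, so the prescribed moments do not depend on `θ` and one filter
handles the whole union. The natural number `m` corresponds to the positive index `m + 1` of `ξ`. -/
lemma nbhd_mem_nearMoments {R : ℝ} {ξ : ℕ+ → ℕ+} {x : Fin p → (groupVN G).toStarSubalgebra}
    {Y : Fin p → (k : ℕ+) → Mat k} (hY : Y ∈ nbhd ω (groupTrace G) R ξ x) {m : ℕ} {k : ℕ+}
    (hm : m ≤ (k : ℕ)) (hk : ξ m.succPNat ≤ k) :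
    (⟨k, proj k Y, nbhd_norm_le hY k⟩ : Σ k, BddTuple p R k) ∈
      nearMoments R (fun i => (x i : ell2 G →L[ℂ] ell2 G)) (delta (1 : G)) m := by
  obtain ⟨θ, hθ, hY⟩ := Set.mem_iUnion₂.1 hY
  refine ⟨hm, fun w h1 h2 => ?_⟩
  have h := hY.2 m.succPNat k hk w h1 (by simpa using h2)
  have e : ((m.succPNat : ℕ) : ℝ) = m + 1 := by simp
  rw [ultraTrace_starWord hθ, e] at h
  exact h

/-- Matrix models of `L(G)` along `atTop` provide microstates. -/
lemma exists_nbhd_nonempty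
    {𝒜 : StarSubalgebra ℂ (MatFam (fun k : ℕ+ => k) × (ell2 G →L[ℂ] ell2 G))}
    (hM : IsMatrixModel (d := fun k : ℕ+ => k) atTop (groupVN G) (delta (1 : G)) 𝒜)
    (hω : (ω : Filter ℕ+) ≤ atTop) (x : Fin p → (groupVN G).toStarSubalgebra) :
    ∃ R > 0, ∃ ξ ∈ Xi, (nbhd ω (groupTrace G) R ξ x).Nonempty := by
  choose Y hY using fun i => hM.exists_lift_atTop (x i)
  have hlim : ∀ w : List (Fin p × Bool),
      Tendsto (fun k : ℕ+ => ntrace (starWord (fun i => (Y i k : Mat k)) w)) atTop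
        (𝓝 ⟪(delta (1 : G) : ell2 G),
          starWord (fun i => (x i : ell2 G →L[ℂ] ell2 G)) w (delta 1)⟫_ℂ) := by
    intro w
    have h1 : starWord (fun i => (Y i, (x i : ell2 G →L[ℂ] ell2 G))) w ∈ hM.limitPairs := by
      induction w with
      | nil => exact one_mem _
      | cons q w ih =>
        rw [starWord_cons]
        refine mul_mem ?_ ih
        split_ifs
        · exact star_mem (hY q.1)
        · exact hY q.1
    have h2 := hM.tendsto_ntrace h1
    have h3 : ∀ k : ℕ+, (starWord (fun i => (Y i, (x i : ell2 G →L[ℂ] ell2 G))) w).1 k =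
        starWord (fun i => (Y i k : Mat k)) w := fun k =>
      map_starWord (fun a : MatFam (fun k : ℕ+ => k) × (ell2 G →L[ℂ] ell2 G) => a.1 k) rfl
        (fun _ _ => rfl) (fun _ => rfl) _ w
    have h4 : (starWord (fun i => (Y i, (x i : ell2 G →L[ℂ] ell2 G))) w).2 =
        starWord (fun i => (x i : ell2 G →L[ℂ] ell2 G)) w :=
      map_starWord Prod.snd rfl (fun _ _ => rfl) (fun _ => rfl) _ w
    simp_rw [h3, h4] at h2
    exact h2
  have hev : ∀ m : ℕ+, ∃ K : ℕ+, ∀ k, K ≤ k → ∀ w : List (Fin p × Bool), w.length ≤ (m : ℕ) →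
      ‖ntrace (starWord (fun i => (Y i k : Mat k)) w) - ⟪(delta (1 : G) : ell2 G),
        starWord (fun i => (x i : ell2 G →L[ℂ] ell2 G)) w (delta 1)⟫_ℂ‖ < 1 / ((m : ℕ) : ℝ) := by
    intro m
    have hm : (0 : ℝ) < 1 / ((m : ℕ) : ℝ) := by
      have : (0 : ℝ) < ((m : ℕ) : ℝ) := by exact_mod_cast m.pos
      positivity
    have h := (List.finite_length_le (Fin p × Bool) (m : ℕ)).eventually_all
      (l := (atTop : Filter ℕ+)) (p := fun w k =>
        ‖ntrace (starWord (fun i => (Y i k : Mat k)) w) - ⟪(delta (1 : G) : ell2 G),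
        starWord (fun i => (x i : ell2 G →L[ℂ] ell2 G)) w (delta 1)⟫_ℂ‖ < 1 / ((m : ℕ) : ℝ))
    obtain ⟨K, hK⟩ := eventually_atTop.1 (h.2 fun w _ =>
      (((hlim w).sub_const _).norm.eventually_lt_const (by simp)))
    exact ⟨K, fun k hk w hw => hK k hk w hw⟩
  choose K hK using hev
  -- The summand `1` makes the norm bound strict, and the maximum with `m` makes the sequence tend
  -- to infinity.
  refine ⟨1 + ∑ i, ‖Y i‖, by positivity, fun m => max (K m) m,
    tendsto_atTop_mono (fun m => le_max_right _ _) tendsto_id, fun i k => Y i k,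
    Set.mem_iUnion₂.2 ⟨_, embedding_mem_embeddings hM hω, ?_, ?_⟩⟩
  · intro i k
    calc ‖Y i k‖ ≤ ‖Y i‖ := lp.norm_apply_le_norm ENNReal.top_ne_zero (Y i) k
      _ ≤ ∑ i, ‖Y i‖ := Finset.single_le_sum (f := fun i => ‖Y i‖)
          (fun i _ => norm_nonneg _) (Finset.mem_univ i)
      _ < 1 + ∑ i, ‖Y i‖ := by linarith
  · intro m k hk w _ hw
    rw [ultraTrace_starWord (embedding_mem_embeddings hM hω)]
    exact hK m k ((le_max_left _ _).trans hk) w hw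

end Nbhd

/-! ### The embedding dimension -/

section Dimension

variable {G : Type*} [Group G] {p : ℕ} {ω : Ultrafilter ℕ+}

/-- All matrix models of `L(G)` have small orbits. -/
def HasSmallMatrixModels (G : Type*) [Group G] : Prop :=
  ∀ {C : ℕ+ → Type} {𝓕 : Filter (Σ k, C k)}
    {𝒜 : StarSubalgebra ℂ (ConfFam C × (ell2 G →L[ℂ] ell2 G))}
    (hM : IsMatrixModel 𝓕 (groupVN G) (delta (1 : G)) 𝒜) {U : G → ConfFam C},
    (∀ g, (U g, leftRegular g) ∈ hM.limitPairs) → (∀ m : ℕ, ∀ᶠ i in 𝓕, m ≤ (i.1 : ℕ)) →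
      HasSmallOrbits 𝓕 (U '' Set.univ)

/-- The group elements are lifted along the microstates of the generators and their orbits counted;
the coordinates are then recovered, being lifts of elements of `L(G)`. -/
lemma HasSmallMatrixModels.hasSmallOrbits_coordFam (hG : HasSmallMatrixModels G) (R : ℝ)
    {x : Fin p → (groupVN G).toStarSubalgebra} (hx : Generates (groupVN G) x) :
    HasSmallOrbits (momentFilter R (fun i => (x i : ell2 G →L[ℂ] ell2 G)) (delta (1 : G)))
      (Set.range (coordFam R)) := by
  have hM := isMatrixModel_tupleAlgebra R hx (norm_delta (1 : G)) groupVN_tracial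
  choose U hU using fun g : G =>
    hM.exists_lift (nearMoments_mem R _ _) (iInter_nearMoments R _ _) (leftRegular_mem g)
  refine (hG hM hU fun m => mem_of_superset (nearMoments_mem R _ _ m)
    fun c hc => hc.1).of_isDetermined ?_
  rintro _ ⟨i, rfl⟩
  exact isDetermined_of_mem_groupVN hM hU
    (hM.le_limitPairs (StarAlgebra.subset_adjoin ℂ _ ⟨i, rfl⟩))

/-- The orbit covering numbers of the microstates of generators grow slower than
`exp(θ k²)`. -/
lemma HasSmallMatrixModels.eventually_orbitCoveringNumber_le (hG : HasSmallMatrixModels G)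
    (hω : (ω : Filter ℕ+) ≤ atTop) {x : Fin p → (groupVN G).toStarSubalgebra}
    (hx : Generates (groupVN G) x) (R : ℝ) (ξ : ℕ+ → ℕ+) {δ θ : ℝ} (hδ : 0 < δ) (hθ : 0 < θ) :
    ∀ᶠ k : ℕ+ in (ω : Filter ℕ+), ∃ n : ℕ, (n : ℝ) ≤ Real.exp (θ * ((k : ℕ) : ℝ) ^ 2) ∧
      orbitCoveringNumber (proj k '' nbhd ω (groupTrace G) R ξ x) δ ≤ n := by
  classical
  obtain ⟨E, hE, h⟩ := hG.hasSmallOrbits_coordFam R hx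
    (Finset.univ.image (coordFam R)) (by simp) (δ / (p + 1)) (by positivity) θ hθ
  obtain ⟨m, hm⟩ := mem_momentFilter.1 hE
  have hk : ∀ᶠ k : ℕ+ in (ω : Filter ℕ+), ξ m.succPNat ≤ k ∧ m.succPNat ≤ k :=
    hω ((eventually_ge_atTop _).and (eventually_ge_atTop _))
  filter_upwards [hk] with k hk
  have hmk : m ≤ (k : ℕ) := (Nat.le_succ m).trans hk.2
  obtain ⟨J, hJ, q, hcard, hq⟩ := h k
  refine ⟨Fintype.card J, hcard, ?_⟩
  have hΓ : ∀ A : proj k '' nbhd ω (groupTrace G) R ξ x, ∃ X : BddTuple p R k,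
      X.1 = A.1 ∧ (⟨k, X⟩ : Σ k, BddTuple p R k) ∈ E := by
    rintro ⟨_, Y, hY, rfl⟩
    exact ⟨⟨proj k Y, nbhd_norm_le hY k⟩, rfl, hm (nbhd_mem_nearMoments hY hmk hk.1)⟩
  choose X hX hXE using hΓ
  refine orbitCoveringNumber_le (fun A => q (X A)) fun A B hAB => ?_
  obtain ⟨W, hW, hd⟩ := hq (X A) (X B) (hXE A) (hXE B) hAB
  refine ⟨W, hW, twoNorm_lt hδ fun i => ?_⟩
  rw [← hX A, ← hX B]
  exact hd (coordFam R i) (Finset.mem_image_of_mem _ (Finset.mem_univ i))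

/-- `EReal` is compact, so the ultrafilter limit exists and `limUnder` has its intended meaning. -/
lemma tendsto_embDimAt (s : ℝ) (x : Fin p → (groupVN G).toStarSubalgebra) (R : ℝ)
    (ξ : ℕ+ → ℕ+) (δ : ℝ) :
    Tendsto (fun k : ℕ+ => ENNReal.log (orbitCoveringNumber
      (proj k '' nbhd ω (groupTrace G) R ξ x) δ : ℝ≥0∞) / ((((k : ℕ) : ℝ) ^ (2 * s) : ℝ) : EReal))
      (ω : Filter ℕ+) (𝓝 (embDimAt ω s (groupTrace G) x R ξ δ)) := by
  refine tendsto_nhds_limUnder ?_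
  obtain ⟨L, -, hL⟩ := isCompact_univ.ultrafilter_le_nhds (ω.map fun k : ℕ+ =>
    ENNReal.log (orbitCoveringNumber (proj k '' nbhd ω (groupTrace G) R ξ x) δ : ℝ≥0∞) /
      ((((k : ℕ) : ℝ) ^ (2 * s) : ℝ) : EReal)) (by simp)
  exact ⟨L, hL⟩

lemma HasSmallMatrixModels.embDimAt_le (hG : HasSmallMatrixModels G)
    (hω : (ω : Filter ℕ+) ≤ atTop) {x : Fin p → (groupVN G).toStarSubalgebra}
    (hx : Generates (groupVN G) x) (R : ℝ) (ξ : ℕ+ → ℕ+) {δ : ℝ} (hδ : 0 < δ) :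
    embDimAt ω 1 (groupTrace G) x R ξ δ ≤ 0 := by
  by_contra! hpos
  obtain ⟨θ, h0, h1⟩ := EReal.lt_iff_exists_real_btwn.1 hpos
  have hθ : 0 < θ := by exact_mod_cast h0
  refine absurd h1 (not_lt.2 (le_of_tendsto (tendsto_embDimAt 1 x R ξ δ) ?_))
  filter_upwards [hG.eventually_orbitCoveringNumber_le hω hx R ξ hδ hθ] with k hk
  obtain ⟨n, hn, hle⟩ := hk
  have hk0 : (0 : ℝ) < ((k : ℕ) : ℝ) := by exact_mod_cast k.pos
  have hpow : ((k : ℕ) : ℝ) ^ (2 * (1 : ℝ)) = ((k : ℕ) : ℝ) ^ 2 := by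
    rw [mul_one]; exact Real.rpow_two _
  have hpos : (0 : ℝ) < ((k : ℕ) : ℝ) ^ 2 := by positivity
  rw [hpow, EReal.div_le_iff_le_mul (by exact_mod_cast hpos) (EReal.coe_ne_top _)]
  have h2 : (orbitCoveringNumber (proj k '' nbhd ω (groupTrace G) R ξ x) δ : ℝ≥0∞) ≤
      ENNReal.ofReal (Real.exp (θ * ((k : ℕ) : ℝ) ^ 2)) := by
    refine (ENat.toENNReal_le.2 hle).trans ?_
    rw [ENat.toENNReal_coe, ← ENNReal.ofReal_natCast]
    exact ENNReal.ofReal_le_ofReal hn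
  refine (ENNReal.log_le_log h2).trans (le_of_eq ?_)
  rw [ENNReal.log_ofReal_of_pos (Real.exp_pos _), Real.log_exp, ← EReal.coe_mul, mul_comm]

/-- One microstate makes every covering number at least `1`, so no logarithm is negative. -/
lemma embDimAt_nonneg {x : Fin p → (groupVN G).toStarSubalgebra} {R : ℝ} {ξ : ℕ+ → ℕ+}
    (hne : (nbhd ω (groupTrace G) R ξ x).Nonempty) (s δ : ℝ) :
    0 ≤ embDimAt ω s (groupTrace G) x R ξ δ := by
  refine ge_of_tendsto (tendsto_embDimAt s x R ξ δ) (Eventually.of_forall fun k => ?_)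
  refine EReal.div_nonneg ?_ ?_
  · rw [← ENNReal.log_one]
    refine ENNReal.log_le_log ?_
    have := ENat.toENNReal_le.2 (one_le_orbitCoveringNumber (hne.image (proj k)) δ)
    simpa using this
  · exact EReal.coe_nonneg.2 (by positivity)

/-- The supremum at each `δ > 0` is already `0`: a single pair `R`, `ξ` with microstates gives the
lower bound for all `δ` at once. -/
theorem HasSmallMatrixModels.embDim_eq_zero (hG : HasSmallMatrixModels G)
    {𝒜 : StarSubalgebra ℂ (MatFam (fun k : ℕ+ => k) × (ell2 G →L[ℂ] ell2 G))}
    (hM : IsMatrixModel (d := fun k : ℕ+ => k) atTop (groupVN G) (delta (1 : G)) 𝒜)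
    (hω : (ω : Filter ℕ+) ≤ atTop) {x : Fin p → (groupVN G).toStarSubalgebra}
    (hx : Generates (groupVN G) x) : embDim ω 1 (groupTrace G) x = 0 := by
  obtain ⟨R, hR, ξ, hξ, hne⟩ := exists_nbhd_nonempty hM hω x
  rw [embDim, limsup_congr (v := fun _ => (0 : EReal)), limsup_const]
  filter_upwards [self_mem_nhdsWithin] with δ hδ
  refine le_antisymm ?_ ?_
  · exact iSup₂_le fun R _ => iSup₂_le fun ξ _ => hG.embDimAt_le hω hx R ξ hδ
  · exact (embDimAt_nonneg hne 1 δ).trans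
      (le_iSup₂_of_le R hR (le_iSup₂_of_le ξ hξ le_rfl))

/-- The von Neumann algebra of a finitely generated group is finitely generated. -/
lemma exists_generates {S : Set G} (hS : S.Finite) (hcl : Subgroup.closure S = ⊤) :
    ∃ (n : ℕ) (x : Fin n → (groupVN G).toStarSubalgebra), Generates (groupVN G) x := by
  obtain ⟨n, f, -, hf⟩ := hS.fin_param
  refine ⟨n, fun i => ⟨leftRegular (f i), leftRegular_mem (f i)⟩, SetLike.ext fun y => ?_⟩
  change y ∈ vnGenerated _ ↔ y ∈ vnGenerated _
  rw [mem_vnGenerated, mem_vnGenerated]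
  refine forall_congr' fun z => imp_congr_left ⟨?_, ?_⟩
  · intro h
    have hall : ∀ g : G, leftRegular g * z = z * leftRegular g := by
      intro g
      have hg : g ∈ Subgroup.closure S := by rw [hcl]; trivial
      induction hg using Subgroup.closure_induction'' with
      | mem a ha =>
        obtain ⟨i, rfl⟩ := hf.symm ▸ ha
        exact (h _ ⟨i, rfl⟩).1
      | inv_mem a ha =>
        obtain ⟨i, rfl⟩ := hf.symm ▸ ha
        rw [← star_leftRegular]
        exact (h _ ⟨i, rfl⟩).2
      | one => rw [leftRegular_one, one_mul, mul_one]
      | mul a b _ _ ha hb =>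
        rw [leftRegular_mul, mul_assoc, hb, ← mul_assoc, ha, mul_assoc]
    rintro _ ⟨g, rfl⟩
    refine ⟨hall g, ?_⟩
    rw [star_leftRegular]
    exact hall g⁻¹
  · rintro h _ ⟨i, rfl⟩
    exact h _ ⟨f i, rfl⟩

end Dimension

/-- `ℋ_1^ω(L(SL_ι(ℤ))) = 0` for `|ι| ≠ 2`. -/
theorem hasEmbDim_specialLinearGroup {ι : Type*} [Fintype ι] [DecidableEq ι]
    (hι : Fintype.card ι ≠ 2) {ω : Ultrafilter ℕ+} (hω : (ω : Filter ℕ+) ≤ Filter.cofinite) :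
    HasEmbDim ω 1 (groupVN (Matrix.SpecialLinearGroup ι ℤ))
      (groupTrace (Matrix.SpecialLinearGroup ι ℤ)) 0 := by
  have hω' := ultrafilter_le_atTop hω
  obtain ⟨π, hπ⟩ := exists_hom_perm_specialLinearGroup ι
  obtain ⟨𝒜, hM⟩ := exists_isMatrixModel_of_perm π hπ
  have hG : HasSmallMatrixModels (Matrix.SpecialLinearGroup ι ℤ) := fun hM U hU hk =>
    hasSmallOrbits_specialLinearGroup hι hM hU hk
  exact ⟨exists_generates finite_elementaryMatrices closure_elementaryMatrices,
    ⟨_, embedding_mem_embeddings hM hω'⟩, fun _ _ hx => hG.embDim_eq_zero hM hω' hx⟩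

end EmbDim

end

theorem theorem10 (n : ℕ) (ω : Ultrafilter ℕ+) (hω : (ω : Filter ℕ+) ≤ Filter.cofinite) :
    EmbDim.HasEmbDim ω 1
      (EmbDim.groupVN (Matrix.SpecialLinearGroup (Fin (2 * n + 1)) ℤ))
      (EmbDim.groupTrace (Matrix.SpecialLinearGroup (Fin (2 * n + 1)) ℤ)) 0 := by
  refine EmbDim.hasEmbDim_specialLinearGroup ?_ hω
  rw [Fintype.card_fin]
  omega
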